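/- Let $d\ge 1$, let $\mathbb T^d=(\mathbb R/\mathbb Z)^d$ be the flat torus, and let $q>1$, $r>1$, with $p$ the conjugate exponent of $q$, i.e. $\frac1p+\frac1q=1$. Assume: (H1) $f:\mathbb T^d\times[0,\infty)\to\mathbb R$ is continuous, $f(x,\cdot)$ is strictly increasing for every $x$, and there is $C>0$ with $\frac1C m^{q-1}-C\le f(x,m)\le C m^{q-1}+C$ for all $(x,m)\in\mathbb T^d\times[0,\infty)$. (H2) $H:\mathbb T^d\times\mathbb R^d\to\mathbb R$ is continuous, $H(x,\cdot)$ is strictly convex and differentiable for every $x$, $D_pH$ is continuous on $\mathbb T^d\times\mathbb R^d$, and there is $C>0$ with $\frac1C|\xi|^{r}-C\le H(x,\xi)\le C|\xi|^{r}+C$ for all $(x,\xi)\in\mathbb T^d\times\mathbb R^d$. For $\varepsilon>0$ consider the discount mean field game system $$\varepsilon u+H(x,Du)=f(x,m),\qquad \varepsilon m-\operatorname{div}\bigl(m\,D_pH(x,Du)\bigr)=\varepsilon\qquad\text{in }\mathbb T^d. \tag{DP}$$ A pair $(u,m)\in W^{1,pr}(\mathbb T^d)\times L^q(\mathbb T^d)$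 is called a weak solution of (DP) if (i) $m\ge0$ a.e., $\int_{\mathbb T^d}m\,dx=1$ and $m\,D_pH(\cdot,Du)\in L^1(\mathbb T^d)$; (ii) $\varepsilon u+H(x,Du)=f(x,m)$ a.e. in $\{m>0\}$, and $\varepsilon u+H(x,Du)\le f(x,m)$ a.e. in $\mathbb T^d$; (iii) the second equation of (DP) holds in the sense of distributions, i.e. $\varepsilon\int m\psi\,dx+\int m\,D_pH(x,Du)\cdot D\psi\,dx=\varepsilon\int\psi\,dx$ for all $\psi\in C^1(\mathbb T^d)$. Then for every $\varepsilon>0$ the system (DP) has exactly one weak solution $(u^\varepsilon,m^\varepsilon)\in W^{1,pr}(\mathbb T^d)\times L^q(\mathbb T^d)$ (functions that agree a.e. being identified). Moreover, if $pr>d$, then $u^\varepsilon$ has a continuous representative, and this representative satisfies $$\varepsilon u^\varepsilon+H(x,Du^\varepsilon)\ge f(x,0)\quad\text{in }\mathbb T^d$$ in the viscosity sense: whenever $\psi\in C^1(\mathbb T^d)$ and $u^\varepsilon-\psi$ has a local minimum at $x_0$, one has $\varepsilon u^\varepsilon(x_0)+H(x_0,D\psi(x_0))\ge f(x_0,0)$.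 -/

import Mathlib

open MeasureTheory Set
open scoped ContDiff ENNReal

noncomputable section

namespace DiscountMFG

/-- The flat torus `𝕋^d = (ℝ/ℤ)^d`; its `volume` is Lebesgue measure, of total mass one. -/
abbrev Torus (d : ℕ) : Type := UnitAddTorus (Fin d)

/-- `ℝ^d` with its Euclidean norm. -/
abbrev Space (d : ℕ) : Type := EuclideanSpace ℝ (Fin d)

/-- The covering map `ℝ^d → 𝕋^d`. -/
def toTorus {d : ℕ} (y : Space d) : Torus d := fun i => (y i : UnitAddCircle)

/-- `ψ` is of class `C^n` on the torus: its periodic lift to `ℝ^d` is of class `C^n`. -/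
def IsCn {d : ℕ} (n : ℕ∞) (ψ : Torus d → ℝ) : Prop :=
  ContDiff ℝ n (fun y : Space d => ψ (toTorus y))

/-- The gradient `Dψ(x)` of a function on the torus, for differentiable `ψ`. -/
def torusGrad {d : ℕ} (ψ : Torus d → ℝ) (x : Torus d) : Space d :=
  gradient (fun y : Space d => ψ (x + toTorus y)) 0

/-- `G` is the weak (distributional) gradient of `u` on the torus. It is used for integrable
`u` and `G` only. -/
def HasWeakGrad {d : ℕ} (u : Torus d → ℝ) (G : Torus d → Space d) : Prop :=
  ∀ ψ : Torus d → ℝ, IsCn ⊤ ψ → ∀ i : Fin d,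
    ∫ x, u x * torusGrad ψ x i = - ∫ x, G x i * ψ x

/-- The Sobolev space `W^{1,s}(𝕋^d)`, as a set of classes in `L^s(𝕋^d)`. -/
def W1 (d : ℕ) (s : ℝ) : Set (Lp ℝ (ENNReal.ofReal s) (volume : Measure (Torus d))) :=
  {u | ∃ G : Torus d → Space d, MemLp G (ENNReal.ofReal s) volume ∧ HasWeakGrad u G}

/-- Assumptions on the coupling `f : 𝕋^d × [0,∞) → ℝ`. The values of `f x` at negative numbers
play no role. -/
structure IsCoupling {d : ℕ} (f : Torus d → ℝ → ℝ) (q : ℝ) : Prop where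
  continuousOn : ContinuousOn (fun z : Torus d × ℝ => f z.1 z.2) (univ ×ˢ Ici 0)
  strictMonoOn : ∀ x, StrictMonoOn (f x) (Ici 0)
  growth : ∃ C : ℝ, 0 < C ∧ ∀ x, ∀ m : ℝ, 0 ≤ m →
    1 / C * |m| ^ (q - 1) - C ≤ f x m ∧ f x m ≤ C * |m| ^ (q - 1) + C

/-- Assumptions on the Hamiltonian `H : 𝕋^d × ℝ^d → ℝ`; `gradient (H x) ξ` is `D_pH(x,ξ)`. -/
structure IsHamiltonian {d : ℕ} (H : Torus d → Space d → ℝ) (r : ℝ) : Prop where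
  continuous : Continuous (fun z : Torus d × Space d => H z.1 z.2)
  strictConvexOn : ∀ x, StrictConvexOn ℝ univ (H x)
  differentiable : ∀ x, Differentiable ℝ (H x)
  continuous_grad : Continuous (fun z : Torus d × Space d => gradient (H z.1) z.2)
  growth : ∃ C : ℝ, 0 < C ∧ ∀ x, ∀ ξ : Space d,
    1 / C * ‖ξ‖ ^ r - C ≤ H x ξ ∧ H x ξ ≤ C * ‖ξ‖ ^ r + C

/-- The requirements on a weak solution `(u, m)` of the system
`ε u + H(x, Du) = f(x, m)`, `ε m - div (m D_pH(x, Du)) = ε`,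
where the function `Du` is the weak gradient of `u`. -/
structure WeakSystem {d : ℕ} (ε : ℝ) (H : Torus d → Space d → ℝ) (f : Torus d → ℝ → ℝ)
    (u : Torus d → ℝ) (Du : Torus d → Space d) (m : Torus d → ℝ) : Prop where
  nonneg : ∀ᵐ x, 0 ≤ m x
  mass : ∫ x, m x = 1
  integrable_flux : Integrable (fun x => m x • gradient (H x) (Du x)) volume
  eq_on_pos : ∀ᵐ x, 0 < m x → ε * u x + H x (Du x) = f x (m x)
  le_ae : ∀ᵐ x, ε * u x + H x (Du x) ≤ f x (m x)
  transport : ∀ ψ : Torus d → ℝ, IsCn 1 ψ →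
    ε * (∫ x, m x * ψ x) + ∫ x, inner ℝ (m x • gradient (H x) (Du x)) (torusGrad ψ x)
      = ε * ∫ x, ψ x

/-- `(u, m) ∈ W^{1,s} × L^q` is a weak solution of the discount mean field game system. The weak
gradient of `u` is unique up to null sets, so that it does not matter which one is taken. -/
def IsWeakSolution {d : ℕ} (ε : ℝ) (H : Torus d → Space d → ℝ) (f : Torus d → ℝ → ℝ) {s q : ℝ}
    (u : W1 d s) (m : Lp ℝ (ENNReal.ofReal q) (volume : Measure (Torus d))) : Prop :=
  ∃ Du : Torus d → Space d, MemLp Du (ENNReal.ofReal s) volume ∧ HasWeakGrad u.1 Du ∧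
    WeakSystem ε H f u.1 Du m

/-- `v` is a viscosity supersolution of `ε v + H(x, Dv) = g(x)` on the torus. -/
def IsViscositySupersolution {d : ℕ} (ε : ℝ) (H : Torus d → Space d → ℝ) (g : Torus d → ℝ)
    (v : C(Torus d, ℝ)) : Prop :=
  ∀ ψ : Torus d → ℝ, IsCn 1 ψ → ∀ x₀ : Torus d, IsLocalMin (fun x => v x - ψ x) x₀ →
    g x₀ ≤ ε * v x₀ + H x₀ (torusGrad ψ x₀)

end DiscountMFG

end

noncomputable section

namespace DiscountMFG

open Filter Topology

section

variable {d : ℕ}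

/-! ### Calculus on the torus -/

/-! The system is the Euler–Lagrange equation of a convex functional. Let `M x` be the inverse of `f
x`, extended by zero below `f x 0`, and let `B x` be a primitive of `M x`. For J(u) = ∫ B(x, εu +
H(x,Du)) - ε∫u, a minimizer u with m = M(x, εu + H(x,Du)) makes the first variation of J vanish,
which is the transport equation; the Hamilton–Jacobi relations are the definition of M, and the test
function 1 gives the mass. J is convex because B is convex and nondecreasing and H is convex. Since
(p-1)(q-1) = 1, B grows like the p-th power of the positive part, so W^{1,pr} is the natural space
and m lies in L^q.

Existence (`exists_minimizer`): sublevels of J are bounded in W^{1,pr} (`energy_coercive`, by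
Poincaré and absorption). No weak compactness is used. A minimizing sequence is chosen that is also
almost minimal, among competitors of comparable energy, for the strictly convex functional ∫ √(1+u²)
+ ∫ √(1+|Du|²) (`exists_minimizing_seq`). Midpoints are again competitors, so the convexity gaps of
this functional tend to zero; with the Sobolev bound this makes u and Du Cauchy in L^1
(`cauchy_of_bracketGap`), and Fatou gives lower semicontinuity.

Uniqueness: the transport equations of two solutions are subtracted and tested with u₁ - u₂. The
integrand is nonnegative by monotonicity of f and convexity of H (`monotonicity_pointwise`); its
vanishing gives m₁ = m₂, and u₁ = u₂ where m₁ > 0. Testing next with a function of (u₁ - u₂)₊, which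
vanishes where m₁ > 0, leaves only the right-hand side ε∫, so u₁ ≤ u₂ almost everywhere; then the
roles are exchanged (`ae_le_of_ae_eq_on_pos`).

Viscosity property: if it failed at x₀, a test function φ touching u from below there could be
raised slightly so that εφ + H(x,Dφ) < f(x,0) on {φ > u}. Testing with a function of (φ - u)₊ and
using convexity of H, the left side of the transport equation is ≤ 0 and the right side is > 0.
Continuity of u for pr > d is Morrey's inequality.

Both applications need Sobolev test functions (`WeakSystem.transport_comp`), hence the density of
C^1 functions by mollification. -/

instance : IsProbabilityMeasure (volume : Measure UnitAddCircle) :=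
  ⟨UnitAddCircle.measure_univ⟩

instance : IsProbabilityMeasure (volume : Measure (Torus d)) :=
  inferInstanceAs (IsProbabilityMeasure (Measure.pi fun _ => volume))

theorem toTorus_add (a b : Space d) : toTorus (a + b) = toTorus a + toTorus b := by
  ext i; simp [toTorus]

theorem toTorus_neg (a : Space d) : toTorus (-a) = -toTorus a := by
  ext i; simp [toTorus]

@[simp] theorem toTorus_zero : toTorus (0 : Space d) = 0 := by
  ext i; simp [toTorus]

theorem continuous_toTorus : Continuous (toTorus : Space d → Torus d) :=
  continuous_pi fun i => (AddCircle.continuous_mk' 1).comp (EuclideanSpace.proj i).continuous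

theorem isOpenQuotientMap_toTorus : IsOpenQuotientMap (toTorus : Space d → Torus d) := by
  have h : IsOpenQuotientMap (Pi.map fun (_ : Fin d) (y : ℝ) => (y : UnitAddCircle)) :=
    IsOpenQuotientMap.piMap fun _ => QuotientAddGroup.isOpenQuotientMap_mk
  exact h.comp (EuclideanSpace.equiv (Fin d) ℝ).toHomeomorph.isOpenQuotientMap

theorem toTorus_surjective : Function.Surjective (toTorus : Space d → Torus d) :=
  isOpenQuotientMap_toTorus.surjective

theorem IsCn.continuous {n : ℕ∞} {ψ : Torus d → ℝ} (h : IsCn n ψ) : Continuous ψ :=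
  isOpenQuotientMap_toTorus.isQuotientMap.continuous_iff.2 (ContDiff.continuous h)

theorem IsCn.of_le {m n : ℕ∞} {ψ : Torus d → ℝ} (h : IsCn n ψ) (hmn : m ≤ n) : IsCn m ψ :=
  ContDiff.of_le h (by exact_mod_cast hmn)

theorem IsCn.comp_add_right {n : ℕ∞} {ψ : Torus d → ℝ} (h : IsCn n ψ) (a : Torus d) :
    IsCn n (fun x => ψ (x + a)) := by
  obtain ⟨b, rfl⟩ := toTorus_surjective a
  have : ContDiff ℝ n (fun y : Space d => ψ (toTorus (y + b))) :=
    ContDiff.comp (g := fun y : Space d => ψ (toTorus y)) h (contDiff_id.add contDiff_const)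
  simpa [IsCn, toTorus_add] using this

theorem IsCn.contDiff_add {n : ℕ∞} {ψ : Torus d → ℝ} (h : IsCn n ψ) (a : Torus d) :
    ContDiff ℝ n (fun y : Space d => ψ (a + toTorus y)) := by
  simpa [IsCn, add_comm] using h.comp_add_right a

theorem IsCn.hasGradientAt {ψ : Torus d → ℝ} (h : IsCn 1 ψ) (x : Torus d) (y : Space d) :
    HasGradientAt (fun y : Space d => ψ (x + toTorus y)) (torusGrad ψ (x + toTorus y)) y := by
  have hd : DifferentiableAt ℝ (fun y : Space d => ψ (x + toTorus y)) y :=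
    (h.contDiff_add x).differentiable (by simp) y
  have : torusGrad ψ (x + toTorus y) = gradient (fun y : Space d => ψ (x + toTorus y)) y := by
    unfold torusGrad gradient
    have := fderiv_comp_add_left (𝕜 := ℝ) (f := fun y : Space d => ψ (x + toTorus y)) (x := 0) y
    simp only [toTorus_add, ← add_assoc] at this
    rw [this, add_zero]
  rw [this]
  exact hd.hasGradientAt

theorem IsCn.continuous_torusGrad {ψ : Torus d → ℝ} (h : IsCn 1 ψ) :
    Continuous (torusGrad ψ) := by
  refine isOpenQuotientMap_toTorus.isQuotientMap.continuous_iff.2 ?_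
  have : torusGrad ψ ∘ toTorus = gradient (fun y : Space d => ψ (toTorus y)) := by
    funext y
    simpa using (h.hasGradientAt 0 y).gradient.symm
  rw [this]
  exact (InnerProductSpace.toDual ℝ (Space d)).symm.continuous.comp
    (ContDiff.continuous_fderiv h (by simp))

theorem isCn_one_of_hasGradientAt {ψ : Torus d → ℝ} {G : Torus d → Space d} (hG : Continuous G)
    (h : ∀ y : Space d, HasGradientAt (fun y : Space d => ψ (toTorus y)) (G (toTorus y)) y) :
    IsCn 1 ψ := by
  refine contDiff_one_iff_hasFDerivAt.2
    ⟨fun y => InnerProductSpace.toDual ℝ (Space d) (G (toTorus y)), ?_, fun y => h y⟩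
  exact (InnerProductSpace.toDual ℝ (Space d)).continuous.comp (hG.comp continuous_toTorus)

theorem torusGrad_eq_of_hasGradientAt {ψ : Torus d → ℝ} {x : Torus d} {g : Space d}
    (h : HasGradientAt (fun y : Space d => ψ (x + toTorus y)) g 0) : torusGrad ψ x = g :=
  h.gradient

theorem IsCn.hasGradientAt_zero {ψ : Torus d → ℝ} (h : IsCn 1 ψ) (x : Torus d) :
    HasGradientAt (fun y : Space d => ψ (x + toTorus y)) (torusGrad ψ x) 0 := by
  simpa using h.hasGradientAt x 0

theorem torusGrad_comp_add_right (ψ : Torus d → ℝ) (a x : Torus d) :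
    torusGrad (fun x => ψ (x + a)) x = torusGrad ψ (x + a) := by
  simp only [torusGrad, add_right_comm]

theorem IsCn.hasDerivAt_line {ψ : Torus d → ℝ} (h : IsCn 1 ψ) (x : Torus d) (v : Space d) (t : ℝ) :
    HasDerivAt (fun t : ℝ => ψ (x + toTorus (t • v)))
      (inner ℝ (torusGrad ψ (x + toTorus (t • v))) v) t := by
  have h1 := (h.hasGradientAt x (t • v)).hasFDerivAt
  have h2 : HasDerivAt (fun t : ℝ => t • v) v t := by
    simpa using (hasDerivAt_id t).smul_const v
  have h3 := h1.comp_hasDerivAt t h2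
  rw [InnerProductSpace.toDual_apply_apply] at h3
  exact h3

theorem IsCn.add {n : ℕ∞} {φ ψ : Torus d → ℝ} (hφ : IsCn n φ) (hψ : IsCn n ψ) :
    IsCn n (fun x => φ x + ψ x) := ContDiff.add hφ hψ

theorem IsCn.sub {n : ℕ∞} {φ ψ : Torus d → ℝ} (hφ : IsCn n φ) (hψ : IsCn n ψ) :
    IsCn n (fun x => φ x - ψ x) := ContDiff.sub hφ hψ

theorem IsCn.mul {n : ℕ∞} {φ ψ : Torus d → ℝ} (hφ : IsCn n φ) (hψ : IsCn n ψ) :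
    IsCn n (fun x => φ x * ψ x) := ContDiff.mul hφ hψ

theorem isCn_const {n : ℕ∞} (c : ℝ) : IsCn n (fun _ : Torus d => c) := contDiff_const

theorem IsCn.comp {n : ℕ∞} {g : ℝ → ℝ} {ψ : Torus d → ℝ} (hg : ContDiff ℝ n g) (hψ : IsCn n ψ) :
    IsCn n (fun x => g (ψ x)) := ContDiff.comp hg hψ

theorem torusGrad_add {φ ψ : Torus d → ℝ} (hφ : IsCn 1 φ) (hψ : IsCn 1 ψ) (x : Torus d) :
    torusGrad (fun x => φ x + ψ x) x = torusGrad φ x + torusGrad ψ x := by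
  refine torusGrad_eq_of_hasGradientAt ?_
  rw [hasGradientAt_iff_hasFDerivAt, map_add]
  exact (hφ.hasGradientAt_zero x).hasFDerivAt.add (hψ.hasGradientAt_zero x).hasFDerivAt

theorem torusGrad_sub {φ ψ : Torus d → ℝ} (hφ : IsCn 1 φ) (hψ : IsCn 1 ψ) (x : Torus d) :
    torusGrad (fun x => φ x - ψ x) x = torusGrad φ x - torusGrad ψ x := by
  refine torusGrad_eq_of_hasGradientAt ?_
  rw [hasGradientAt_iff_hasFDerivAt, map_sub]
  exact (hφ.hasGradientAt_zero x).hasFDerivAt.sub (hψ.hasGradientAt_zero x).hasFDerivAt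

theorem torusGrad_comp {g : ℝ → ℝ} {ψ : Torus d → ℝ} (hψ : IsCn 1 ψ) (x : Torus d) {g' : ℝ}
    (hg : HasDerivAt g g' (ψ x)) :
    torusGrad (fun x => g (ψ x)) x = g' • torusGrad ψ x := by
  refine torusGrad_eq_of_hasGradientAt ?_
  rw [hasGradientAt_iff_hasFDerivAt]
  have h1 := (hψ.hasGradientAt_zero x).hasFDerivAt
  have hg2 : HasDerivAt g g' (ψ (x + toTorus 0)) := by simpa using hg
  rw [map_smul]
  exact hg2.comp_hasFDerivAt (0 : Space d) h1

theorem torusGrad_const (c : ℝ) (x : Torus d) : torusGrad (fun _ => c) x = 0 := by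
  simp [torusGrad]

theorem torusGrad_mul {φ ψ : Torus d → ℝ} (hφ : IsCn 1 φ) (hψ : IsCn 1 ψ) (x : Torus d) :
    torusGrad (fun x => φ x * ψ x) x = φ x • torusGrad ψ x + ψ x • torusGrad φ x := by
  refine torusGrad_eq_of_hasGradientAt ?_
  rw [hasGradientAt_iff_hasFDerivAt]
  have := (hφ.hasGradientAt_zero x).hasFDerivAt.mul (hψ.hasGradientAt_zero x).hasFDerivAt
  simp only [toTorus_zero, add_zero] at this
  rw [map_add, map_smul, map_smul]
  exact this

/-! ### Integration on the torus -/

theorem measurePreserving_add_right_torus (a : Torus d) :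
    MeasurePreserving (fun x : Torus d => x + a) volume volume :=
  measurePreserving_add_right volume a

/-- The half-open unit cube of `ℝ^d`, a fundamental domain of the torus. -/
def unitCube (d : ℕ) : Set (Space d) := {y | ∀ i, y i ∈ Ioc (0 : ℝ) 1}

theorem measurableSet_unitCube : MeasurableSet (unitCube d) := by
  have : unitCube d = ⋂ i, (fun y : Space d => y i) ⁻¹' Ioc (0 : ℝ) 1 := by
    ext; simp [unitCube]
  rw [this]
  exact MeasurableSet.iInter fun i =>
    (EuclideanSpace.proj (𝕜 := ℝ) i).continuous.measurable measurableSet_Ioc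

theorem measurePreserving_toTorus :
    MeasurePreserving (toTorus : Space d → Torus d) (volume.restrict (unitCube d)) volume := by
  have h1 : MeasurePreserving (fun (y : Fin d → ℝ) i => (y i : UnitAddCircle))
      (Measure.pi fun _ => volume.restrict (Ioc (0 : ℝ) 1)) volume := by
    refine measurePreserving_pi _ _ fun i => ?_
    simpa using UnitAddCircle.measurePreserving_mk 0
  rw [← Measure.restrict_pi_pi] at h1
  have h2 := (EuclideanSpace.volume_preserving_symm_measurableEquiv_toLp (Fin d)).restrict_preimage
    (s := univ.pi fun _ => Ioc (0 : ℝ) 1) (MeasurableSet.univ_pi fun _ => measurableSet_Ioc)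
  have h3 : (MeasurableEquiv.toLp 2 (Fin d → ℝ)).symm ⁻¹' (univ.pi fun _ => Ioc (0 : ℝ) 1)
      = unitCube d := by
    ext y; simp [unitCube]
  rw [h3] at h2
  exact h1.comp h2

theorem volume_unitCube : volume (unitCube d) = 1 := by
  have := (measurePreserving_toTorus (d := d)).measure_preimage MeasurableSet.univ.nullMeasurableSet
  simpa using this

instance : IsProbabilityMeasure (volume.restrict (unitCube d)) :=
  ⟨by simpa using volume_unitCube⟩

theorem norm_le_of_mem_unitCube {y : Space d} (hy : y ∈ unitCube d) : ‖y‖ ≤ √d := by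
  rw [EuclideanSpace.norm_eq]
  refine Real.sqrt_le_sqrt ?_
  calc ∑ i, ‖y i‖ ^ 2 ≤ ∑ _i : Fin d, (1 : ℝ) := by
        refine Finset.sum_le_sum fun i _ => ?_
        have := hy i
        rw [Real.norm_of_nonneg this.1.le]
        nlinarith [this.1, this.2]
    _ = d := by simp

theorem integrable_of_continuous {E : Type*} [NormedAddCommGroup E] {F : Torus d → E}
    (hF : Continuous F) : Integrable F volume :=
  hF.integrable_of_hasCompactSupport (HasCompactSupport.of_compactSpace F)

theorem exists_bound_of_continuous {E : Type*} [NormedAddCommGroup E] {F : Torus d → E}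
    (hF : Continuous F) : ∃ L : ℝ, 0 ≤ L ∧ ∀ x, ‖F x‖ ≤ L := by
  obtain ⟨L, hL⟩ := isCompact_univ.exists_bound_of_continuousOn hF.continuousOn
  exact ⟨max L 0, le_max_right _ _, fun x => (hL x (mem_univ x)).trans (le_max_left _ _)⟩

theorem memLp_of_continuous {E : Type*} [NormedAddCommGroup E] {F : Torus d → E}
    (hF : Continuous F) (s : ℝ≥0∞) : MemLp F s volume := by
  obtain ⟨L, -, hL⟩ := exists_bound_of_continuous hF
  exact MemLp.of_bound (integrable_of_continuous hF).1 L (ae_of_all _ hL)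

/-- By translation invariance t ↦ ∫ ψ(x + tv) is constant; its derivative at 0 is the integral in
question. Applied to products, this is integration by parts. -/
theorem IsCn.integral_inner_torusGrad_eq_zero {ψ : Torus d → ℝ} (h : IsCn 1 ψ) (v : Space d) :
    ∫ x, inner ℝ (torusGrad ψ x) v = 0 := by
  obtain ⟨L, -, hL⟩ := exists_bound_of_continuous h.continuous_torusGrad
  have hc : ∀ t : ℝ, Continuous fun x : Torus d => x + toTorus (t • v) := fun t => by fun_prop
  have key := (hasDerivAt_integral_of_dominated_loc_of_deriv_le (μ := (volume : Measure (Torus d)))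
    (F := fun (t : ℝ) x => ψ (x + toTorus (t • v)))
    (F' := fun (t : ℝ) x => inner ℝ (torusGrad ψ (x + toTorus (t • v))) v)
    (x₀ := 0) (bound := fun _ => L * ‖v‖) (s := univ) univ_mem
    (Eventually.of_forall fun t => (h.continuous.comp (hc t)).aestronglyMeasurable)
    (integrable_of_continuous (h.continuous.comp (hc 0)))
    ((h.continuous_torusGrad.comp (hc 0)).inner continuous_const).aestronglyMeasurable
    (ae_of_all _ fun x t _ => (norm_inner_le_norm _ _).trans
      (mul_le_mul_of_nonneg_right (hL _) (norm_nonneg _)))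
    (integrable_const _)
    (ae_of_all _ fun x t _ => h.hasDerivAt_line x v t)).2
  have hconst : (fun t : ℝ => ∫ x, ψ (x + toTorus (t • v))) = fun _ => ∫ x, ψ x := by
    funext t
    exact integral_add_right_eq_self ψ _
  rw [hconst] at key
  simpa using key.unique (hasDerivAt_const (0 : ℝ) (∫ x, ψ x))

/-- The classical gradient is a weak gradient. -/
theorem IsCn.hasWeakGrad {ψ : Torus d → ℝ} (h : IsCn 1 ψ) : HasWeakGrad ψ (torusGrad ψ) := by
  intro φ hφ i
  have hφ1 : IsCn 1 φ := hφ.of_le le_top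
  have key := (h.mul hφ1).integral_inner_torusGrad_eq_zero (EuclideanSpace.single i (1 : ℝ))
  simp only [torusGrad_mul h hφ1, EuclideanSpace.inner_single_right] at key
  have hi : ∀ {χ : Torus d → ℝ}, IsCn 1 χ → Continuous fun x => torusGrad χ x i := fun hχ =>
    (EuclideanSpace.proj (𝕜 := ℝ) i).continuous.comp hχ.continuous_torusGrad
  rw [← sub_eq_zero, sub_neg_eq_add, ← integral_add, ← key]
  · refine integral_congr_ae (ae_of_all _ fun x => ?_)
    simp [mul_comm]
  · exact integrable_of_continuous (h.continuous.mul (hi hφ1))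
  · exact integrable_of_continuous ((hi h).mul hφ1.continuous)

end

section

variable {d : ℕ}

/-! ### Mollification -/

/-- A smooth function on the torus that vanishes at the origin only. -/
def gauge (x : Torus d) : ℝ := ∑ i, (1 - (AddCircle.toCircle (x i) : ℂ).re)

theorem isCn_gauge : IsCn ⊤ (gauge : Torus d → ℝ) := by
  have : (fun y : Space d => gauge (toTorus y))
      = fun y : Space d => ∑ i, (1 - Real.cos (2 * Real.pi * y i)) := by
    funext y
    refine Finset.sum_congr rfl fun i _ => ?_
    rw [toTorus, AddCircle.toCircle_apply_mk, Circle.coe_exp, Complex.exp_ofReal_mul_I_re]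
    simp
  rw [IsCn, this]
  refine ContDiff.sum fun i _ => contDiff_const.sub (Real.contDiff_cos.comp ?_)
  exact contDiff_const.mul (EuclideanSpace.proj (𝕜 := ℝ) i).contDiff

theorem continuous_gauge : Continuous (gauge : Torus d → ℝ) := isCn_gauge.continuous

theorem re_toCircle_le_one (z : UnitAddCircle) : (AddCircle.toCircle z : ℂ).re ≤ 1 :=
  (Complex.re_le_norm _).trans (Circle.norm_coe _).le

theorem gauge_nonneg (x : Torus d) : 0 ≤ gauge x :=
  Finset.sum_nonneg fun _ _ => sub_nonneg.2 (re_toCircle_le_one _)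

@[simp] theorem gauge_zero : gauge (0 : Torus d) = 0 := by simp [gauge]

theorem gauge_pos {x : Torus d} (hx : x ≠ 0) : 0 < gauge x := by
  refine lt_of_le_of_ne (gauge_nonneg x) fun h => hx ?_
  have h0 := (Finset.sum_eq_zero_iff_of_nonneg
    fun i _ => sub_nonneg.2 (re_toCircle_le_one (x i))).1 h.symm
  funext i
  have h1 : (AddCircle.toCircle (x i) : ℂ).re = 1 := by
    have := h0 i (Finset.mem_univ i); linarith
  have h2 : (AddCircle.toCircle (x i) : ℂ) = 1 := by
    have hn := Circle.normSq_coe (AddCircle.toCircle (x i))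
    rw [Complex.normSq_apply, h1] at hn
    refine Complex.ext (by simpa using h1) ?_
    simp only [Complex.one_im]
    nlinarith
  refine AddCircle.injective_toCircle one_ne_zero ?_
  ext
  simpa using h2

/-- By compactness `gauge` has a positive minimum off an open neighbourhood of 0. So its sublevels
form a neighbourhood basis, and this smooth function can play the role of a distance. -/
theorem exists_gauge_lt_subset {U : Set (Torus d)} (hU : U ∈ 𝓝 0) :
    ∃ δ > 0, ∀ x, gauge x < δ → x ∈ U := by
  obtain ⟨V, hVU, hV, h0⟩ := mem_nhds_iff.1 hU
  rcases (Vᶜ).eq_empty_or_nonempty with he | hne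
  · exact ⟨1, one_pos, fun x _ => hVU (by simpa using (compl_empty_iff.1 he).symm ▸ mem_univ x)⟩
  · obtain ⟨z, hz, hmin⟩ :=
      hV.isClosed_compl.isCompact.exists_isMinOn hne continuous_gauge.continuousOn
    refine ⟨gauge z, gauge_pos fun h => hz (h ▸ h0), fun x hx => ?_⟩
    by_contra hxU
    exact absurd (hmin (show x ∈ Vᶜ from fun h => hxU (hVU h))) (not_le.2 hx)

/-- A smooth cutoff of `gauge`, divided by its integral, which is positive because the cutoff is
nonzero at the origin. -/
theorem exists_kernel {δ : ℝ} (hδ : 0 < δ) :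
    ∃ η : Torus d → ℝ, IsCn ⊤ η ∧ (∀ x, 0 ≤ η x) ∧ ∫ x, η x = 1 ∧
      ∀ x, η x ≠ 0 → gauge x < δ := by
  set k : Torus d → ℝ := fun x => Real.smoothTransition (1 - gauge x / δ) with hk
  have hkC : IsCn ⊤ k := by
    have h1 : IsCn ⊤ fun x : Torus d => 1 - gauge x * δ⁻¹ :=
      (isCn_const 1).sub (isCn_gauge.mul (isCn_const _))
    simpa only [hk, div_eq_mul_inv] using IsCn.comp Real.smoothTransition.contDiff h1
  have hk0 : ∀ x, 0 ≤ k x := fun x => Real.smoothTransition.nonneg _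
  have hpos : 0 < ∫ x, k x := by
    refine hkC.continuous.integral_pos_of_hasCompactSupport_nonneg_nonzero
      (HasCompactSupport.of_compactSpace k) hk0 (x := 0) ?_
    simp [hk]
  refine ⟨fun x => (∫ x, k x)⁻¹ * k x, (isCn_const _).mul hkC,
    fun x => mul_nonneg (inv_nonneg.2 hpos.le) (hk0 x), ?_, fun x hx => ?_⟩
  · rw [integral_const_mul, inv_mul_cancel₀ hpos.ne']
  · by_contra hlt
    refine hx ?_
    have : k x = 0 := Real.smoothTransition.zero_of_nonpos (by
      rw [sub_nonpos, le_div_iff₀ hδ]; linarith)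
    simp [this]

variable {E : Type*} [NormedAddCommGroup E] [NormedSpace ℝ E]

/-- The average of the translates of `F` with respect to the weight `η`. -/
def mollify (η : Torus d → ℝ) (F : Torus d → E) (x : Torus d) : E := ∫ y, η (y - x) • F y

theorem mollify_eq (η : Torus d → ℝ) (F : Torus d → E) (x : Torus d) :
    mollify η F x = ∫ y, η y • F (x + y) := by
  have := integral_add_right_eq_self (μ := (volume : Measure (Torus d)))
    (fun y => η (y - x) • F y) x
  rw [mollify, ← this]
  simp [add_comm]

theorem continuous_mollify {η : Torus d → ℝ} (hη : Continuous η) {F : Torus d → E}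
    (hF : Integrable F volume) : Continuous (mollify η F) := by
  obtain ⟨L, -, hL⟩ := exists_bound_of_continuous hη
  refine continuous_of_dominated (bound := fun y => L * ‖F y‖) (fun x => ?_)
    (fun x => ae_of_all _ fun y => ?_) (hF.norm.const_mul L) (ae_of_all _ fun y => ?_)
  · exact ((hη.comp (continuous_id.sub continuous_const)).aestronglyMeasurable).smul hF.1
  · rw [norm_smul]
    exact mul_le_mul_of_nonneg_right (hL _) (norm_nonneg _)
  · exact (hη.comp (continuous_const.sub continuous_id)).smul continuous_const

/-- The derivative first falls on the kernel, by differentiation under the integral; the definition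
of the weak gradient, with a translated kernel as test function, then moves it to u. -/
theorem hasGradientAt_mollify {η : Torus d → ℝ} (hη : IsCn ⊤ η) {u : Torus d → ℝ}
    {G : Torus d → Space d} (hu : Integrable u volume) (hG : Integrable G volume)
    (h : HasWeakGrad u G) (y : Space d) :
    HasGradientAt (fun y : Space d => mollify η u (toTorus y)) (mollify η G (toTorus y)) y := by
  have hη1 : IsCn 1 η := hη.of_le le_top
  obtain ⟨L, -, hL⟩ := exists_bound_of_continuous hη1.continuous_torusGrad
  have hshift : ∀ x : Torus d, Continuous fun z : Torus d => z - x := fun x => by fun_prop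
  have hderiv : ∀ (z : Torus d) (w : Space d), HasFDerivAt
      (fun w : Space d => η (z - toTorus w) • u z)
      (InnerProductSpace.toDual ℝ (Space d) (-(u z • torusGrad η (z - toTorus w)))) w := by
    intro z w
    have h1 := (hη1.hasGradientAt z (-w)).hasFDerivAt
    have h2 := (h1.comp w (hasFDerivAt_id w).neg).mul_const (u z)
    have h3 : ∀ w : Space d, z + toTorus (-w) = z - toTorus w := fun w => by
      rw [toTorus_neg, sub_eq_add_neg]
    rw [h3] at h2
    have e1 : (fun w : Space d => η (z - toTorus w) • u z)
        = fun w => ((fun y => η (z + toTorus y)) ∘ Neg.neg) w * u z := by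
      funext w; simp [h3]
    have e2 : InnerProductSpace.toDual ℝ (Space d) (-(u z • torusGrad η (z - toTorus w)))
        = u z • (InnerProductSpace.toDual ℝ (Space d) (torusGrad η (z - toTorus w))).comp
          (-ContinuousLinearMap.id ℝ (Space d)) := by
      ext v; simp
    rw [e1, e2]
    exact h2
  have hmeasG : AEStronglyMeasurable (fun z => u z • torusGrad η (z - toTorus y)) volume :=
    hu.1.smul (hη1.continuous_torusGrad.comp (hshift _)).aestronglyMeasurable
  have hint : Integrable (fun z => u z • torusGrad η (z - toTorus y)) volume := by
    refine (hu.norm.const_mul L).mono' hmeasG (ae_of_all _ fun z => ?_)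
    rw [norm_smul, mul_comm]
    exact mul_le_mul_of_nonneg_right (hL _) (norm_nonneg _)
  have key := hasFDerivAt_integral_of_dominated_of_fderiv_le (𝕜 := ℝ)
    (μ := (volume : Measure (Torus d))) (x₀ := y) (s := univ)
    (F := fun (w : Space d) z => η (z - toTorus w) • u z)
    (F' := fun w z => InnerProductSpace.toDual ℝ (Space d) (-(u z • torusGrad η (z - toTorus w))))
    (bound := fun z => L * ‖u z‖) univ_mem
    (Eventually.of_forall fun w => ((hη.continuous.comp (hshift _)).aestronglyMeasurable).smul hu.1)
    (by
      obtain ⟨K, -, hK⟩ := exists_bound_of_continuous hη.continuous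
      refine (hu.norm.const_mul K).mono'
        (((hη.continuous.comp (hshift _)).aestronglyMeasurable).smul hu.1)
        (ae_of_all _ fun z => ?_)
      rw [norm_smul]
      exact mul_le_mul_of_nonneg_right (hK _) (norm_nonneg _))
    ((InnerProductSpace.toDual ℝ (Space d)).continuous.comp_aestronglyMeasurable hmeasG.neg)
    (ae_of_all _ fun z w _ => by
      rw [LinearIsometryEquiv.norm_map, norm_neg, norm_smul, mul_comm]
      exact mul_le_mul_of_nonneg_right (hL _) (norm_nonneg _))
    (hu.norm.const_mul L) (ae_of_all _ fun z w _ => hderiv z w)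
  rw [hasGradientAt_iff_hasFDerivAt]
  have hcomm : ∫ z, InnerProductSpace.toDual ℝ (Space d) (-(u z • torusGrad η (z - toTorus y)))
      = InnerProductSpace.toDual ℝ (Space d) (∫ z, -(u z • torusGrad η (z - toTorus y))) :=
    (InnerProductSpace.toDual ℝ (Space d)).toContinuousLinearEquiv.toContinuousLinearMap
      |>.integral_comp_comm hint.neg
  suffices hgrad : mollify η G (toTorus y) = ∫ z, -(u z • torusGrad η (z - toTorus y)) by
    rw [hgrad]
    rw [hcomm] at key
    exact key
  have hintG : Integrable (fun z => η (z - toTorus y) • G z) volume := by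
    obtain ⟨K, -, hK⟩ := exists_bound_of_continuous hη.continuous
    refine (hG.norm.const_mul K).mono'
      (((hη.continuous.comp (hshift _)).aestronglyMeasurable).smul hG.1) (ae_of_all _ fun z => ?_)
    rw [norm_smul]
    exact mul_le_mul_of_nonneg_right (hK _) (norm_nonneg _)
  ext i
  have e1 := (EuclideanSpace.proj i : Space d →L[ℝ] ℝ).integral_comp_comm hintG
  have e2 := (EuclideanSpace.proj i : Space d →L[ℝ] ℝ).integral_comp_comm hint.neg
  -- Differentiating η(z - y) in y instead of z produces a minus sign, which cancels the one in the
  -- definition of the weak gradient.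
  have e3 := h (fun z => η (z + (-toTorus y))) (hη.comp_add_right _) i
  simp only [torusGrad_comp_add_right] at e3
  simp only [PiLp.proj_apply, PiLp.smul_apply, PiLp.neg_apply, smul_eq_mul,
    Pi.neg_apply, sub_eq_add_neg] at e1 e2
  rw [mollify]
  simp only [sub_eq_add_neg]
  rw [← e1, ← e2, integral_neg, e3, neg_neg]
  exact integral_congr_ae (ae_of_all _ fun z => mul_comm _ _)

/-- `(u, G)` represents an element of `W^{1,s}` together with its weak gradient. -/
structure IsSobolev (s : ℝ) (u : Torus d → ℝ) (G : Torus d → Space d) : Prop where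
  memLp : MemLp u (ENNReal.ofReal s) volume
  memLp_grad : MemLp G (ENNReal.ofReal s) volume
  hasWeakGrad : HasWeakGrad u G

theorem IsSobolev.integrable {s : ℝ} (hs : 1 ≤ s) {u : Torus d → ℝ} {G : Torus d → Space d}
    (h : IsSobolev s u G) : Integrable u volume :=
  h.memLp.integrable (by simpa using hs)

theorem IsSobolev.integrable_grad {s : ℝ} (hs : 1 ≤ s) {u : Torus d → ℝ} {G : Torus d → Space d}
    (h : IsSobolev s u G) : Integrable G volume :=
  h.memLp_grad.integrable (by simpa using hs)

theorem isCn_mollify {η : Torus d → ℝ} (hη : IsCn ⊤ η) {u : Torus d → ℝ}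
    {G : Torus d → Space d} (hu : Integrable u volume) (hG : Integrable G volume)
    (h : HasWeakGrad u G) : IsCn 1 (mollify η u) :=
  isCn_one_of_hasGradientAt (continuous_mollify hη.continuous hG)
    (hasGradientAt_mollify hη hu hG h)

theorem torusGrad_mollify {η : Torus d → ℝ} (hη : IsCn ⊤ η) {u : Torus d → ℝ}
    {G : Torus d → Space d} (hu : Integrable u volume) (hG : Integrable G volume)
    (h : HasWeakGrad u G) : torusGrad (mollify η u) = mollify η G := by
  funext x
  obtain ⟨y, rfl⟩ := toTorus_surjective x
  have h1 := hasGradientAt_mollify hη hu hG h y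
  have h2 := (isCn_mollify hη hu hG h).hasGradientAt 0 y
  simp only [zero_add] at h2
  exact h2.unique h1

/-- Minkowski's inequality for averages with respect to a probability measure. -/
theorem lintegral_rpow_average_le {X Ω : Type*} [MeasurableSpace X] [MeasurableSpace Ω]
    {μ : Measure X} {ν : Measure Ω} [SFinite μ] [IsProbabilityMeasure ν] {g : X → Ω → ℝ≥0∞}
    (hg : Measurable (Function.uncurry g)) {s : ℝ} (hs : 1 ≤ s) {c : ℝ≥0∞}
    (h : ∀ᵐ w ∂ν, ∫⁻ x, g x w ^ s ∂μ ≤ c) :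
    ∫⁻ x, (∫⁻ w, g x w ∂ν) ^ s ∂μ ≤ c := by
  have hs0 : 0 < s := one_pos.trans_le hs
  -- Jensen's inequality, in the form of monotonicity of L^s norms over a probability measure.
  have jensen : ∀ x, (∫⁻ w, g x w ∂ν) ^ s ≤ ∫⁻ w, g x w ^ s ∂ν := by
    intro x
    have hgx : AEStronglyMeasurable (g x) ν := (hg.of_uncurry_left).aestronglyMeasurable
    have := eLpNorm_le_eLpNorm_of_exponent_le (μ := ν) (p := 1) (q := ENNReal.ofReal s)
      (by simpa using hs) hgx
    rw [eLpNorm_one_eq_lintegral_enorm, eLpNorm_eq_lintegral_rpow_enorm_toReal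
      (by simpa using hs0) ENNReal.ofReal_ne_top, ENNReal.toReal_ofReal hs0.le] at this
    simp only [enorm_eq_self] at this
    rw [one_div] at this
    exact (ENNReal.le_rpow_inv_iff hs0).1 this
  calc ∫⁻ x, (∫⁻ w, g x w ∂ν) ^ s ∂μ ≤ ∫⁻ x, ∫⁻ w, g x w ^ s ∂ν ∂μ := lintegral_mono jensen
    _ = ∫⁻ w, ∫⁻ x, g x w ^ s ∂μ ∂ν := lintegral_lintegral_swap (hg.pow_const s).aemeasurable
    _ ≤ ∫⁻ _, c ∂ν := lintegral_mono_ae h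
    _ = c := by simp

theorem eLpNorm_ofReal_le_iff {X : Type*} [MeasurableSpace X] {μ : Measure X}
    {F : Type*} [NormedAddCommGroup F] {f : X → F} {s : ℝ} (hs : 0 < s) {c : ℝ≥0∞} :
    eLpNorm f (ENNReal.ofReal s) μ ≤ c ↔ ∫⁻ x, ‖f x‖ₑ ^ s ∂μ ≤ c ^ s := by
  rw [eLpNorm_eq_lintegral_rpow_enorm_toReal (by simpa using hs) ENNReal.ofReal_ne_top,
    ENNReal.toReal_ofReal hs.le, one_div, ENNReal.rpow_inv_le_iff hs]

/-- Since η dy is a probability measure, the difference is the average of F(· + y) - F over the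
support of η, and Minkowski's inequality bounds its norm by the largest translation error. -/
theorem eLpNorm_mollify_sub_le [CompleteSpace E] {η : Torus d → ℝ} (hη : Continuous η)
    (hη0 : ∀ x, 0 ≤ η x) (hη1 : ∫ x, η x = 1) {s : ℝ} (hs : 1 ≤ s) {F : Torus d → E}
    (hF : MemLp F (ENNReal.ofReal s) volume) {c : ℝ≥0∞}
    (h : ∀ y, η y ≠ 0 → eLpNorm (fun x => F (x + y) - F x) (ENNReal.ofReal s) volume ≤ c) :
    eLpNorm (fun x => mollify η F x - F x) (ENNReal.ofReal s) volume ≤ c := by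
  have hs0 : 0 < s := one_pos.trans_le hs
  -- Passing to a strongly measurable representative makes (x, y) ↦ F(x + y) - F(x) jointly
  -- measurable, as the exchange of integrals requires.
  wlog hFm : StronglyMeasurable F generalizing F
  · have hae := hF.1.ae_eq_mk
    have e1 : mollify η F = mollify η (hF.1.mk F) := by
      funext x
      exact integral_congr_ae (hae.mono fun y hy => by simp only [hy])
    have e2 : (fun x => mollify η F x - F x)
        =ᵐ[volume] fun x => mollify η (hF.1.mk F) x - hF.1.mk F x := by
      filter_upwards [hae] with x hx
      rw [e1, hx]
    rw [eLpNorm_congr_ae e2]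
    refine this (hF.ae_eq hae) (fun y hy => ?_) hF.1.stronglyMeasurable_mk
    refine le_trans (eLpNorm_congr_ae ?_).ge (h y hy)
    filter_upwards [hae, (measurePreserving_add_right_torus y).quasiMeasurePreserving.ae_eq hae]
      with x h1 h2
    simp only [Function.comp_apply] at h2
    rw [h1, h2]
  rw [eLpNorm_ofReal_le_iff hs0]
  set ν : Measure (Torus d) := volume.withDensity fun y => ENNReal.ofReal (η y) with hν
  have hηm : Measurable fun y => ENNReal.ofReal (η y) := hη.measurable.ennreal_ofReal
  have hprob : IsProbabilityMeasure ν := ⟨by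
    rw [hν, withDensity_apply _ MeasurableSet.univ, Measure.restrict_univ,
      ← ofReal_integral_eq_lintegral_ofReal (integrable_of_continuous hη) (ae_of_all _ hη0), hη1,
      ENNReal.ofReal_one]⟩
  have hFi : Integrable F volume := hF.integrable (by simpa using hs)
  have hpt : ∀ x, ‖mollify η F x - F x‖ₑ ≤ ∫⁻ y, ‖F (x + y) - F x‖ₑ ∂ν := by
    intro x
    have hFx : Integrable (fun y => F (x + y)) volume := hFi.comp_add_left x
    have hi1 : Integrable (fun y => η y • F (x + y)) volume := by
      obtain ⟨K, -, hK⟩ := exists_bound_of_continuous hη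
      refine (hFx.norm.const_mul K).mono' (hη.aestronglyMeasurable.smul hFx.1)
        (ae_of_all _ fun z => ?_)
      rw [norm_smul]
      exact mul_le_mul_of_nonneg_right (hK _) (norm_nonneg _)
    have hi2 : Integrable (fun y => η y • F x) volume :=
      (integrable_of_continuous hη).smul_const _
    have e : mollify η F x - F x = ∫ y, η y • (F (x + y) - F x) := by
      simp only [smul_sub]
      rw [integral_sub hi1 hi2, integral_smul_const, hη1, one_smul, mollify_eq]
    rw [e, hν, lintegral_withDensity_eq_lintegral_mul₀ hηm.aemeasurable]
    · refine (enorm_integral_le_lintegral_enorm _).trans (lintegral_mono fun y => ?_)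
      simp only [Pi.mul_apply, enorm_smul]
      rw [Real.enorm_of_nonneg (hη0 y)]
    · exact ((hFm.comp_measurable (measurable_const_add x)).sub
        stronglyMeasurable_const).enorm.aemeasurable
  refine (lintegral_mono fun x => ENNReal.rpow_le_rpow (hpt x) hs0.le).trans ?_
  refine lintegral_rpow_average_le (ν := ν) (g := fun x y => ‖F (x + y) - F x‖ₑ) ?_ hs ?_
  · exact ((hFm.comp_measurable measurable_add).sub (hFm.comp_measurable measurable_fst)).enorm
  · rw [hν, ae_withDensity_iff hηm]
    refine ae_of_all _ fun y hy => ?_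
    exact (eLpNorm_ofReal_le_iff hs0).1 (h y fun h0 => hy (by simp [h0]))

theorem tendsto_eLpNorm_translate_sub {E : Type*} [NormedAddCommGroup E] {s : ℝ} (hs : 1 ≤ s) {F : Torus d → E}
    (hF : MemLp F (ENNReal.ofReal s) volume) :
    Tendsto (fun y => eLpNorm (fun x => F (x + y) - F x) (ENNReal.ofReal s) volume) (𝓝 0)
      (𝓝 0) := by
  have : Fact (1 ≤ ENNReal.ofReal s) := ⟨by simpa using hs⟩
  -- Translations form a continuous family of measure preserving maps, so composing a fixed class
  -- with them is continuous in L^s; finiteness of s is essential.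
  let g : C(Torus d, C(Torus d, Torus d)) :=
    (ContinuousMap.mk (fun a : Torus d × Torus d => a.2 + a.1)
      (continuous_snd.add continuous_fst)).curry
  have hgm : ∀ y, MeasurePreserving (g y) volume volume := measurePreserving_add_right_torus
  have h1 : Continuous fun y => Lp.compMeasurePreserving (g y) (hgm y) (hF.toLp F) :=
    continuous_const.compMeasurePreservingLp g.continuous hgm ENNReal.ofReal_ne_top
  have h2 := (h1.tendsto 0).edist (tendsto_const_nhds (x := hF.toLp F))
  have e : ∀ y, edist (Lp.compMeasurePreserving (g y) (hgm y) (hF.toLp F)) (hF.toLp F)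
      = eLpNorm (fun x => F (x + y) - F x) (ENNReal.ofReal s) volume := by
    intro y
    rw [Lp.toLp_compMeasurePreserving, Lp.edist_toLp_toLp]
    rfl
  simp only [e] at h2
  simpa using h2

/-- Density of `C^1` functions in Sobolev spaces. -/
theorem IsSobolev.exists_smooth_approx {s : ℝ} (hs : 1 ≤ s) {u : Torus d → ℝ}
    {G : Torus d → Space d} (h : IsSobolev s u G) :
    ∃ v : ℕ → Torus d → ℝ, (∀ n, IsCn 1 (v n)) ∧
      Tendsto (fun n => eLpNorm (fun x => v n x - u x) (ENNReal.ofReal s) volume) atTop (𝓝 0) ∧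
      Tendsto (fun n => eLpNorm (fun x => torusGrad (v n) x - G x) (ENNReal.ofReal s) volume)
        atTop (𝓝 0) := by
  choose η hηC hη0 hη1 hηs using fun n : ℕ =>
    exists_kernel (d := d) (Nat.one_div_pos_of_nat (n := n) (α := ℝ))
  have hu := h.integrable hs
  have hG := h.integrable_grad hs
  -- Stated for general values, because it serves for u and for its gradient.
  have key : ∀ {E' : Type} [NormedAddCommGroup E'] [NormedSpace ℝ E'] [CompleteSpace E']
      {F : Torus d → E'}, MemLp F (ENNReal.ofReal s) volume →
      Tendsto (fun n => eLpNorm (fun x => mollify (η n) F x - F x) (ENNReal.ofReal s) volume)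
        atTop (𝓝 0) := by
    intro E' _ _ _ F hF
    rw [ENNReal.tendsto_atTop_zero]
    intro e he
    have h1 := (tendsto_eLpNorm_translate_sub hs hF).eventually (Iic_mem_nhds he)
    obtain ⟨δ, hδ, hsub⟩ := exists_gauge_lt_subset h1
    obtain ⟨N, hN⟩ := exists_nat_one_div_lt hδ
    refine ⟨N, fun n hn => eLpNorm_mollify_sub_le (hηC n).continuous (hη0 n) (hη1 n) hs hF
      fun y hy => hsub y ?_⟩
    exact (hηs n y hy).trans ((Nat.one_div_le_one_div hn).trans_lt hN)
  refine ⟨fun n => mollify (η n) u, fun n => isCn_mollify (hηC n) hu hG h.hasWeakGrad,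
    key h.memLp, ?_⟩
  simp only [torusGrad_mollify (hηC _) hu hG h.hasWeakGrad]
  exact key h.memLp_grad

end

section

variable {d : ℕ}

/-! ### The inequalities of Poincaré and Morrey -/

theorem integral_unitCube_translate {v : Torus d → ℝ} (hv : Continuous v) (x : Torus d) :
    ∫ h in unitCube d, v (x + toTorus h) = ∫ z, v z := by
  have hc : Continuous fun z => v (x + z) := by fun_prop
  have h1 := integral_map (μ := volume.restrict (unitCube d))
    (measurePreserving_toTorus (d := d)).measurable.aemeasurable (f := fun z => v (x + z))
    hc.aestronglyMeasurable
  rw [measurePreserving_toTorus.map_eq] at h1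
  rw [← h1]
  exact integral_add_left_eq_self v x

/-- The probability measure on `(0,1] × (0,1]^d`. -/
def segmentMeasure (d : ℕ) : Measure (ℝ × Space d) :=
  (volume.restrict (Ioc (0 : ℝ) 1)).prod (volume.restrict (unitCube d))

instance : IsProbabilityMeasure (volume.restrict (Ioc (0 : ℝ) 1)) := ⟨by simp⟩

instance : IsProbabilityMeasure (segmentMeasure d) :=
  inferInstanceAs (IsProbabilityMeasure
    ((volume.restrict (Ioc (0 : ℝ) 1)).prod (volume.restrict (unitCube d))))

theorem IsCn.enorm_sub_le {v : Torus d → ℝ} (hv : IsCn 1 v) (x : Torus d) (h : Space d) :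
    ‖v x - v (x + toTorus h)‖ₑ
      ≤ ‖h‖ₑ * ∫⁻ t in Ioc (0 : ℝ) 1, ‖torusGrad v (x + toTorus (t • h))‖ₑ := by
  have hcont : Continuous fun t : ℝ => torusGrad v (x + toTorus (t • h)) :=
    hv.continuous_torusGrad.comp (continuous_const.add (continuous_toTorus.comp (by fun_prop)))
  have hftc := intervalIntegral.integral_eq_sub_of_hasDerivAt (a := 0) (b := 1)
    (fun t _ => hv.hasDerivAt_line x h t)
    ((hcont.inner continuous_const).intervalIntegrable 0 1)
  simp only [one_smul, zero_smul, toTorus_zero, add_zero] at hftc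
  rw [enorm_sub_rev, ← hftc, intervalIntegral.integral_of_le zero_le_one,
    ← lintegral_const_mul' _ _ enorm_ne_top]
  refine (enorm_integral_le_lintegral_enorm _).trans (lintegral_mono fun t => ?_)
  rw [← ofReal_norm, ← ofReal_norm, ← ofReal_norm,
    ← ENNReal.ofReal_mul (norm_nonneg _), mul_comm]
  exact ENNReal.ofReal_le_ofReal (norm_inner_le_norm _ _)

theorem continuous_segment (x : Torus d) :
    Continuous fun z : ℝ × Space d => x + toTorus (z.1 • z.2) :=
  continuous_const.add (continuous_toTorus.comp (continuous_fst.smul continuous_snd))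

/-- A `C^1` function differs from its mean by at most an average of its gradient. -/
theorem IsCn.enorm_sub_integral_le {v : Torus d → ℝ} (hv : IsCn 1 v) (x : Torus d) :
    ‖v x - ∫ z, v z‖ₑ ≤ ENNReal.ofReal √d *
      ∫⁻ t in Ioc (0 : ℝ) 1, ∫⁻ h in unitCube d, ‖torusGrad v (x + toTorus (t • h))‖ₑ := by
  have hc : Continuous fun h : Space d => v (x + toTorus h) :=
    hv.continuous.comp (continuous_const.add continuous_toTorus)
  have hbd : ∃ L, 0 ≤ L ∧ ∀ x, ‖v x‖ ≤ L := exists_bound_of_continuous hv.continuous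
  obtain ⟨L, -, hL⟩ := hbd
  have hint : Integrable (fun h : Space d => v (x + toTorus h)) (volume.restrict (unitCube d)) :=
    Integrable.of_bound hc.aestronglyMeasurable L (ae_of_all _ fun _ => hL _)
  -- As h runs through the unit cube, x + h covers the torus once, so the mean of v is the average
  -- of v at the endpoints of segments starting at x.
  have e : v x - ∫ z, v z = ∫ h in unitCube d, (v x - v (x + toTorus h)) := by
    rw [integral_sub (integrable_const _) hint, integral_unitCube_translate hv.continuous]
    simp
  have hmeas : Measurable (Function.uncurry fun (h : Space d) (t : ℝ) =>
      ‖torusGrad v (x + toTorus (t • h))‖ₑ) :=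
    ((hv.continuous_torusGrad.comp ((continuous_segment x).comp continuous_swap)).enorm).measurable
  rw [e]
  refine (enorm_integral_le_lintegral_enorm _).trans ?_
  calc ∫⁻ h in unitCube d, ‖v x - v (x + toTorus h)‖ₑ
      ≤ ∫⁻ h in unitCube d, ENNReal.ofReal √d *
          ∫⁻ t in Ioc (0 : ℝ) 1, ‖torusGrad v (x + toTorus (t • h))‖ₑ := by
        refine setLIntegral_mono' measurableSet_unitCube fun h hh => ?_
        refine (hv.enorm_sub_le x h).trans (mul_le_mul_left ?_ _)
        rw [← ofReal_norm]
        exact ENNReal.ofReal_le_ofReal (norm_le_of_mem_unitCube hh)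
    _ = ENNReal.ofReal √d * ∫⁻ h in unitCube d,
          ∫⁻ t in Ioc (0 : ℝ) 1, ‖torusGrad v (x + toTorus (t • h))‖ₑ :=
        lintegral_const_mul' _ _ ENNReal.ofReal_ne_top
    _ = _ := by
        rw [lintegral_lintegral_swap hmeas.aemeasurable]

theorem lintegral_torus_translate (g : Torus d → ℝ≥0∞) (a : Torus d) :
    ∫⁻ x, g (x + a) = ∫⁻ x, g x :=
  lintegral_add_right_eq_self g a

/-- The deviation from the mean is at most √d, a bound for the segment lengths, times an average of
translates of |Dv|. All translates have the same L^s norm, so Minkowski's inequality applies. -/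
theorem IsCn.poincare {v : Torus d → ℝ} (hv : IsCn 1 v) {s : ℝ} (hs : 1 ≤ s) :
    eLpNorm (fun x => v x - ∫ z, v z) (ENNReal.ofReal s) volume
      ≤ ENNReal.ofReal √d * eLpNorm (torusGrad v) (ENNReal.ofReal s) volume := by
  have hs0 : 0 < s := one_pos.trans_le hs
  have hmeas : Measurable (Function.uncurry fun (x : Torus d) (z : ℝ × Space d) =>
      ‖torusGrad v (x + toTorus (z.1 • z.2))‖ₑ) := by
    have : Continuous fun q : Torus d × (ℝ × Space d) => q.1 + toTorus (q.2.1 • q.2.2) :=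
      continuous_fst.add (continuous_toTorus.comp (by fun_prop))
    exact ((hv.continuous_torusGrad.comp this).enorm).measurable
  rw [eLpNorm_ofReal_le_iff hs0]
  have hpt : ∀ x, ‖v x - ∫ z, v z‖ₑ ^ s ≤ ENNReal.ofReal √d ^ s *
      (∫⁻ z, ‖torusGrad v (x + toTorus (z.1 • z.2))‖ₑ ∂segmentMeasure d) ^ s := by
    intro x
    rw [← ENNReal.mul_rpow_of_nonneg _ _ hs0.le]
    refine ENNReal.rpow_le_rpow ((hv.enorm_sub_integral_le x).trans_eq ?_) hs0.le
    rw [segmentMeasure, lintegral_prod _ (hmeas.of_uncurry_left).aemeasurable]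
  refine (lintegral_mono hpt).trans ?_
  rw [lintegral_const_mul' _ _ (ENNReal.rpow_ne_top_of_nonneg hs0.le ENNReal.ofReal_ne_top),
    ENNReal.mul_rpow_of_nonneg _ _ hs0.le]
  refine mul_le_mul_right (lintegral_rpow_average_le hmeas hs (ae_of_all _ fun z => ?_)) _
  refine (lintegral_torus_translate (fun x => ‖torusGrad v x‖ₑ ^ s) _).trans_le ?_
  exact (eLpNorm_ofReal_le_iff hs0).1 le_rfl

theorem enorm_integral_sub_le {s : ℝ} (hs : 1 ≤ s) {v u : Torus d → ℝ} (hv : Integrable v volume)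
    (hu : Integrable u volume) :
    ‖(∫ x, v x) - ∫ x, u x‖ₑ ≤ eLpNorm (fun x => v x - u x) (ENNReal.ofReal s) volume := by
  rw [← integral_sub hv hu]
  refine (enorm_integral_le_lintegral_enorm _).trans ?_
  rw [← eLpNorm_one_eq_lintegral_enorm]
  exact eLpNorm_le_eLpNorm_of_exponent_le (by simpa using hs) (hv.sub hu).1

theorem IsSobolev.poincare {s : ℝ} (hs : 1 ≤ s) {u : Torus d → ℝ} {G : Torus d → Space d}
    (h : IsSobolev s u G) :
    eLpNorm (fun x => u x - ∫ z, u z) (ENNReal.ofReal s) volume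
      ≤ ENNReal.ofReal √d * eLpNorm G (ENNReal.ofReal s) volume := by
  obtain ⟨v, hv, hvu, hvG⟩ := h.exists_smooth_approx hs
  have hs1 : 1 ≤ ENNReal.ofReal s := by simpa using hs
  have hui := h.integrable hs
  have hlim : Tendsto (fun n => eLpNorm (fun x => v n x - u x) (ENNReal.ofReal s) volume +
      (ENNReal.ofReal √d * (eLpNorm (fun x => torusGrad (v n) x - G x) (ENNReal.ofReal s) volume
        + eLpNorm G (ENNReal.ofReal s) volume)
      + eLpNorm (fun x => v n x - u x) (ENNReal.ofReal s) volume)) atTop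
      (𝓝 (0 + (ENNReal.ofReal √d * (0 + eLpNorm G (ENNReal.ofReal s) volume) + 0))) :=
    hvu.add ((ENNReal.Tendsto.const_mul (hvG.add tendsto_const_nhds)
      (Or.inr ENNReal.ofReal_ne_top)).add hvu)
  simp only [zero_add, add_zero] at hlim
  refine ge_of_tendsto' hlim fun n => ?_
  have hvn := (hv n).continuous
  have hvi := integrable_of_continuous hvn
  have e : (fun x => u x - ∫ z, u z) = (fun x => u x - v n x) +
      ((fun x => v n x - ∫ z, v n z) + fun _ => (∫ z, v n z) - ∫ z, u z) := by
    funext x; simp only [Pi.add_apply]; ring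
  have m1 : AEStronglyMeasurable (fun x => u x - v n x) volume := (hui.sub hvi).1
  have m2 : AEStronglyMeasurable (fun x => v n x - ∫ z, v n z) volume :=
    (hvn.sub continuous_const).aestronglyMeasurable
  have m4 : AEStronglyMeasurable (fun x => torusGrad (v n) x - G x) volume :=
    (hv n).continuous_torusGrad.aestronglyMeasurable.sub h.memLp_grad.1
  rw [e]
  refine (eLpNorm_add_le m1 (m2.add aestronglyMeasurable_const) hs1).trans (add_le_add ?_ ?_)
  · rw [← eLpNorm_neg]
    refine (congrArg (fun f => eLpNorm f (ENNReal.ofReal s) volume) ?_).le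
    funext x; simp
  refine (eLpNorm_add_le m2 aestronglyMeasurable_const hs1).trans (add_le_add ?_ ?_)
  · refine ((hv n).poincare hs).trans (mul_le_mul_right ?_ _)
    refine le_trans (congrArg (fun f => eLpNorm f (ENNReal.ofReal s) volume) ?_).le
      (eLpNorm_add_le m4 h.memLp_grad.1 hs1)
    funext x; simp
  · rw [eLpNorm_const _ (by positivity) (NeZero.ne _)]
    simpa using enorm_integral_sub_le hs hvi hui

/-- The change of variables y = th has Jacobian factor t^{-d}, and the contracted cube stays inside
the cube. -/
theorem lintegral_unitCube_smul_le {φ : Space d → ℝ≥0∞} (hφ : Measurable φ) {t : ℝ}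
    (ht : t ∈ Ioc (0 : ℝ) 1) :
    ∫⁻ h in unitCube d, φ (t • h) ≤ ENNReal.ofReal (t ^ d)⁻¹ * ∫⁻ h in unitCube d, φ h := by
  have hsub : ∀ h ∈ unitCube d, t • h ∈ unitCube d := fun h hh i => by
    have := hh i
    exact ⟨by simpa using mul_pos ht.1 this.1,
      by simpa using mul_le_one₀ ht.2 this.1.le this.2⟩
  calc ∫⁻ h in unitCube d, φ (t • h)
      ≤ ∫⁻ h, (unitCube d).indicator φ (t • h) := by
        rw [← lintegral_indicator measurableSet_unitCube]
        refine lintegral_mono fun h => ?_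
        by_cases hh : h ∈ unitCube d
        · simp [hh, hsub h hh]
        · simp [hh]
    _ = ∫⁻ y, (unitCube d).indicator φ y ∂(Measure.map (t • ·) (volume : Measure (Space d))) :=
        (lintegral_map (hφ.indicator measurableSet_unitCube) (measurable_const_smul t)).symm
    _ = _ := by
        rw [Measure.map_addHaar_smul volume ht.1.ne', lintegral_smul_measure,
          lintegral_indicator measurableSet_unitCube, finrank_euclideanSpace, Fintype.card_fin,
          abs_of_nonneg (inv_nonneg.2 (pow_nonneg ht.1.le d)), smul_eq_mul]

/-- The supremum of a `C^1` function of mean zero is controlled by the `L^s` norm of its gradient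
when `s` exceeds the dimension. -/
theorem exists_morrey_const {s : ℝ} (hs : 1 ≤ s) (hds : (d : ℝ) < s) :
    ∃ K : ℝ≥0∞, K ≠ ⊤ ∧ ∀ v : Torus d → ℝ, IsCn 1 v → ∀ x,
      ‖v x - ∫ z, v z‖ₑ ≤ K * eLpNorm (torusGrad v) (ENNReal.ofReal s) volume := by
  have hs0 : 0 < s := one_pos.trans_le hs
  -- Contraction by t costs t^{-d} in the s-th power of the norm, hence t^{-d/s} in the norm.
  -- Integrability at 0 is exactly the condition d < s.
  have hK : ∫⁻ t in Ioc (0 : ℝ) 1, ENNReal.ofReal (t ^ (-(d / s) : ℝ)) ≠ ⊤ := by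
    have h1 : IntervalIntegrable (fun t : ℝ => t ^ (-(d / s) : ℝ)) volume 0 1 :=
      intervalIntegral.intervalIntegrable_rpow' (by
        have := (div_lt_one hs0).2 hds; linarith)
    rw [intervalIntegrable_iff_integrableOn_Ioc_of_le zero_le_one] at h1
    exact h1.lintegral_lt_top.ne
  refine ⟨ENNReal.ofReal √d * ∫⁻ t in Ioc (0 : ℝ) 1, ENNReal.ofReal (t ^ (-(d / s) : ℝ)),
    ENNReal.mul_ne_top ENNReal.ofReal_ne_top hK, fun v hv x => ?_⟩
  refine (hv.enorm_sub_integral_le x).trans ?_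
  rw [mul_assoc]
  refine mul_le_mul_right ?_ _
  have hN : eLpNorm (torusGrad v) (ENNReal.ofReal s) volume ≠ ⊤ :=
    (memLp_of_continuous hv.continuous_torusGrad _).2.ne
  rw [← lintegral_mul_const' _ _ hN]
  refine setLIntegral_mono' measurableSet_Ioc fun t ht => ?_
  have hc : Continuous fun h : Space d => torusGrad v (x + toTorus h) :=
    hv.continuous_torusGrad.comp (continuous_const.add continuous_toTorus)
  have hct : Continuous fun h : Space d => torusGrad v (x + toTorus (t • h)) :=
    hc.comp (continuous_const_smul t)
  have h1 : ∫⁻ h in unitCube d, ‖torusGrad v (x + toTorus (t • h))‖ₑ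
      ≤ eLpNorm (fun h : Space d => torusGrad v (x + toTorus (t • h))) (ENNReal.ofReal s)
        (volume.restrict (unitCube d)) := by
    rw [← eLpNorm_one_eq_lintegral_enorm]
    exact eLpNorm_le_eLpNorm_of_exponent_le (by simpa using hs) hct.aestronglyMeasurable
  refine h1.trans ?_
  rw [eLpNorm_ofReal_le_iff hs0, ENNReal.mul_rpow_of_nonneg _ _ hs0.le]
  refine (lintegral_unitCube_smul_le
    (φ := fun h => ‖torusGrad v (x + toTorus h)‖ₑ ^ s) (hc.enorm.measurable.pow_const s) ht).trans ?_
  refine mul_le_mul' ?_ ?_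
  · rw [ENNReal.ofReal_rpow_of_nonneg (Real.rpow_nonneg ht.1.le _) hs0.le, ← Real.rpow_mul ht.1.le]
    refine ENNReal.ofReal_le_ofReal (le_of_eq ?_)
    rw [neg_mul, div_mul_cancel₀ _ hs0.ne', Real.rpow_neg ht.1.le, Real.rpow_natCast]
  · have hm : Measurable fun z : Torus d => ‖torusGrad v (x + z)‖ₑ ^ s :=
      ((hv.continuous_torusGrad.comp (continuous_const.add continuous_id)).enorm.measurable).pow_const s
    rw [measurePreserving_toTorus.lintegral_comp hm]
    refine (lintegral_add_left_eq_self (fun z => ‖torusGrad v z‖ₑ ^ s) x).trans_le ?_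
    exact (eLpNorm_ofReal_le_iff hs0).1 le_rfl

/-- Sobolev functions have a continuous representative when `s` exceeds the dimension. -/
theorem IsSobolev.exists_continuous {s : ℝ} (hs : 1 ≤ s) (hds : (d : ℝ) < s) {u : Torus d → ℝ}
    {G : Torus d → Space d} (h : IsSobolev s u G) :
    ∃ w : C(Torus d, ℝ), ∀ᵐ x, u x = w x := by
  obtain ⟨v, hv, hvu, hvG⟩ := h.exists_smooth_approx hs
  obtain ⟨K, hK, hmorrey⟩ := exists_morrey_const hs hds
  have hs1 : 1 ≤ ENNReal.ofReal s := by simpa using hs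
  set A : ℕ → ℝ≥0∞ := fun n => eLpNorm (fun x => v n x - u x) (ENNReal.ofReal s) volume
    + K * eLpNorm (fun x => torusGrad (v n) x - G x) (ENNReal.ofReal s) volume with hA
  have hA0 : Tendsto A atTop (𝓝 0) := by
    simpa using hvu.add (ENNReal.Tendsto.const_mul hvG (Or.inr hK))
  have hmG : ∀ n, AEStronglyMeasurable (fun x => torusGrad (v n) x - G x) volume := fun n =>
    (hv n).continuous_torusGrad.aestronglyMeasurable.sub h.memLp_grad.1
  have hmv : ∀ n, AEStronglyMeasurable (fun x => v n x - u x) volume := fun n =>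
    (hv n).continuous.aestronglyMeasurable.sub h.memLp.1
  -- Morrey controls the oscillation of v n - v m by the gradients, and the L^s norm controls its
  -- mean; so the approximations are uniformly Cauchy.
  have hdist : ∀ n m x, ‖v n x - v m x‖ₑ ≤ A n + A m := by
    intro n m x
    have hcn := integrable_of_continuous (hv n).continuous
    have hcm := integrable_of_continuous (hv m).continuous
    have e : v n x - v m x = ((v n x - v m x) - ∫ z, (v n z - v m z))
        + ((∫ z, v n z) - ∫ z, v m z) := by
      rw [integral_sub hcn hcm]; ring
    have b1 := hmorrey _ ((hv n).sub (hv m)) x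
    have b2 : eLpNorm (torusGrad fun x => v n x - v m x) (ENNReal.ofReal s) volume
        ≤ eLpNorm (fun x => torusGrad (v n) x - G x) (ENNReal.ofReal s) volume
          + eLpNorm (fun x => torusGrad (v m) x - G x) (ENNReal.ofReal s) volume := by
      refine le_trans (congrArg (fun f => eLpNorm f (ENNReal.ofReal s) volume) ?_).le
        (eLpNorm_sub_le (hmG n) (hmG m) hs1)
      funext x
      simp [torusGrad_sub (hv n) (hv m)]
    have b3 := enorm_integral_sub_le hs hcn hcm
    have b4 : eLpNorm (fun x => v n x - v m x) (ENNReal.ofReal s) volume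
        ≤ eLpNorm (fun x => v n x - u x) (ENNReal.ofReal s) volume
          + eLpNorm (fun x => v m x - u x) (ENNReal.ofReal s) volume := by
      refine le_trans (congrArg (fun f => eLpNorm f (ENNReal.ofReal s) volume) ?_).le
        (eLpNorm_sub_le (hmv n) (hmv m) hs1)
      funext x
      simp
    rw [e]
    refine (enorm_add_le _ _).trans ((add_le_add (b1.trans (mul_le_mul_right b2 K))
      (b3.trans b4)).trans_eq ?_)
    simp only [hA]
    ring
  let V : ℕ → C(Torus d, ℝ) := fun n => ⟨v n, (hv n).continuous⟩
  have hV : CauchySeq V := by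
    rw [Metric.cauchySeq_iff]
    intro e he
    have hev := hA0.eventually (Iio_mem_nhds (show (0 : ℝ≥0∞) < ENNReal.ofReal (e / 2) by simpa using he))
    obtain ⟨N, hN⟩ := eventually_atTop.1 hev
    refine ⟨N, fun n hn m hm => (ContinuousMap.dist_lt_iff he).2 fun x => ?_⟩
    have h1 := (hdist n m x).trans_lt (ENNReal.add_lt_add (hN n hn) (hN m hm))
    rw [← ENNReal.ofReal_add (by positivity) (by positivity), add_halves, ← ofReal_norm,
      ENNReal.ofReal_lt_ofReal_iff he] at h1
    simpa [V, Real.dist_eq] using h1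
  obtain ⟨w, hw⟩ := cauchySeq_tendsto_of_complete hV
  refine ⟨w, ?_⟩
  have hpt : ∀ x, Tendsto (fun n => v n x) atTop (𝓝 (w x)) := fun x =>
    ((continuous_eval_const x).tendsto w).comp hw
  have hmeas : TendstoInMeasure volume v atTop u :=
    tendstoInMeasure_of_tendsto_eLpNorm (by simpa using one_pos.trans_le hs)
      (fun n => (hv n).continuous.aestronglyMeasurable) h.memLp.1 hvu
  obtain ⟨ns, hns, hae⟩ := hmeas.exists_seq_tendsto_ae
  filter_upwards [hae] with x hx
  exact tendsto_nhds_unique hx ((hpt x).comp hns.tendsto_atTop)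

end

section

variable {d : ℕ}

/-! ### The inverse of the coupling and its primitive -/

/-- Truncation gives a globally continuous extension, whatever values f takes at negative arguments.
-/
theorem IsCoupling.continuous_max {f : Torus d → ℝ → ℝ} {q : ℝ} (hf : IsCoupling f q) :
    Continuous fun z : Torus d × ℝ => f z.1 (max z.2 0) :=
  hf.continuousOn.comp_continuous (f := fun z : Torus d × ℝ => (z.1, max z.2 0))
    (by fun_prop) fun z => ⟨mem_univ _, mem_Ici.2 (le_max_right _ _)⟩

theorem IsCoupling.continuous_zero {f : Torus d → ℝ → ℝ} {q : ℝ} (hf : IsCoupling f q) :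
    Continuous fun x => f x 0 := by
  simpa [Function.comp_def] using hf.continuous_max.comp (continuous_id.prodMk (continuous_const (y := (0 : ℝ))))

theorem IsCoupling.exists_inverse {f : Torus d → ℝ → ℝ} {q : ℝ} (hq : 1 < q)
    (hf : IsCoupling f q) :
    ∃ M : Torus d → ℝ → ℝ, Continuous (Function.uncurry M) ∧ (∀ x a, 0 ≤ M x a) ∧
      ∀ x a, f x (M x a) = max a (f x 0) := by
  obtain ⟨C, hC, hgr⟩ := hf.growth
  have hq1 : 0 < q - 1 := by linarith
  have hex : ∀ x a, ∃ m, 0 ≤ m ∧ f x m = max a (f x 0) := by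
    intro x a
    -- The solution of b^{q-1}/C - C = |a|: by the lower growth bound f x b ≥ a, and the
    -- intermediate value theorem applies on [0, b].
    set b := (C * (|a| + C)) ^ (q - 1)⁻¹ with hb
    have hb0 : 0 ≤ b := by positivity
    have hfb : a ≤ f x b := by
      have h1 := (hgr x b hb0).1
      have h2 : |b| ^ (q - 1) = C * (|a| + C) := by
        rw [abs_of_nonneg hb0, hb, Real.rpow_inv_rpow (by positivity) hq1.ne']
      rw [h2] at h1
      have h3 : 1 / C * (C * (|a| + C)) - C = |a| := by field_simp; ring
      rw [h3] at h1
      exact (le_abs_self a).trans h1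
    have hcont : ContinuousOn (f x) (Icc 0 b) :=
      hf.continuousOn.comp (f := fun m => (x, m)) (by fun_prop) fun m hm => ⟨mem_univ _, hm.1⟩
    have hmono := (hf.strictMonoOn x).monotoneOn
    obtain ⟨m, hm, hfm⟩ := intermediate_value_Icc hb0 hcont
      (show max a (f x 0) ∈ Icc (f x 0) (f x b) from
        ⟨le_max_right _ _, max_le hfb (hmono self_mem_Ici hb0 hb0)⟩)
    exact ⟨m, hm.1, hfm⟩
  choose M hM0 hM using hex
  refine ⟨M, ?_, hM0, hM⟩
  -- Joint continuity of M in (x, a) follows from this order relation and the next, whose right-hand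
  -- sides compare jointly continuous functions and so define open conditions.
  have hlt : ∀ x a m, 0 ≤ m → (M x a < m ↔ max a (f x 0) < f x m) := fun x a m hm => by
    rw [← hM x a]
    exact ((hf.strictMonoOn x).lt_iff_lt (hM0 x a) hm).symm
  have hgt : ∀ x a m, 0 ≤ m → (m < M x a ↔ f x m < max a (f x 0)) := fun x a m hm => by
    rw [← hM x a]
    exact ((hf.strictMonoOn x).lt_iff_lt hm (hM0 x a)).symm
  have hc1 : Continuous fun z : Torus d × ℝ => max z.2 (f z.1 0) :=
    continuous_snd.max (hf.continuous_zero.comp continuous_fst)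
  have hc2 : ∀ m : ℝ, 0 ≤ m → Continuous fun z : Torus d × ℝ => f z.1 m := fun m hm => by
    have := hf.continuous_max.comp
      (continuous_fst.prodMk (continuous_const (y := m)) : Continuous fun z : Torus d × ℝ => (z.1, m))
    simpa [Function.comp_def, max_eq_left hm] using this
  rw [continuous_iff_continuousAt]
  rintro ⟨x, a⟩
  refine tendsto_order.2 ⟨fun m hm => ?_, fun m hm => ?_⟩
  · rcases lt_or_ge m 0 with h | h
    · exact Eventually.of_forall fun z => h.trans_le (hM0 _ _)
    · filter_upwards [(hc2 m h).continuousAt.eventually_lt hc1.continuousAt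
        ((hgt x a m h).1 hm)] with z hz
      exact (hgt z.1 z.2 m h).2 hz
  · have h : 0 ≤ m := (hM0 x a).trans hm.le
    filter_upwards [hc1.continuousAt.eventually_lt (hc2 m h).continuousAt
      ((hlt x a m h).1 hm)] with z hz
    exact (hlt z.1 z.2 m h).2 hz

/-- `M x` is the inverse of the coupling `f x`, extended by zero, and `B x` is a primitive
of `M x`. -/
structure IsPotential (f : Torus d → ℝ → ℝ) (p : ℝ) (M B : Torus d → ℝ → ℝ) : Prop where
  continuous_inv : Continuous (Function.uncurry M)
  inv_nonneg : ∀ x a, 0 ≤ M x a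
  apply_inv : ∀ x a, f x (M x a) = max a (f x 0)
  continuous : Continuous (Function.uncurry B)
  nonneg : ∀ x a, 0 ≤ B x a
  hasDerivAt : ∀ x a, HasDerivAt (B x) (M x a) a
  monotone : ∀ x, Monotone (B x)
  convexOn : ∀ x, ConvexOn ℝ univ (B x)
  inv_le : ∃ K, 0 < K ∧ ∀ x a, M x a ≤ K * (1 + |a|) ^ (p - 1)
  le : ∃ K, 0 < K ∧ ∀ x a, B x a ≤ K * (1 + |a|) ^ p
  coercive : ∃ k, 0 < k ∧ ∃ K, ∀ x a, k * (max a 0) ^ p - K ≤ B x a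
  superlinear : ∃ K, ∀ x a, 2 * a - K ≤ B x a

theorem tangent_le {g : ℝ → ℝ} {g' a : ℝ} (hg : ConvexOn ℝ univ g) (h : HasDerivAt g g' a) (b : ℝ) :
    g a + g' * (b - a) ≤ g b := by
  rcases lt_trichotomy a b with hab | rfl | hab
  · have h1 := hg.le_slope_of_hasDerivAt (mem_univ a) (mem_univ b) hab h
    rw [slope_def_field, le_div_iff₀ (sub_pos.2 hab)] at h1
    linarith
  · simp
  · have h1 := hg.slope_le_of_hasDerivAt (mem_univ b) (mem_univ a) hab h
    rw [slope_def_field, div_le_iff₀ (sub_pos.2 hab)] at h1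
    linarith

/-- As (p-1)(q-1) = 1, inverting the growth of f makes `M` of order p - 1. The bounds on `B` come
from its tangent lines: the one at a evaluated at -C bounds B(a) from above, the one at a/2
evaluated at a bounds it from below. -/
theorem IsCoupling.exists_potential {f : Torus d → ℝ → ℝ} {p q : ℝ} (hpq : p.HolderConjugate q)
    (hf : IsCoupling f q) : ∃ M B, IsPotential f p M B := by
  have hq : 1 < q := hpq.symm.lt
  have hp : 1 < p := hpq.lt
  have hp1 : 0 < p - 1 := by linarith
  have hq1 : 0 < q - 1 := by linarith
  have hinv : (q - 1) * (p - 1) = 1 := by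
    have := hpq.sub_one_mul_conj
    nlinarith
  obtain ⟨M, hMc, hM0, hM⟩ := hf.exists_inverse hq
  obtain ⟨C, hC, hgr⟩ := hf.growth
  have hf0 : ∀ x, -C ≤ f x 0 := fun x => by
    have := (hgr x 0 le_rfl).1
    simpa [Real.zero_rpow hq1.ne'] using this
  have hMx : ∀ x, Continuous (M x) := fun x => hMc.comp (by fun_prop : Continuous fun a => (x, a))
  have hmono : ∀ x, Monotone (M x) := fun x a b hab => by
    refine ((hf.strictMonoOn x).le_iff_le (hM0 x a) (hM0 x b)).1 ?_
    rw [hM, hM]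
    exact max_le_max_right _ hab
  have hzero : ∀ x a, a ≤ f x 0 → M x a = 0 := fun x a ha => by
    refine ((hf.strictMonoOn x).eq_iff_eq (hM0 x a) self_mem_Ici).1 ?_
    rw [hM, max_eq_right ha]
  have hroot : ∀ m : ℝ, 0 ≤ m → (m ^ (q - 1)) ^ (p - 1) = m := fun m hm => by
    rw [← Real.rpow_mul hm, hinv, Real.rpow_one]
  have hMle : ∀ x a, M x a ≤ (C * (1 + C)) ^ (p - 1) * (1 + |a|) ^ (p - 1) := by
    intro x a
    rcases le_total a (f x 0) with ha | ha
    · rw [hzero x a ha]; positivity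
    · have h1 := (hgr x (M x a) (hM0 x a)).1
      rw [hM, max_eq_left ha, abs_of_nonneg (hM0 x a)] at h1
      have h2 : M x a ^ (q - 1) ≤ C * (a + C) := by
        have h3 : 1 / C * M x a ^ (q - 1) ≤ a + C := by linarith
        rwa [one_div, inv_mul_le_iff₀ hC] at h3
      have h4 : C * (a + C) ≤ C * (1 + C) * (1 + |a|) := by
        rw [mul_assoc]
        refine mul_le_mul_of_nonneg_left ?_ hC.le
        nlinarith [le_abs_self a, abs_nonneg a]
      rw [← Real.mul_rpow (by positivity) (by positivity), ← hroot _ (hM0 x a)]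
      exact Real.rpow_le_rpow (Real.rpow_nonneg (hM0 x a) _) (h2.trans h4) hp1.le
  have hleM : ∀ x a, C ≤ a → ((a - C) / C) ^ (p - 1) ≤ M x a := by
    intro x a ha
    have h1 := (hgr x (M x a) (hM0 x a)).2
    rw [hM, abs_of_nonneg (hM0 x a)] at h1
    have h2 : (a - C) / C ≤ M x a ^ (q - 1) := by
      rw [div_le_iff₀ hC]
      nlinarith [le_max_left a (f x 0)]
    calc ((a - C) / C) ^ (p - 1) ≤ (M x a ^ (q - 1)) ^ (p - 1) :=
          Real.rpow_le_rpow (div_nonneg (by linarith) hC.le) h2 hp1.le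
      _ = M x a := hroot _ (hM0 x a)
  -- The base point -C lies below every f x 0, so M x vanishes to its left; therefore B is
  -- nonnegative, and continuous in x since the base point is fixed.
  set B : Torus d → ℝ → ℝ := fun x a => ∫ t in (-C)..a, M x t with hB
  have hderiv : ∀ x a, HasDerivAt (B x) (M x a) a := fun x a =>
    ((hMx x).integral_hasStrictDerivAt (-C) a).hasDerivAt
  have hdiff : ∀ x, Differentiable ℝ (B x) := fun x a => (hderiv x a).differentiableAt
  have hderiv' : ∀ x, deriv (B x) = M x := fun x => funext fun a => (hderiv x a).deriv
  have hB0 : ∀ x a, 0 ≤ B x a := by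
    intro x a
    rcases le_total (-C) a with ha | ha
    · exact intervalIntegral.integral_nonneg ha fun t _ => hM0 x t
    · have : B x a = ∫ _ in (-C)..a, (0 : ℝ) := by
        refine intervalIntegral.integral_congr fun t ht => ?_
        rw [uIcc_of_ge ha] at ht
        exact hzero x t (ht.2.trans (hf0 x))
      rw [this]; simp
  have hconv : ∀ x, ConvexOn ℝ univ (B x) := fun x =>
    Monotone.convexOn_univ_of_deriv (hdiff x) (by rw [hderiv']; exact hmono x)
  have hBC : ∀ x, B x (-C) = 0 := fun x => intervalIntegral.integral_same
  refine ⟨M, B, hMc, hM0, hM, ?_, hB0, hderiv,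
    fun x => monotone_of_deriv_nonneg (hdiff x) fun a => by rw [hderiv']; exact hM0 x a,
    hconv, ⟨_, by positivity, hMle⟩, ?_, ?_, ?_⟩
  · have h1 : Continuous (Function.uncurry fun (z : Torus d × ℝ) (t : ℝ) => M z.1 t) :=
      hMc.comp (by fun_prop : Continuous fun w : (Torus d × ℝ) × ℝ => (w.1.1, w.2))
    exact intervalIntegral.continuous_parametric_intervalIntegral_of_continuous h1 continuous_snd
  · refine ⟨(C * (1 + C)) ^ (p - 1) * (1 + C), by positivity, fun x a => ?_⟩
    have h1 := tangent_le (hconv x) (hderiv x a) (-C)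
    rw [hBC] at h1
    have h2 : B x a ≤ M x a * (a + C) := by linarith
    have h3 : a + C ≤ (1 + C) * (1 + |a|) := by nlinarith [le_abs_self a, abs_nonneg a]
    have h4 : (1 + |a|) ^ p = (1 + |a|) ^ (p - 1) * (1 + |a|) := by
      rw [← Real.rpow_add_one (by positivity)]; ring_nf
    calc B x a ≤ M x a * (a + C) := h2
      _ ≤ M x a * ((1 + C) * (1 + |a|)) := mul_le_mul_of_nonneg_left h3 (hM0 x a)
      _ ≤ ((C * (1 + C)) ^ (p - 1) * (1 + |a|) ^ (p - 1)) * ((1 + C) * (1 + |a|)) :=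
          mul_le_mul_of_nonneg_right (hMle x a) (by positivity)
      _ = _ := by rw [h4]; ring
  · have hk : 0 < 1 / 2 * (1 / (4 * C)) ^ (p - 1) := by positivity
    refine ⟨1 / 2 * (1 / (4 * C)) ^ (p - 1), hk,
      1 / 2 * (1 / (4 * C)) ^ (p - 1) * (4 * C) ^ p, fun x a => ?_⟩
    -- The threshold makes a/2 - C ≥ a/4, so M at a/2 is at least (a/(4C))^{p-1}; below it the
    -- constant K dominates the power.
    rcases le_total a (4 * C) with ha | ha
    · have h1 : max a 0 ^ p ≤ (4 * C) ^ p :=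
        Real.rpow_le_rpow (le_max_right _ _) (max_le ha (by positivity)) (by linarith)
      nlinarith [hB0 x a, mul_le_mul_of_nonneg_left h1 hk.le]
    · have ha0 : 0 < a := by linarith
      have h1 := tangent_le (hconv x) (hderiv x (a / 2)) a
      have h2 : (a / (4 * C)) ^ (p - 1) ≤ M x (a / 2) := by
        refine le_trans (Real.rpow_le_rpow (by positivity) ?_ hp1.le) (hleM x (a / 2) (by linarith))
        rw [div_le_div_iff₀ (by positivity) hC]
        nlinarith
      have h3 : max a 0 ^ p = a ^ (p - 1) * a := by
        rw [max_eq_left ha0.le, ← Real.rpow_add_one ha0.ne']; ring_nf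
      have h4 : (a / (4 * C)) ^ (p - 1) = (1 / (4 * C)) ^ (p - 1) * a ^ (p - 1) := by
        rw [← Real.mul_rpow (by positivity) ha0.le]; ring_nf
      have h5 : 0 ≤ 1 / 2 * (1 / (4 * C)) ^ (p - 1) * (4 * C) ^ p := by positivity
      rw [h3]
      have h6 : (1 / (4 * C)) ^ (p - 1) * a ^ (p - 1) * (a / 2) ≤ M x (a / 2) * (a / 2) :=
        mul_le_mul_of_nonneg_right (h4 ▸ h2) (by linarith)
      have h7 : a - a / 2 = a / 2 := by ring
      rw [h7] at h1
      nlinarith [hB0 x (a / 2)]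
  · set a₁ := C + C * 2 ^ (q - 1) with ha₁
    have hM2 : ∀ x, 2 ≤ M x a₁ := fun x => by
      have h1 := hleM x a₁ (by rw [ha₁]; have : 0 ≤ C * 2 ^ (q - 1) := by positivity
                               linarith)
      have h2 : (a₁ - C) / C = 2 ^ (q - 1) := by rw [ha₁]; field_simp; ring
      rwa [h2, hroot 2 zero_le_two] at h1
    refine ⟨2 * a₁, fun x a => ?_⟩
    have h1 := tangent_le (hconv x) (hderiv x a₁) a
    rcases le_total a₁ a with h | h
    · nlinarith [hM2 x, hB0 x a₁]
    · linarith [hB0 x a]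

theorem IsPotential.le_apply_inv {f : Torus d → ℝ → ℝ} {p : ℝ} {M B : Torus d → ℝ → ℝ}
    (h : IsPotential f p M B) (x : Torus d) (a : ℝ) : a ≤ f x (M x a) :=
  h.apply_inv x a ▸ le_max_left _ _

/-- If M x a > 0 then f x (M x a) exceeds f x 0, so the maximum defining it is a. This yields the
Hamilton–Jacobi equation on {m > 0}. -/
theorem IsPotential.apply_inv_of_pos {f : Torus d → ℝ → ℝ} {p q : ℝ} {M B : Torus d → ℝ → ℝ}
    (hf : IsCoupling f q) (h : IsPotential f p M B) {x : Torus d} {a : ℝ} (hpos : 0 < M x a) :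
    f x (M x a) = a := by
  have h1 := hf.strictMonoOn x self_mem_Ici hpos.le hpos
  rw [h.apply_inv] at h1 ⊢
  rcases max_choice a (f x 0) with h2 | h2
  · exact h2
  · exact absurd h1 (by rw [h2]; exact lt_irrefl _)

/-! ### The Hamiltonian -/

theorem IsHamiltonian.gradient_inner_le {H : Torus d → Space d → ℝ} {r : ℝ}
    (hH : IsHamiltonian H r) (x : Torus d) (ξ ζ : Space d) :
    H x ξ + inner ℝ (gradient (H x) ξ) (ζ - ξ) ≤ H x ζ := by
  have h1 : ConvexOn ℝ univ (H x ∘ AffineMap.lineMap (k := ℝ) ξ ζ) := by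
    simpa using (hH.strictConvexOn x).convexOn.comp_affineMap (AffineMap.lineMap (k := ℝ) ξ ζ)
  have h2 : HasDerivAt (H x ∘ AffineMap.lineMap (k := ℝ) ξ ζ)
      (inner ℝ (gradient (H x) ξ) (ζ - ξ)) 0 := by
    have hg := ((hH.differentiable x) (AffineMap.lineMap (k := ℝ) ξ ζ (0 : ℝ))).hasGradientAt.hasFDerivAt
    have h3 := hg.comp_hasDerivAt (0 : ℝ) AffineMap.hasDerivAt_lineMap
    rw [InnerProductSpace.toDual_apply_apply, AffineMap.lineMap_apply_zero] at h3
    exact h3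
  simpa using tangent_le h1 h2 1

/-- The tangent inequality at the midpoint of ξ and ζ, combined with strict convexity there. -/
theorem IsHamiltonian.gradient_inner_lt {H : Torus d → Space d → ℝ} {r : ℝ}
    (hH : IsHamiltonian H r) (x : Torus d) {ξ ζ : Space d} (hne : ξ ≠ ζ) :
    H x ξ + inner ℝ (gradient (H x) ξ) (ζ - ξ) < H x ζ := by
  have h1 := (hH.strictConvexOn x).2 (mem_univ ξ) (mem_univ ζ) hne
    (by norm_num : (0 : ℝ) < 1 / 2) (by norm_num : (0 : ℝ) < 1 / 2) (by norm_num)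
  have h2 := hH.gradient_inner_le x ξ ((1 / 2 : ℝ) • ξ + (1 / 2 : ℝ) • ζ)
  have h3 : (1 / 2 : ℝ) • ξ + (1 / 2 : ℝ) • ζ - ξ = (1 / 2 : ℝ) • (ζ - ξ) := by module
  rw [h3, inner_smul_right] at h2
  simp only [smul_eq_mul] at h1
  linarith

/-- The gradient bound is not assumed: convexity derives it from the two-sided growth of H. -/
theorem IsHamiltonian.exists_bounds {H : Torus d → Space d → ℝ} {r : ℝ} (hr : 1 < r)
    (hH : IsHamiltonian H r) : ∃ K, 0 < K ∧ ∀ x ξ,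
      |H x ξ| ≤ K * (1 + ‖ξ‖) ^ r ∧ ‖gradient (H x) ξ‖ ≤ K * (1 + ‖ξ‖) ^ (r - 1) ∧
      ‖ξ‖ ^ r ≤ K * (H x ξ + K) := by
  obtain ⟨C, hC, hgr⟩ := hH.growth
  have hr0 : 0 < r := by linarith
  have hone : ∀ ξ : Space d, 1 ≤ (1 + ‖ξ‖) ^ r := fun ξ =>
    Real.one_le_rpow (by linarith [norm_nonneg ξ]) hr0.le
  have habs : ∀ x ξ, |H x ξ| ≤ 2 * C * (1 + ‖ξ‖) ^ r := by
    intro x ξ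
    have h1 : ‖ξ‖ ^ r ≤ (1 + ‖ξ‖) ^ r :=
      Real.rpow_le_rpow (norm_nonneg _) (by linarith) hr0.le
    have h2 : 0 ≤ 1 / C * ‖ξ‖ ^ r := by positivity
    rw [abs_le]
    constructor <;> nlinarith [hgr x ξ, hone ξ]
  have hgrad : ∀ x ξ, ‖gradient (H x) ξ‖ ≤ (2 * C * 2 ^ r + 2 * C) * (1 + ‖ξ‖) ^ (r - 1) := by
    intro x ξ
    set g := gradient (H x) ξ with hg
    rcases eq_or_ne g 0 with h0 | h0
    · rw [h0, norm_zero]; positivity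
    have hgn : 0 < ‖g‖ := norm_pos_iff.2 h0
    -- A step of length 1 + ‖ξ‖ along the gradient g: the tangent inequality there bounds (1 +
    -- ‖ξ‖)‖g‖ by values of H of order (1 + ‖ξ‖)^r.
    set e : Space d := ((1 + ‖ξ‖) * ‖g‖⁻¹) • g with he
    have hen : ‖e‖ = 1 + ‖ξ‖ := by
      rw [he, norm_smul, Real.norm_of_nonneg (by positivity), mul_assoc, inv_mul_cancel₀ hgn.ne',
        mul_one]
    have h1 := hH.gradient_inner_le x ξ (ξ + e)
    rw [add_sub_cancel_left, he, inner_smul_right, ← hg, real_inner_self_eq_norm_sq, ← he] at h1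
    have h2 : (1 + ‖ξ‖) * ‖g‖⁻¹ * ‖g‖ ^ 2 = (1 + ‖ξ‖) * ‖g‖ := by field_simp
    rw [h2] at h1
    have h3 : (1 + ‖ξ + e‖) ^ r ≤ 2 ^ r * (1 + ‖ξ‖) ^ r := by
      rw [← Real.mul_rpow zero_le_two (by positivity)]
      refine Real.rpow_le_rpow (by positivity) ?_ hr0.le
      have := norm_add_le ξ e
      rw [hen] at this
      linarith
    have h4 := (abs_le.1 (habs x ξ)).1
    have h5 := (le_abs_self _).trans (habs x (ξ + e))
    have h6 : (1 + ‖ξ‖) ^ r = (1 + ‖ξ‖) ^ (r - 1) * (1 + ‖ξ‖) := by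
      rw [← Real.rpow_add_one (by positivity)]; ring_nf
    have h7 : (1 + ‖ξ‖) * ‖g‖ ≤ (2 * C * 2 ^ r + 2 * C) * (1 + ‖ξ‖) ^ r := by
      nlinarith [mul_le_mul_of_nonneg_left h3 (show 0 ≤ 2 * C by positivity)]
    rw [h6] at h7
    have hpos : 0 < 1 + ‖ξ‖ := by positivity
    refine le_of_mul_le_mul_left ?_ hpos
    calc (1 + ‖ξ‖) * ‖g‖ ≤ _ := h7
      _ = _ := by ring
  have hp2 : (0 : ℝ) ≤ 2 * C * 2 ^ r := by positivity
  refine ⟨2 * C * 2 ^ r + 2 * C, by positivity, fun x ξ => ⟨?_, hgrad x ξ, ?_⟩⟩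
  · refine (habs x ξ).trans (mul_le_mul_of_nonneg_right (by linarith) (by positivity))
  · have h1 := (hgr x ξ).1
    have h2 : ‖ξ‖ ^ r ≤ C * (H x ξ + C) := by
      have h3 : 1 / C * ‖ξ‖ ^ r ≤ H x ξ + C := by linarith
      rwa [one_div, inv_mul_le_iff₀ hC] at h3
    have h4 : 0 ≤ H x ξ + C := by
      have : 0 ≤ 1 / C * ‖ξ‖ ^ r := by positivity
      linarith
    refine h2.trans (mul_le_mul (by linarith) (by linarith) h4 (by positivity))

end

section

variable {d : ℕ}

/-! ### Minimizing sequences that converge strongly -/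

/-- A convex function on an abstract space with midpoints has minimizing sequences that are almost
minimal for a second function `Φ`, hence have small convexity gaps. -/
theorem exists_minimizing_seq {X : Type*} [Nonempty X] (J Φ : X → ℝ) (mid : X → X → X)
    (hmid : ∀ a b, J (mid a b) ≤ (J a + J b) / 2) (hΦ0 : ∀ a, 0 ≤ Φ a)
    {R : ℝ} (hR : ∀ a, J a ≤ sInf (range J) + 1 → Φ a ≤ R) :
    ∃ z : ℕ → X, (∀ n : ℕ, J (z n) ≤ sInf (range J) + 1 / ((n : ℝ) + 1)) ∧
      ∃ e : ℕ → ℝ, Tendsto e atTop (𝓝 0) ∧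
        ∀ n m, n ≤ m → (Φ (z n) + Φ (z m)) / 2 - Φ (mid (z n) (z m)) ≤ e n := by
  set I := sInf (range J)
  let K : ℕ → Set X := fun n => {a | J a ≤ I + 1 / ((n : ℝ) + 1)}
  have hpos : ∀ n : ℕ, (0 : ℝ) < 1 / ((n : ℝ) + 1) := fun n => Nat.one_div_pos_of_nat
  have hKne : ∀ n, (K n).Nonempty := fun n => by
    obtain ⟨_, ⟨a, rfl⟩, ha⟩ := exists_lt_of_csInf_lt (range_nonempty J)
      (lt_add_of_pos_right I (hpos n))
    exact ⟨a, ha.le⟩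
  have hKmono : ∀ n m, n ≤ m → K m ⊆ K n := fun n m hnm a (ha : J a ≤ _) => by
    have := Nat.one_div_le_one_div (α := ℝ) hnm
    show J a ≤ _
    linarith
  have hKR : ∀ n, ∀ a ∈ K n, Φ a ≤ R := fun n a ha => hR a (by
    have := hKmono 0 n (Nat.zero_le n) ha
    simpa [K] using this)
  -- As the sublevels `K n` shrink these infima increase, and they are bounded; their convergence
  -- makes the gaps small.
  let F : ℕ → ℝ := fun n => sInf (Φ '' K n)
  have hbdd : ∀ n, BddBelow (Φ '' K n) := fun n => ⟨0, by rintro _ ⟨a, -, rfl⟩; exact hΦ0 a⟩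
  have hF : ∀ n, ∀ a ∈ K n, F n ≤ Φ a := fun n a ha => csInf_le (hbdd n) ⟨a, ha, rfl⟩
  have hFmono : Monotone F := fun n m hnm =>
    csInf_le_csInf (hbdd n) ((hKne m).image Φ) (image_mono (hKmono n m hnm))
  have hFbdd : BddAbove (range F) := ⟨R, by
    rintro _ ⟨n, rfl⟩
    obtain ⟨a, ha⟩ := hKne n
    exact (hF n a ha).trans (hKR n a ha)⟩
  have hlim := tendsto_atTop_ciSup hFmono hFbdd
  have hz : ∀ n, ∃ a ∈ K n, Φ a ≤ F n + 1 / ((n : ℝ) + 1) := fun n => by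
    obtain ⟨_, ⟨a, ha, rfl⟩, hlt⟩ := exists_lt_of_csInf_lt ((hKne n).image Φ)
      (lt_add_of_pos_right (F n) (hpos n))
    exact ⟨a, ha, hlt.le⟩
  choose z hzK hzΦ using hz
  refine ⟨z, hzK, fun n => ((⨆ k, F k) - F n) / 2 + 1 / ((n : ℝ) + 1), ?_, fun n m hnm => ?_⟩
  · have h1 : Tendsto (fun n => ((⨆ k, F k) - F n) / 2) atTop (𝓝 (((⨆ k, F k) - ⨆ k, F k) / 2)) :=
      (tendsto_const_nhds.sub hlim).div_const 2
    simpa using h1.add tendsto_one_div_add_atTop_nhds_zero_nat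
  -- Both points lie in the larger sublevel `K n`, hence so does their midpoint, where Φ is at least
  -- F n; and Φ at z n and at z m is at most F n and sup F, up to 1/(n+1).
  · have h1 : mid (z n) (z m) ∈ K n := by
      have h2 : J (z n) ≤ _ := hzK n
      have h3 : J (z m) ≤ I + 1 / ((n : ℝ) + 1) := hKmono n m hnm (hzK m)
      show J (mid (z n) (z m)) ≤ I + 1 / ((n : ℝ) + 1)
      linarith [hmid (z n) (z m)]
    have h4 := hF n _ h1
    have h5 := le_ciSup hFbdd m
    have h6 := Nat.one_div_le_one_div (α := ℝ) hnm
    linarith [hzΦ n, hzΦ m]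

/-! ### Quantitative strict convexity of √(1 + ‖a‖²) -/

variable {E : Type*} [NormedAddCommGroup E]

/-- A smooth strictly convex function of linear growth. -/
def bracket (a : E) : ℝ := √(1 + ‖a‖ ^ 2)

theorem bracket_sq (a : E) : bracket a ^ 2 = 1 + ‖a‖ ^ 2 := Real.sq_sqrt (by positivity)

theorem one_le_bracket (a : E) : 1 ≤ bracket a := Real.one_le_sqrt.2 (by nlinarith [norm_nonneg a])

theorem bracket_le (a : E) : bracket a ≤ 1 + ‖a‖ :=
  Real.sqrt_le_iff.2 ⟨by positivity, by nlinarith [norm_nonneg a]⟩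

theorem continuous_bracket : Continuous (bracket : E → ℝ) := by
  unfold bracket
  fun_prop

variable [InnerProductSpace ℝ E]

/-- The convexity gap of `bracket`. -/
def bracketGap (a b : E) : ℝ :=
  (bracket a + bracket b) / 2 - bracket ((1 / 2 : ℝ) • (a + b))

/-- Write A, B, M for the brackets of a, b and their midpoint. Cauchy–Schwarz gives ‖a-b‖² ≤ (AB)² -
(1+⟨a,b⟩)², which contains the factor AB - 1 - ⟨a,b⟩; the identity ((A+B)/2)² - M² = (AB - 1 -
⟨a,b⟩)/2 expresses this factor through the gap. -/
theorem norm_sub_sq_le_bracketGap (a b : E) :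
    ‖a - b‖ ^ 2 ≤ 4 * (bracket a * bracket b) * (bracket a + bracket b) * bracketGap a b := by
  set A := bracket a
  set B := bracket b
  set M := bracket ((1 / 2 : ℝ) • (a + b)) with hM
  have hA : A ^ 2 = 1 + ‖a‖ ^ 2 := bracket_sq a
  have hB : B ^ 2 = 1 + ‖b‖ ^ 2 := bracket_sq b
  have hA1 : 1 ≤ A := one_le_bracket a
  have hB1 : 1 ≤ B := one_le_bracket b
  have hM1 : 1 ≤ M := one_le_bracket _
  have hsub := norm_sub_sq_real a b
  have hadd := norm_add_sq_real a b
  have hM2 : M ^ 2 = 1 + ‖a + b‖ ^ 2 / 4 := by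
    rw [hM, bracket_sq, norm_smul]
    norm_num
    ring
  set i := inner ℝ a b
  have hcs : i ^ 2 ≤ ‖a‖ ^ 2 * ‖b‖ ^ 2 := by
    have h1 := abs_real_inner_le_norm a b
    have h2 := sq_le_sq' (by linarith [neg_abs_le i, abs_nonneg i, norm_nonneg a]) (le_of_abs_le h1)
    rwa [mul_pow] at h2
  have hAB : ‖a - b‖ ^ 2 ≤ (A * B) ^ 2 - (1 + i) ^ 2 := by
    rw [mul_pow, hA, hB, hsub]
    nlinarith
  have hle : |1 + i| ≤ A * B :=
    abs_le_of_sq_le_sq (by nlinarith [sq_nonneg ‖a - b‖]) (by positivity)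
  have hle' := abs_le.1 hle
  have h1 : ‖a - b‖ ^ 2 ≤ (A * B - 1 - i) * (2 * (A * B)) := by
    have : (A * B) ^ 2 - (1 + i) ^ 2 = (A * B - 1 - i) * (A * B + 1 + i) := by ring
    rw [this] at hAB
    refine hAB.trans (mul_le_mul_of_nonneg_left (by linarith) (by linarith))
  have h2 : ((A + B) / 2 - M) * ((A + B) / 2 + M) = (A * B - 1 - i) / 2 := by
    have : ((A + B) / 2 - M) * ((A + B) / 2 + M) = (A ^ 2 + B ^ 2 + 2 * (A * B)) / 4 - M ^ 2 := by
      ring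
    rw [this, hA, hB, hM2, hadd]
    ring
  have hg : 0 ≤ (A + B) / 2 - M := by
    by_contra hneg
    push Not at hneg
    have : ((A + B) / 2 - M) * ((A + B) / 2 + M) < 0 :=
      mul_neg_of_neg_of_pos hneg (by linarith)
    linarith
  have h3 : A * B - 1 - i ≤ 2 * ((A + B) * ((A + B) / 2 - M)) := by
    have : (A * B - 1 - i) = 2 * (((A + B) / 2 - M) * ((A + B) / 2 + M)) := by linarith
    rw [this]
    have : ((A + B) / 2 - M) * ((A + B) / 2 + M) ≤ ((A + B) / 2 - M) * (A + B) :=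
      mul_le_mul_of_nonneg_left (by linarith) hg
    linarith
  calc ‖a - b‖ ^ 2 ≤ (A * B - 1 - i) * (2 * (A * B)) := h1
    _ ≤ (2 * ((A + B) * ((A + B) / 2 - M))) * (2 * (A * B)) :=
        mul_le_mul_of_nonneg_right h3 (by positivity)
    _ = 4 * (A * B) * (A + B) * ((A + B) / 2 - M) := by ring

theorem bracketGap_nonneg (a b : E) : 0 ≤ bracketGap a b := by
  have h := norm_sub_sq_le_bracketGap a b
  have hA := one_le_bracket a
  have hB := one_le_bracket b
  by_contra hneg
  push Not at hneg
  have : 4 * (bracket a * bracket b) * (bracket a + bracket b) * bracketGap a b < 0 :=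
    mul_neg_of_pos_of_neg (by positivity) hneg
  nlinarith [sq_nonneg ‖a - b‖]

/-- Small convexity gaps force points to be close, up to a small multiple of higher powers. -/
theorem exists_norm_sub_le_bracketGap {s : ℝ} (hs : 1 < s) {η : ℝ} (hη : 0 < η) :
    ∃ K, 0 ≤ K ∧ ∀ a b : E,
      ‖a - b‖ ≤ η * (1 + ‖a‖ ^ s + ‖b‖ ^ s) + K * bracketGap a b := by
  have hs1 : 0 < s - 1 := by linarith
  -- Beyond R one has 2t ≤ ηt^s, so if one vector is longer than R the powers alone bound ‖a - b‖.
  -- On the ball of radius R the gap controls ‖a - b‖².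
  set R := (2 / η) ^ (s - 1)⁻¹ with hR
  have hR0 : 0 < R := by positivity
  have hRs : R ^ (s - 1) = 2 / η := by
    rw [hR, Real.rpow_inv_rpow (by positivity) hs1.ne']
  set K := 8 * (1 + R) ^ 3 / (4 * η) with hK
  have hK0 : 0 ≤ K := by positivity
  have hlarge : ∀ t : ℝ, R ≤ t → 2 * t ≤ η * t ^ s := by
    intro t ht
    have ht0 : 0 < t := hR0.trans_le ht
    have h1 : 2 / η ≤ t ^ (s - 1) := hRs ▸ Real.rpow_le_rpow hR0.le ht hs1.le
    have h2 : t ^ s = t ^ (s - 1) * t := by rw [← Real.rpow_add_one ht0.ne']; ring_nf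
    rw [div_le_iff₀ hη] at h1
    rw [h2]
    nlinarith
  refine ⟨K, hK0, fun a b => ?_⟩
  have hg := bracketGap_nonneg a b
  have hab := norm_sub_le a b
  have ha0 := Real.rpow_nonneg (norm_nonneg a) s
  have hb0 := Real.rpow_nonneg (norm_nonneg b) s
  have hKg := mul_nonneg hK0 hg
  by_cases hsmall : ‖a‖ ≤ R ∧ ‖b‖ ≤ R
  · have hA : bracket a ≤ 1 + R := (bracket_le a).trans (by linarith)
    have hB : bracket b ≤ 1 + R := (bracket_le b).trans (by linarith)
    have hA1 := one_le_bracket a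
    have hB1 := one_le_bracket b
    have h1 : 4 * (bracket a * bracket b) * (bracket a + bracket b) ≤ 8 * (1 + R) ^ 3 := by
      have h2 : bracket a * bracket b ≤ (1 + R) * (1 + R) :=
        mul_le_mul hA hB (by linarith) (by linarith)
      calc 4 * (bracket a * bracket b) * (bracket a + bracket b)
          ≤ 4 * ((1 + R) * (1 + R)) * ((1 + R) + (1 + R)) := by gcongr
        _ = _ := by ring
    have h3 := (norm_sub_sq_le_bracketGap a b).trans (mul_le_mul_of_nonneg_right h1 hg)
    -- Young's inequality turns the bound on the square into a linear one; the denominator 4η of `K`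
    -- comes from here.
    have h4 : ‖a - b‖ ≤ η + ‖a - b‖ ^ 2 / (4 * η) := by
      have h5 : η + ‖a - b‖ ^ 2 / (4 * η) - ‖a - b‖ = (2 * η - ‖a - b‖) ^ 2 / (4 * η) := by
        field_simp; ring
      have : 0 ≤ (2 * η - ‖a - b‖) ^ 2 / (4 * η) := by positivity
      linarith
    have h6 : ‖a - b‖ ^ 2 / (4 * η) ≤ K * bracketGap a b := by
      rw [hK, div_mul_eq_mul_div]
      exact div_le_div_of_nonneg_right h3 (by positivity)
    nlinarith
  · rw [not_and_or, not_le, not_le] at hsmall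
    rcases le_total ‖a‖ ‖b‖ with h | h
    · have := hlarge ‖b‖ (by rcases hsmall with h' | h' <;> linarith)
      nlinarith
    · have := hlarge ‖a‖ (by rcases hsmall with h' | h' <;> linarith)
      nlinarith

/-! ### Convergence in `L^1` -/

theorem exists_limit_of_cauchy_integral {E : Type*} [NormedAddCommGroup E] [CompleteSpace E]
    {g : ℕ → Torus d → E} (hg : ∀ n, Integrable (g n) volume)
    (hc : ∀ η > 0, ∃ N, ∀ n ≥ N, ∀ m ≥ n, ∫ x, ‖g n x - g m x‖ ≤ η) :
    ∃ G : Torus d → E, Integrable G volume ∧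
      Tendsto (fun n => eLpNorm (fun x => g n x - G x) 1 volume) atTop (𝓝 0) := by
  have hm : ∀ n, MemLp (g n) 1 volume := fun n => memLp_one_iff_integrable.2 (hg n)
  have hdist : ∀ n m, dist ((hm n).toLp (g n)) ((hm m).toLp (g m)) = ∫ x, ‖g n x - g m x‖ := by
    intro n m
    rw [Lp.dist_edist, Lp.edist_toLp_toLp, eLpNorm_one_eq_lintegral_enorm]
    exact (integral_norm_eq_lintegral_enorm ((hg n).sub (hg m)).1).symm
  have hcs : CauchySeq fun n => (hm n).toLp (g n) := by
    rw [Metric.cauchySeq_iff']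
    intro η hη
    obtain ⟨N, hN⟩ := hc (η / 2) (by positivity)
    refine ⟨N, fun n hn => ?_⟩
    rw [dist_comm, hdist]
    exact (hN N le_rfl n hn).trans_lt (by linarith)
  obtain ⟨G, hG⟩ := cauchySeq_tendsto_of_complete hcs
  refine ⟨G, memLp_one_iff_integrable.1 (Lp.memLp G), ?_⟩
  rw [Lp.tendsto_Lp_iff_tendsto_eLpNorm'] at hG
  refine hG.congr fun n => eLpNorm_congr_ae ?_
  filter_upwards [(hm n).coeFn_toLp] with x hx
  simp [hx]

theorem tendsto_integral_mul_of_tendsto_eLpNorm {g : ℕ → Torus d → ℝ} {G φ : Torus d → ℝ}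
    (hg : ∀ n, Integrable (g n) volume) (hG : Integrable G volume) (hφ : Continuous φ)
    (h : Tendsto (fun n => eLpNorm (fun x => g n x - G x) 1 volume) atTop (𝓝 0)) :
    Tendsto (fun n => ∫ x, g n x * φ x) atTop (𝓝 (∫ x, G x * φ x)) := by
  obtain ⟨L, -, hL⟩ := exists_bound_of_continuous hφ
  have hmul : ∀ {g : Torus d → ℝ}, Integrable g volume → Integrable (fun x => g x * φ x) volume :=
    fun hg => hg.mul_bdd hφ.aestronglyMeasurable (ae_of_all _ hL)
  refine tendsto_integral_of_L1 _ (hmul hG).1 (Eventually.of_forall fun n => hmul (hg n)) ?_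
  have h2 := ENNReal.Tendsto.const_mul (a := ENNReal.ofReal L) h (Or.inr ENNReal.ofReal_ne_top)
  rw [mul_zero] at h2
  refine tendsto_of_tendsto_of_tendsto_of_le_of_le tendsto_const_nhds h2 (fun _ => zero_le)
    fun n => ?_
  dsimp only
  rw [eLpNorm_one_eq_lintegral_enorm, ← lintegral_const_mul' _ _ ENNReal.ofReal_ne_top]
  refine lintegral_mono fun x => ?_
  rw [← sub_mul, enorm_mul, mul_comm, ← ofReal_norm (φ x)]
  exact mul_le_mul_left (ENNReal.ofReal_le_ofReal (hL x)) _

theorem hasWeakGrad_of_tendsto {u : ℕ → Torus d → ℝ} {G : ℕ → Torus d → Space d}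
    {u' : Torus d → ℝ} {G' : Torus d → Space d}
    (hu : ∀ n, Integrable (u n) volume) (hG : ∀ n, Integrable (G n) volume)
    (hu' : Integrable u' volume) (hG' : Integrable G' volume)
    (h : ∀ n, HasWeakGrad (u n) (G n))
    (h1 : Tendsto (fun n => eLpNorm (fun x => u n x - u' x) 1 volume) atTop (𝓝 0))
    (h2 : Tendsto (fun n => eLpNorm (fun x => G n x - G' x) 1 volume) atTop (𝓝 0)) :
    HasWeakGrad u' G' := by
  intro φ hφ i
  have hφ1 : IsCn 1 φ := hφ.of_le le_top
  have hproj : ∀ {F : Torus d → Space d}, Integrable F volume →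
      Integrable (fun x => F x i) volume := fun hF =>
    (EuclideanSpace.proj i : Space d →L[ℝ] ℝ).integrable_comp hF
  have l1 := tendsto_integral_mul_of_tendsto_eLpNorm hu hu'
    (φ := fun x => torusGrad φ x i)
    ((EuclideanSpace.proj i : Space d →L[ℝ] ℝ).continuous.comp hφ1.continuous_torusGrad) h1
  have l2 := tendsto_integral_mul_of_tendsto_eLpNorm (fun n => hproj (hG n)) (hproj hG')
    (φ := φ) hφ.continuous (by
      refine tendsto_of_tendsto_of_tendsto_of_le_of_le tendsto_const_nhds h2
        (fun _ => zero_le) fun n => eLpNorm_mono fun x => ?_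
      exact PiLp.norm_apply_le (G n x - G' x) i)
  refine tendsto_nhds_unique l1 (l2.neg.congr fun n => (h n φ hφ i).symm)

end

section

variable {d : ℕ}

/-! ### The energy -/

/-! ### Powers of norms of functions in L^s -/

section Powers

variable {X : Type*} [MeasurableSpace X] {μ : Measure X} {E : Type*} [NormedAddCommGroup E]

theorem integrable_norm_rpow_of_memLp {s : ℝ} (hs : 0 < s) {g : X → E}
    (hg : MemLp g (ENNReal.ofReal s) μ) : Integrable (fun x => ‖g x‖ ^ s) μ := by
  have := hg.integrable_norm_rpow (by simpa using hs) ENNReal.ofReal_ne_top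
  simpa [ENNReal.toReal_ofReal hs.le] using this

theorem lintegral_enorm_rpow_eq {s : ℝ} (hs : 0 < s) {g : X → E}
    (hg : MemLp g (ENNReal.ofReal s) μ) :
    ∫⁻ x, ‖g x‖ₑ ^ s ∂μ = ENNReal.ofReal (∫ x, ‖g x‖ ^ s ∂μ) := by
  rw [ofReal_integral_eq_lintegral_ofReal (integrable_norm_rpow_of_memLp hs hg)
    (ae_of_all _ fun x => Real.rpow_nonneg (norm_nonneg _) _)]
  refine lintegral_congr fun x => ?_
  rw [← ofReal_norm, ENNReal.ofReal_rpow_of_nonneg (norm_nonneg _) hs.le]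

theorem memLp_norm_rpow {p r : ℝ} (hr : 0 < r) {g : X → E}
    (hg : MemLp g (ENNReal.ofReal (p * r)) μ) :
    MemLp (fun x => ‖g x‖ ^ r) (ENNReal.ofReal p) μ := by
  have := hg.norm_rpow_div (ENNReal.ofReal r)
  rwa [ENNReal.toReal_ofReal hr.le, ← ENNReal.ofReal_div_of_pos hr,
    mul_div_cancel_right₀ _ hr.ne'] at this

end Powers

theorem IsSobolev.mono {s t : ℝ} (hts : t ≤ s) {u : Torus d → ℝ} {G : Torus d → Space d}
    (h : IsSobolev s u G) : IsSobolev t u G :=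
  ⟨h.memLp.mono_exponent (ENNReal.ofReal_le_ofReal hts),
    h.memLp_grad.mono_exponent (ENNReal.ofReal_le_ofReal hts), h.hasWeakGrad⟩

theorem IsSobolev.integral_poincare {s : ℝ} (hs : 1 ≤ s) {u : Torus d → ℝ} {G : Torus d → Space d}
    (h : IsSobolev s u G) :
    ∫ x, |u x - ∫ z, u z| ^ s ≤ √d ^ s * ∫ x, ‖G x‖ ^ s := by
  have hs0 : 0 < s := one_pos.trans_le hs
  have h0 : MemLp (fun x => u x - ∫ z, u z) (ENNReal.ofReal s) volume :=
    h.memLp.sub (memLp_const _)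
  have h1 := (eLpNorm_ofReal_le_iff hs0).1 (h.poincare hs)
  have h2 : eLpNorm G (ENNReal.ofReal s) volume ≤ (∫⁻ x, ‖G x‖ₑ ^ s) ^ s⁻¹ :=
    (eLpNorm_ofReal_le_iff hs0).2 (by rw [ENNReal.rpow_inv_rpow hs0.ne'])
  have h3 := h1.trans (ENNReal.rpow_le_rpow (mul_le_mul_right h2 _) hs0.le)
  rw [ENNReal.mul_rpow_of_nonneg _ _ hs0.le, ENNReal.rpow_inv_rpow hs0.ne',
    lintegral_enorm_rpow_eq hs0 h.memLp_grad, lintegral_enorm_rpow_eq hs0 h0, ENNReal.ofReal_rpow_of_nonneg (Real.sqrt_nonneg _) hs0.le,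
    ← ENNReal.ofReal_mul (by positivity)] at h3
  exact (ENNReal.ofReal_le_ofReal_iff (mul_nonneg (by positivity)
    (integral_nonneg fun x => by positivity))).1 h3

theorem IsSobolev.add {s : ℝ} (hs : 1 ≤ s) {u v : Torus d → ℝ} {F G : Torus d → Space d}
    (hu : IsSobolev s u F) (hv : IsSobolev s v G) :
    IsSobolev s (fun x => u x + v x) (fun x => F x + G x) := by
  refine ⟨hu.memLp.add hv.memLp, hu.memLp_grad.add hv.memLp_grad, fun φ hφ i => ?_⟩
  have hφ1 : IsCn 1 φ := hφ.of_le le_top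
  have hi : Continuous fun x => torusGrad φ x i :=
    (EuclideanSpace.proj i : Space d →L[ℝ] ℝ).continuous.comp hφ1.continuous_torusGrad
  have hmul : ∀ {g ψ : Torus d → ℝ}, Integrable g volume → Continuous ψ →
      Integrable (fun x => g x * ψ x) volume := fun hg hψ => by
    obtain ⟨L, -, hL⟩ := exists_bound_of_continuous hψ
    exact hg.mul_bdd hψ.aestronglyMeasurable (ae_of_all _ hL)
  have hproj : ∀ {F : Torus d → Space d}, Integrable F volume →
      Integrable (fun x => F x i) volume := fun hF =>
    (EuclideanSpace.proj i : Space d →L[ℝ] ℝ).integrable_comp hF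
  simp only [PiLp.add_apply, add_mul]
  rw [integral_add (hmul (hu.integrable hs) hi) (hmul (hv.integrable hs) hi),
    integral_add (hmul (hproj (hu.integrable_grad hs)) hφ.continuous)
      (hmul (hproj (hv.integrable_grad hs)) hφ.continuous),
    hu.hasWeakGrad φ hφ i, hv.hasWeakGrad φ hφ i]
  ring

theorem IsSobolev.const_mul {s : ℝ} {u : Torus d → ℝ} {G : Torus d → Space d}
    (hu : IsSobolev s u G) (c : ℝ) :
    IsSobolev s (fun x => c * u x) (fun x => c • G x) := by
  refine ⟨hu.memLp.const_mul c, hu.memLp_grad.const_smul c, fun φ hφ i => ?_⟩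
  simp only [PiLp.smul_apply, smul_eq_mul, mul_assoc]
  rw [integral_const_mul, integral_const_mul, hu.hasWeakGrad φ hφ i, mul_neg]

theorem IsCn.isSobolev {ψ : Torus d → ℝ} (h : IsCn 1 ψ) (s : ℝ) : IsSobolev s ψ (torusGrad ψ) :=
  ⟨memLp_of_continuous h.continuous _, memLp_of_continuous h.continuous_torusGrad _,
    h.hasWeakGrad⟩

/-- The function `A(y, ξ) = 1 + |y| + (1 + |ξ|)^r` that controls all the quantities below. -/
def majorant (r : ℝ) (y : ℝ) (ξ : Space d) : ℝ := 1 + |y| + (1 + ‖ξ‖) ^ r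

theorem one_le_majorant (r y : ℝ) (ξ : Space d) : 1 ≤ majorant r y ξ := by
  have : 0 ≤ (1 + ‖ξ‖) ^ r := by positivity
  unfold majorant
  linarith [abs_nonneg y]

/-- The exponent pr is what puts |Du|^r in L^p. The p-th power of the majorant is the dominating
function throughout. -/
theorem integrable_majorant_rpow {p r : ℝ} (hp : 1 < p) (hr : 1 < r) {u : Torus d → ℝ}
    {G : Torus d → Space d} (hu : MemLp u (ENNReal.ofReal (p * r)) volume)
    (hG : MemLp G (ENNReal.ofReal (p * r)) volume) :
    Integrable (fun x => majorant r (u x) (G x) ^ p) volume := by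
  have hp0 : 0 < p := by linarith
  have h1 : MemLp u (ENNReal.ofReal p) volume :=
    hu.mono_exponent (ENNReal.ofReal_le_ofReal (by nlinarith))
  have h2 : MemLp (fun x => 1 + ‖G x‖) (ENNReal.ofReal (p * r)) volume :=
    (memLp_const (1 : ℝ)).add hG.norm
  have h3 : MemLp (fun x => (1 + ‖G x‖) ^ r) (ENNReal.ofReal p) volume := by
    refine (memLp_norm_rpow (by linarith) h2).congr_norm ?_ (ae_of_all _ fun x => ?_)
    · exact ((aestronglyMeasurable_const.add hG.1.norm).aemeasurable.pow_const r).aestronglyMeasurable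
    · rw [Real.norm_of_nonneg (by positivity : (0 : ℝ) ≤ 1 + ‖G x‖)]
  have h4 : MemLp (fun x => 1 + ‖u x‖ + (1 + ‖G x‖) ^ r) (ENNReal.ofReal p) volume :=
    ((memLp_const (1 : ℝ)).add h1.norm).add h3
  have h5 := integrable_norm_rpow_of_memLp hp0 h4
  have h6 : ∀ x, ‖1 + ‖u x‖ + (1 + ‖G x‖) ^ r‖ = majorant r (u x) (G x) := fun x => by
    rw [Real.norm_of_nonneg (by positivity), majorant, Real.norm_eq_abs]
  simpa only [h6] using h5

/-- The powers are arranged so that M times the gradient of H is at most a multiple of A^{p-1}·A =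
A^p, with A the majorant. Bounding the gradient by A, not by the power r - 1, is lossy but enough.
-/
theorem exists_majorant_bounds {p r ε : ℝ} (hp : 1 < p) (hr : 1 < r) (hε : 0 < ε)
    {f : Torus d → ℝ → ℝ} {M B : Torus d → ℝ → ℝ} (hB : IsPotential f p M B)
    {H : Torus d → Space d → ℝ} (hH : IsHamiltonian H r) :
    ∃ K, 0 < K ∧ ∀ x y ξ,
      |ε * y + H x ξ| ≤ K * majorant r y ξ ∧
      B x (ε * y + H x ξ) ≤ K * majorant r y ξ ^ p ∧
      M x (ε * y + H x ξ) ≤ K * majorant r y ξ ^ (p - 1) ∧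
      ‖gradient (H x) ξ‖ ≤ K * majorant r y ξ := by
  obtain ⟨K₁, hK₁, hM⟩ := hB.inv_le
  obtain ⟨K₂, hK₂, hB'⟩ := hB.le
  obtain ⟨K₃, hK₃, hH'⟩ := hH.exists_bounds hr
  set c := 1 + ε + K₃ with hc
  have hc0 : 0 < c := by positivity
  have habs : ∀ x y ξ, 1 + |ε * y + H x ξ| ≤ c * majorant r y ξ := by
    intro x y ξ
    have h1 := (abs_add_le (ε * y) (H x ξ)).trans (add_le_add le_rfl (hH' x ξ).1)
    rw [abs_mul, abs_of_pos hε] at h1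
    have h2 : 0 ≤ (1 + ‖ξ‖) ^ r := by positivity
    have h3 := abs_nonneg y
    unfold majorant
    have : c * (1 + |y| + (1 + ‖ξ‖) ^ r) = 1 + ε * |y| + K₃ * (1 + ‖ξ‖) ^ r
      + (ε + K₃) + (1 + K₃) * |y| + (1 + ε) * (1 + ‖ξ‖) ^ r := by rw [hc]; ring
    rw [this]
    have : 0 ≤ (1 + K₃) * |y| := by positivity
    have : 0 ≤ (1 + ε) * (1 + ‖ξ‖) ^ r := by positivity
    linarith
  have hpow : ∀ x y ξ, ∀ t : ℝ, 0 ≤ t →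
      (1 + |ε * y + H x ξ|) ^ t ≤ c ^ t * majorant r y ξ ^ t := by
    intro x y ξ t ht
    rw [← Real.mul_rpow hc0.le (zero_le_one.trans (one_le_majorant r y ξ))]
    exact Real.rpow_le_rpow (by positivity) (habs x y ξ) ht
  have hA0 : ∀ y (ξ : Space d), 0 ≤ majorant r y ξ := fun y ξ =>
    zero_le_one.trans (one_le_majorant r y ξ)
  refine ⟨c + K₂ * c ^ p + K₁ * c ^ (p - 1) + K₃, by positivity, fun x y ξ => ⟨?_, ?_, ?_, ?_⟩⟩
  · have h1 := habs x y ξ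
    have : 0 ≤ K₂ * c ^ p + K₁ * c ^ (p - 1) + K₃ := by positivity
    nlinarith [mul_nonneg this (hA0 y ξ)]
  · have h1 := (hB' x (ε * y + H x ξ)).trans
      (mul_le_mul_of_nonneg_left (hpow x y ξ p (by linarith)) hK₂.le)
    have : 0 ≤ c + K₁ * c ^ (p - 1) + K₃ := by positivity
    nlinarith [mul_nonneg this (Real.rpow_nonneg (hA0 y ξ) p)]
  · have h1 := (hM x (ε * y + H x ξ)).trans
      (mul_le_mul_of_nonneg_left (hpow x y ξ (p - 1) (by linarith)) hK₁.le)
    have : 0 ≤ c + K₂ * c ^ p + K₃ := by positivity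
    nlinarith [mul_nonneg this (Real.rpow_nonneg (hA0 y ξ) (p - 1))]
  · have h1 := (hH' x ξ).2.1
    have h2 : (1 + ‖ξ‖) ^ (r - 1) ≤ majorant r y ξ := by
      have h3 : (1 + ‖ξ‖) ^ (r - 1) ≤ (1 + ‖ξ‖) ^ r :=
        Real.rpow_le_rpow_of_exponent_le (by linarith [norm_nonneg ξ]) (by linarith)
      unfold majorant
      linarith [abs_nonneg y]
    have : 0 ≤ c + K₂ * c ^ p + K₁ * c ^ (p - 1) := by positivity
    nlinarith [mul_nonneg this (hA0 y ξ), mul_le_mul_of_nonneg_left h2 hK₃.le]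

theorem aestronglyMeasurable_comp {F : Type*} [TopologicalSpace F]
    {Ψ : Torus d × ℝ × Space d → F} (hΨ : Continuous Ψ)
    {u : Torus d → ℝ} {G : Torus d → Space d} (hu : AEStronglyMeasurable u volume)
    (hG : AEStronglyMeasurable G volume) :
    AEStronglyMeasurable (fun x => Ψ (x, u x, G x)) volume :=
  hΨ.comp_aestronglyMeasurable
    (measurable_id.aestronglyMeasurable.prodMk (hu.prodMk hG))

theorem IsHamiltonian.continuous_hjb {H : Torus d → Space d → ℝ} {r : ℝ} (hH : IsHamiltonian H r)
    (ε : ℝ) : Continuous fun z : Torus d × ℝ × Space d => ε * z.2.1 + H z.1 z.2.2 :=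
  (by fun_prop : Continuous fun z : Torus d × ℝ × Space d => ε * z.2.1).add
    (hH.continuous.comp (by fun_prop : Continuous fun z : Torus d × ℝ × Space d => (z.1, z.2.2)))

theorem IsHamiltonian.continuous_comp_hjb {H : Torus d → Space d → ℝ} {r : ℝ}
    (hH : IsHamiltonian H r) (ε : ℝ) {B : Torus d → ℝ → ℝ} (hB : Continuous (Function.uncurry B)) :
    Continuous fun z : Torus d × ℝ × Space d => B z.1 (ε * z.2.1 + H z.1 z.2.2) :=
  hB.comp (continuous_fst.prodMk (hH.continuous_hjb ε))

/-- The energy `∫ B(x, εu + H(x, Du)) - ε ∫ u`. -/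
def energy (ε : ℝ) (H : Torus d → Space d → ℝ) (B : Torus d → ℝ → ℝ) (u : Torus d → ℝ)
    (G : Torus d → Space d) : ℝ :=
  (∫ x, B x (ε * u x + H x (G x))) - ε * ∫ x, u x

variable {p r ε : ℝ} {f : Torus d → ℝ → ℝ} {M B : Torus d → ℝ → ℝ} {H : Torus d → Space d → ℝ}

theorem integrable_potential (hp : 1 < p) (hr : 1 < r) (hε : 0 < ε) (hB : IsPotential f p M B)
    (hH : IsHamiltonian H r) {u : Torus d → ℝ} {G : Torus d → Space d}
    (hu : MemLp u (ENNReal.ofReal (p * r)) volume)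
    (hG : MemLp G (ENNReal.ofReal (p * r)) volume) :
    Integrable (fun x => B x (ε * u x + H x (G x))) volume := by
  obtain ⟨K, -, hK⟩ := exists_majorant_bounds hp hr hε hB hH
  refine ((integrable_majorant_rpow hp hr hu hG).const_mul K).mono'
    (aestronglyMeasurable_comp (hH.continuous_comp_hjb ε hB.continuous) hu.1 hG.1)
    (ae_of_all _ fun x => ?_)
  rw [Real.norm_of_nonneg (hB.nonneg _ _)]
  exact (hK x (u x) (G x)).2.1

theorem integrable_hamiltonian (hp : 1 < p) (hr : 1 < r) (hH : IsHamiltonian H r)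
    {G : Torus d → Space d} (hG : MemLp G (ENNReal.ofReal (p * r)) volume) :
    Integrable (fun x => H x (G x)) volume := by
  obtain ⟨K, hK0, hK⟩ := hH.exists_bounds hr
  have h1 := integrable_majorant_rpow hp hr (memLp_const (0 : ℝ)) hG
  refine (h1.const_mul K).mono' (hH.continuous.comp_aestronglyMeasurable
    (measurable_id.aestronglyMeasurable.prodMk hG.1)) (ae_of_all _ fun x => ?_)
  refine (hK x (G x)).1.trans (mul_le_mul_of_nonneg_left ?_ hK0.le)
  have h2 := one_le_majorant r 0 (G x)
  calc (1 + ‖G x‖) ^ r ≤ majorant r 0 (G x) := by unfold majorant; simp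
    _ = majorant r 0 (G x) ^ (1 : ℝ) := (Real.rpow_one _).symm
    _ ≤ _ := Real.rpow_le_rpow_of_exponent_le h2 hp.le

/-- Convexity of H passes through B because B is nondecreasing; then B is convex. Midpoints are all
that the choice of the minimizing sequence requires. -/
theorem energy_midpoint_le (hp : 1 < p) (hr : 1 < r) (hε : 0 < ε) (hB : IsPotential f p M B)
    (hH : IsHamiltonian H r) {u v : Torus d → ℝ} {F G : Torus d → Space d}
    (hu : IsSobolev (p * r) u F) (hv : IsSobolev (p * r) v G)
    (hw : IsSobolev (p * r) (fun x => 1 / 2 * (u x + v x)) (fun x => (1 / 2 : ℝ) • (F x + G x))) :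
    energy ε H B (fun x => 1 / 2 * (u x + v x)) (fun x => (1 / 2 : ℝ) • (F x + G x))
      ≤ (energy ε H B u F + energy ε H B v G) / 2 := by
  have hs : 1 ≤ p * r := by nlinarith
  have i1 := integrable_potential hp hr hε hB hH hu.memLp hu.memLp_grad
  have i2 := integrable_potential hp hr hε hB hH hv.memLp hv.memLp_grad
  have i3 := integrable_potential hp hr hε hB hH hw.memLp hw.memLp_grad
  have h1 : ∫ x, B x (ε * (1 / 2 * (u x + v x)) + H x ((1 / 2 : ℝ) • (F x + G x)))
      ≤ ∫ x, (1 / 2 * B x (ε * u x + H x (F x)) + 1 / 2 * B x (ε * v x + H x (G x))) := by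
    refine integral_mono i3 ((i1.const_mul _).add (i2.const_mul _)) fun x => ?_
    have c1 := (hH.strictConvexOn x).convexOn.2 (mem_univ (F x)) (mem_univ (G x))
      (by norm_num : (0 : ℝ) ≤ 1 / 2) (by norm_num : (0 : ℝ) ≤ 1 / 2) (by norm_num)
    have c2 := (hB.convexOn x).2 (mem_univ (ε * u x + H x (F x))) (mem_univ (ε * v x + H x (G x)))
      (by norm_num : (0 : ℝ) ≤ 1 / 2) (by norm_num : (0 : ℝ) ≤ 1 / 2) (by norm_num)
    rw [← smul_add] at c1
    simp only [smul_eq_mul] at c1 c2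
    refine (hB.monotone x ?_).trans c2
    linarith
  rw [integral_add (i1.const_mul _) (i2.const_mul _), integral_const_mul, integral_const_mul] at h1
  unfold energy
  rw [integral_const_mul, integral_add (hu.integrable hs) (hv.integrable hs)]
  linarith

theorem add_rpow_le_three {p a b c : ℝ} (hp : 0 ≤ p) (ha : 0 ≤ a) (hb : 0 ≤ b) (hc : 0 ≤ c) :
    (a + b + c) ^ p ≤ 3 ^ p * (a ^ p + b ^ p + c ^ p) := by
  have ha' := Real.rpow_nonneg ha p
  have hb' := Real.rpow_nonneg hb p
  have hc' := Real.rpow_nonneg hc p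
  have key : ∀ t, 0 ≤ t → a + b + c ≤ 3 * t → t ^ p ≤ a ^ p + b ^ p + c ^ p →
      (a + b + c) ^ p ≤ 3 ^ p * (a ^ p + b ^ p + c ^ p) := fun t ht h1 h2 => by
    calc (a + b + c) ^ p ≤ (3 * t) ^ p := Real.rpow_le_rpow (by positivity) h1 hp
      _ = 3 ^ p * t ^ p := Real.mul_rpow (by norm_num) ht
      _ ≤ _ := mul_le_mul_of_nonneg_left h2 (by positivity)
  rcases le_total a b with h | h <;> rcases le_total b c with h' | h' <;>
    rcases le_total a c with h'' | h''
  all_goals first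
    | exact key a ha (by linarith) (by linarith)
    | exact key b hb (by linarith) (by linarith)
    | exact key c hc (by linarith) (by linarith)

/-- The summand `0 ^ p` is the empty third slot of `add_rpow_le_three`; it vanishes for p > 0. -/
theorem abs_rpow_le_sub_add {p a m : ℝ} (hp : 0 ≤ p) :
    |a| ^ p ≤ 3 ^ p * (|a - m| ^ p + |m| ^ p + 0 ^ p) := by
  refine le_trans (Real.rpow_le_rpow (abs_nonneg _) ?_ hp)
    (add_rpow_le_three hp (abs_nonneg (a - m)) (abs_nonneg m) le_rfl)
  have := abs_add_le (a - m) m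
  rw [sub_add_cancel] at this
  linarith

/-- Sublevel sets of the energy are bounded in the Sobolev space. -/
theorem energy_coercive (hp : 1 < p) (hr : 1 < r) (hε : 0 < ε) (hB : IsPotential f p M B)
    (hH : IsHamiltonian H r) (c : ℝ) : ∃ R, ∀ u G, IsSobolev (p * r) u G → energy ε H B u G ≤ c →
      ∫ x, |u x| ^ (p * r) ≤ R ∧ ∫ x, ‖G x‖ ^ (p * r) ≤ R := by
  obtain ⟨K₁, hK₁⟩ := hB.superlinear
  obtain ⟨k, hk, K₂, hcoer⟩ := hB.coercive
  obtain ⟨K, hK, hHb⟩ := hH.exists_bounds hr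
  have hp0 : 0 < p := by linarith
  have hr0 : 0 < r := by linarith
  have hr1 : 0 < r - 1 := by linarith
  have hs : 1 ≤ p * r := by nlinarith
  have hs0 : 0 < p * r := by positivity
  have hHlow : ∀ x ξ, -K ≤ H x ξ := fun x ξ => by
    have h1 := (hHb x ξ).2.2
    have h2 : 0 ≤ K * (H x ξ + K) := (Real.rpow_nonneg (norm_nonneg _) _).trans h1
    have := nonneg_of_mul_nonneg_right h2 hK
    linarith
  -- `R₁` bounds |∫u| and `R₂` bounds the integral of (εu + H)₊^p. `δ` makes Dδ ≤ 1/2, so that the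
  -- gradient term produced by Poincaré can be absorbed.
  set R₁ := (|c| + |K₁| + 2 * K) / ε with hR₁
  set R₂ := (|c| + ε * R₁ + |K₂|) / k with hR₂
  set Q := K ^ p * 3 ^ p with hQ
  have hQ0 : 0 < Q := by positivity
  set D := Q * (ε ^ p * 3 ^ p * √d ^ p) with hD
  have hD0 : 0 ≤ D := by positivity
  set δ := 1 / (2 * (D + 1)) with hδ
  have hδ0 : 0 < δ := by positivity
  set Cδ := (1 / δ) ^ (r - 1)⁻¹ with hCδ
  have hCδ0 : 0 < Cδ := by positivity
  set S := Q * (R₂ + ε ^ p * (3 ^ p * (R₁ ^ p + 0 ^ p)) + K ^ p) + D * Cδ with hS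
  -- Used with t = ‖G‖^p: as r > 1, the p-th power of the gradient is of lower order than the power
  -- pr.
  have hyoung : ∀ t : ℝ, 0 ≤ t → t ≤ δ * t ^ r + Cδ := by
    intro t ht
    rcases le_total t Cδ with h | h
    · have : 0 ≤ δ * t ^ r := by positivity
      linarith
    · have ht0 : 0 < t := hCδ0.trans_le h
      have h1 : 1 / δ ≤ t ^ (r - 1) := by
        have := Real.rpow_le_rpow hCδ0.le h hr1.le
        rwa [hCδ, Real.rpow_inv_rpow (by positivity) hr1.ne'] at this
      have h2 : t ^ r = t ^ (r - 1) * t := by rw [← Real.rpow_add_one ht0.ne']; ring_nf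
      rw [div_le_iff₀ hδ0] at h1
      rw [h2]
      nlinarith
  refine ⟨max (3 ^ (p * r) * (√d ^ (p * r) * (2 * S) + R₁ ^ (p * r) + 0 ^ (p * r))) (2 * S),
    fun u G hu hle => ?_⟩
  have hui := hu.integrable hs
  have hup : IsSobolev p u G := hu.mono (by nlinarith)
  have iB := integrable_potential hp hr hε hB hH hu.memLp hu.memLp_grad
  have iH := integrable_hamiltonian hp hr hH hu.memLp_grad
  have ia : Integrable (fun x => ε * u x + H x (G x)) volume := (hui.const_mul ε).add iH
  unfold energy at hle
  set m := ∫ x, u x with hm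
  have hc := le_abs_self c
  have hBnn : 0 ≤ ∫ x, B x (ε * u x + H x (G x)) := integral_nonneg fun x => hB.nonneg _ _
  -- B(a) ≥ 2a - K₁ gives 2ε∫u on the left against the single ε∫u of the energy, bounding the mean
  -- from above. The bound from below follows from B ≥ 0.
  have hup1 : ε * m ≤ |c| + |K₁| + 2 * K := by
    have h1 : ∫ x, (2 * (ε * u x + H x (G x)) - K₁) ≤ ∫ x, B x (ε * u x + H x (G x)) :=
      integral_mono ((ia.const_mul 2).sub (integrable_const _)) iB fun x => hK₁ x _
    rw [integral_sub (ia.const_mul 2) (integrable_const _), integral_const_mul,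
      integral_add (hui.const_mul ε) iH, integral_const_mul] at h1
    have h2 : ∫ _ : Torus d, -K ≤ ∫ x, H x (G x) :=
      integral_mono (integrable_const _) iH fun x => hHlow x _
    simp only [integral_const, probReal_univ, one_smul] at h1 h2
    linarith [le_abs_self K₁]
  have hmabs : |m| ≤ R₁ := by
    have h1 : |m| * ε = |ε * m| := by rw [abs_mul, abs_of_pos hε, mul_comm]
    rw [hR₁, le_div_iff₀ hε, h1, abs_le]
    constructor <;> linarith [abs_nonneg K₁]
  have hR₁0 : 0 ≤ R₁ := (abs_nonneg m).trans hmabs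
  have hmaxnn : ∀ x, 0 ≤ max (ε * u x + H x (G x)) 0 := fun x => le_max_right _ _
  have iplus : Integrable (fun x => max (ε * u x + H x (G x)) 0 ^ p) volume := by
    refine ((iB.add (integrable_const K₂)).const_mul k⁻¹).mono' ?_ (ae_of_all _ fun x => ?_)
    · exact ((ia.1.sup aestronglyMeasurable_const).aemeasurable.pow_const p).aestronglyMeasurable
    · rw [Real.norm_of_nonneg (Real.rpow_nonneg (hmaxnn x) p), le_inv_mul_iff₀ hk]
      simp only [Pi.add_apply]
      linarith [hcoer x (ε * u x + H x (G x))]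
  have hplus : ∫ x, max (ε * u x + H x (G x)) 0 ^ p ≤ R₂ := by
    have h1 : ∫ x, (k * max (ε * u x + H x (G x)) 0 ^ p - K₂)
        ≤ ∫ x, B x (ε * u x + H x (G x)) :=
      integral_mono ((iplus.const_mul k).sub (integrable_const _)) iB fun x => hcoer x _
    rw [integral_sub (iplus.const_mul k) (integrable_const _), integral_const_mul] at h1
    simp only [integral_const, probReal_univ, one_smul] at h1
    rw [hR₂, le_div_iff₀ hk]
    have h2 : ε * m ≤ ε * R₁ := mul_le_mul_of_nonneg_left ((le_abs_self m).trans hmabs) hε.le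
    linarith [le_abs_self K₂]
  have iGs := integrable_norm_rpow_of_memLp hs0 hu.memLp_grad
  have iGp := integrable_norm_rpow_of_memLp hp0 hup.memLp_grad
  have iup := integrable_norm_rpow_of_memLp hp0 hup.memLp
  have ius := integrable_norm_rpow_of_memLp hs0 hu.memLp
  simp only [Real.norm_eq_abs] at iup ius
  have iump := integrable_norm_rpow_of_memLp hp0 (hup.memLp.sub (memLp_const m))
  have iums := integrable_norm_rpow_of_memLp hs0 (hu.memLp.sub (memLp_const m))
  simp only [Real.norm_eq_abs, Pi.sub_apply] at iump iums
  have hpoinp := hup.integral_poincare hp.le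
  have hpoins := hu.integral_poincare hs
  rw [← hm] at hpoinp hpoins
  have habs : ∀ t : ℝ, 1 ≤ t → Integrable (fun x => |u x - m| ^ t) volume →
      Integrable (fun x => |u x| ^ t) volume →
      ∫ x, |u x| ^ t ≤ 3 ^ t * ((∫ x, |u x - m| ^ t) + R₁ ^ t + 0 ^ t) := by
    intro t ht i1 i2
    have h1 : ∫ x, |u x| ^ t ≤ ∫ x, 3 ^ t * (|u x - m| ^ t + (|m| ^ t + 0 ^ t)) := by
      refine integral_mono i2 ((i1.add (integrable_const _)).const_mul _) fun x => ?_
      simpa [add_assoc] using abs_rpow_le_sub_add (a := u x) (m := m) (zero_le_one.trans ht)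
    rw [integral_const_mul, integral_add i1 (integrable_const _)] at h1
    simp only [integral_const, probReal_univ, one_smul] at h1
    refine h1.trans (mul_le_mul_of_nonneg_left ?_ (by positivity))
    have := Real.rpow_le_rpow (abs_nonneg m) hmabs (zero_le_one.trans ht)
    linarith
  -- Coercivity of H, applied to H = (εu + H) - εu.
  have hpt : ∀ x, ‖G x‖ ^ (p * r) ≤
      Q * (max (ε * u x + H x (G x)) 0 ^ p + ε ^ p * |u x| ^ p + K ^ p) := by
    intro x
    have h1 := (hHb x (G x)).2.2
    have h2 : ‖G x‖ ^ r ≤ K * (max (ε * u x + H x (G x)) 0 + ε * |u x| + K) := by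
      refine h1.trans (mul_le_mul_of_nonneg_left ?_ hK.le)
      have h3 := le_max_left (ε * u x + H x (G x)) 0
      have h4 := mul_le_mul_of_nonneg_left (neg_abs_le (u x)) hε.le
      linarith
    have h5 := Real.rpow_le_rpow (by positivity) h2 hp0.le
    rw [← Real.rpow_mul (norm_nonneg _), mul_comm r p, Real.mul_rpow hK.le
      (by have := hmaxnn x; positivity)] at h5
    refine h5.trans ?_
    rw [hQ, mul_assoc]
    refine mul_le_mul_of_nonneg_left ?_ (by positivity)
    rw [← Real.mul_rpow hε.le (abs_nonneg _)]
    exact add_rpow_le_three hp0.le (hmaxnn x) (by positivity) hK.le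
  have hY : ∫ x, ‖G x‖ ^ (p * r) ≤ 2 * S := by
    have h1 : ∫ x, ‖G x‖ ^ (p * r) ≤ ∫ x,
        Q * (max (ε * u x + H x (G x)) 0 ^ p + ε ^ p * |u x| ^ p + K ^ p) :=
      integral_mono iGs (((iplus.add (iup.const_mul _)).add (integrable_const _)).const_mul _) hpt
    have h0 : Integrable (fun x => max (ε * u x + H x (G x)) 0 ^ p + ε ^ p * |u x| ^ p) volume :=
      iplus.add (iup.const_mul _)
    rw [integral_const_mul, integral_add h0 (integrable_const _),
      integral_add iplus (iup.const_mul _), integral_const_mul] at h1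
    simp only [integral_const, probReal_univ, one_smul] at h1
    have h2 := habs p hp.le iump iup
    have h3 : ∫ x, ‖G x‖ ^ p ≤ δ * (∫ x, ‖G x‖ ^ (p * r)) + Cδ := by
      have h4 : ∫ x, ‖G x‖ ^ p ≤ ∫ x, (δ * ‖G x‖ ^ (p * r) + Cδ) := by
        refine integral_mono iGp ((iGs.const_mul δ).add (integrable_const _)) fun x => ?_
        have := hyoung (‖G x‖ ^ p) (by positivity)
        rwa [← Real.rpow_mul (norm_nonneg _)] at this
      rw [integral_add (iGs.const_mul δ) (integrable_const _), integral_const_mul] at h4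
      simpa using h4
    set Y := ∫ x, ‖G x‖ ^ (p * r)
    have hY0 : 0 ≤ Y := integral_nonneg fun x => by positivity
    have h5 : ∫ x, |u x| ^ p ≤ 3 ^ p * (√d ^ p * (δ * Y + Cδ) + R₁ ^ p + 0 ^ p) := by
      refine h2.trans (mul_le_mul_of_nonneg_left ?_ (by positivity))
      have := hpoinp.trans (mul_le_mul_of_nonneg_left h3 (by positivity))
      linarith
    -- The right-hand side is S + DδY with Dδ ≤ 1/2, which gives Y ≤ 2S.
    have h6 : Y ≤ Q * (R₂ + ε ^ p * (3 ^ p * (√d ^ p * (δ * Y + Cδ) + R₁ ^ p + 0 ^ p)) + K ^ p) := by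
      refine h1.trans (mul_le_mul_of_nonneg_left ?_ hQ0.le)
      have := mul_le_mul_of_nonneg_left h5 (show 0 ≤ ε ^ p by positivity)
      linarith
    have h7 : Q * (R₂ + ε ^ p * (3 ^ p * (√d ^ p * (δ * Y + Cδ) + R₁ ^ p + 0 ^ p)) + K ^ p)
        = S + D * δ * Y := by rw [hS, hD]; ring
    have h8 : D * δ ≤ 1 / 2 := by
      rw [hδ, mul_one_div, div_le_div_iff₀ (by positivity) (by norm_num)]
      linarith
    have h9 := mul_le_mul_of_nonneg_right h8 hY0
    linarith
  refine ⟨le_trans ?_ (le_max_left _ _), hY.trans (le_max_right _ _)⟩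
  refine (habs (p * r) hs iums ius).trans (mul_le_mul_of_nonneg_left ?_ (by positivity))
  have := hpoins.trans (mul_le_mul_of_nonneg_left hY (by positivity))
  linarith

/-- By `superlinear`, ε∫u is at most half of ∫B up to a constant, and ∫B is nonnegative. -/
theorem energy_bddBelow (hp : 1 < p) (hr : 1 < r) (hε : 0 < ε) (hB : IsPotential f p M B)
    (hH : IsHamiltonian H r) : ∃ c, ∀ u G, IsSobolev (p * r) u G → c ≤ energy ε H B u G := by
  obtain ⟨K₁, hK₁⟩ := hB.superlinear
  obtain ⟨K, hK, hHb⟩ := hH.exists_bounds hr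
  have hs : 1 ≤ p * r := by nlinarith
  have hHlow : ∀ x ξ, -K ≤ H x ξ := fun x ξ => by
    have h1 := (hHb x ξ).2.2
    have h2 : 0 ≤ K * (H x ξ + K) := (Real.rpow_nonneg (norm_nonneg _) _).trans h1
    have := nonneg_of_mul_nonneg_right h2 hK
    linarith
  refine ⟨-(K₁ + 2 * K) / 2, fun u G hu => ?_⟩
  have hui := hu.integrable hs
  have iB := integrable_potential hp hr hε hB hH hu.memLp hu.memLp_grad
  have iH := integrable_hamiltonian hp hr hH hu.memLp_grad
  have ia : Integrable (fun x => ε * u x + H x (G x)) volume := (hui.const_mul ε).add iH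
  have hBnn : 0 ≤ ∫ x, B x (ε * u x + H x (G x)) := integral_nonneg fun x => hB.nonneg _ _
  have h1 : ∫ x, (2 * (ε * u x + H x (G x)) - K₁) ≤ ∫ x, B x (ε * u x + H x (G x)) :=
    integral_mono ((ia.const_mul 2).sub (integrable_const _)) iB fun x => hK₁ x _
  rw [integral_sub (ia.const_mul 2) (integrable_const _), integral_const_mul,
    integral_add (hui.const_mul ε) iH, integral_const_mul] at h1
  have h2 : ∫ _ : Torus d, -K ≤ ∫ x, H x (G x) :=
    integral_mono (integrable_const _) iH fun x => hHlow x _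
  simp only [integral_const, probReal_univ, one_smul] at h1 h2
  unfold energy
  linarith

end

section

variable {d : ℕ}

/-! ### Existence of a minimizer -/

/-! ### From small convexity gaps to strong convergence -/

section Gap

variable {E : Type*} [NormedAddCommGroup E]

theorem integrable_bracket {g : Torus d → E} (hg : Integrable g volume) :
    Integrable (fun x => bracket (g x)) volume := by
  refine ((integrable_const (1 : ℝ)).add hg.norm).mono'
    (continuous_bracket.comp_aestronglyMeasurable hg.1) (ae_of_all _ fun x => ?_)
  rw [Real.norm_of_nonneg (zero_le_one.trans (one_le_bracket _))]
  exact bracket_le _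

theorem integral_bracket_le {s : ℝ} (hs : 1 < s) {g : Torus d → E}
    (hg : MemLp g (ENNReal.ofReal s) volume) :
    ∫ x, bracket (g x) ≤ 2 + ∫ x, ‖g x‖ ^ s := by
  have hi : Integrable g volume := hg.integrable (by simpa using hs.le)
  have hp := integrable_norm_rpow_of_memLp (by linarith) hg
  have h1 : ∫ x, bracket (g x) ≤ ∫ x, (2 + ‖g x‖ ^ s) := by
    refine integral_mono (integrable_bracket hi) ((integrable_const _).add hp) fun x => ?_
    have h2 : ‖g x‖ ≤ 1 + ‖g x‖ ^ s := by
      rcases le_total ‖g x‖ 1 with h | h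
      · have : 0 ≤ ‖g x‖ ^ s := by positivity
        linarith
      · have := Real.rpow_le_rpow_of_exponent_le h hs.le
        rw [Real.rpow_one] at this
        linarith
    have := bracket_le (g x)
    dsimp only
    linarith
  rw [integral_add (integrable_const _) hp] at h1
  simpa using h1

variable [InnerProductSpace ℝ E]

theorem integrable_bracketGap {g h : Torus d → E} (hg : Integrable g volume)
    (hh : Integrable h volume) : Integrable (fun x => bracketGap (g x) (h x)) volume :=
  (((integrable_bracket hg).add (integrable_bracket hh)).div_const 2).sub
    (integrable_bracket ((hg.add hh).smul (1 / 2 : ℝ)))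

theorem integral_bracketGap {g h : Torus d → E} (hg : Integrable g volume)
    (hh : Integrable h volume) :
    ∫ x, bracketGap (g x) (h x) = ((∫ x, bracket (g x)) + ∫ x, bracket (h x)) / 2
      - ∫ x, bracket ((1 / 2 : ℝ) • (g x + h x)) := by
  have h1 : Integrable (fun x => (bracket (g x) + bracket (h x)) / 2) volume :=
    ((integrable_bracket hg).add (integrable_bracket hh)).div_const 2
  have h2 : Integrable (fun x => bracket ((1 / 2 : ℝ) • (g x + h x))) volume :=
    integrable_bracket ((hg.add hh).smul (1 / 2 : ℝ))
  unfold bracketGap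
  rw [integral_sub h1 h2, integral_div,
    integral_add (integrable_bracket hg) (integrable_bracket hh)]

/-- The pointwise estimate `exists_norm_sub_le_bracketGap` is integrated: the uniform bound in L^s
controls the powers, and the small gap controls the rest. The bound s > 1 prevents concentration. -/
theorem cauchy_of_bracketGap {s : ℝ} (hs : 1 < s) {g : ℕ → Torus d → E}
    (hg : ∀ n, MemLp (g n) (ENNReal.ofReal s) volume) {R : ℝ}
    (hR : ∀ n, ∫ x, ‖g n x‖ ^ s ≤ R) {e : ℕ → ℝ} (he : Tendsto e atTop (𝓝 0))
    (hgap : ∀ n m, n ≤ m → ∫ x, bracketGap (g n x) (g m x) ≤ e n) :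
    ∀ η > 0, ∃ N, ∀ n ≥ N, ∀ m ≥ n, ∫ x, ‖g n x - g m x‖ ≤ η := by
  intro η hη
  have hs0 : 0 < s := by linarith
  have hi : ∀ n, Integrable (g n) volume := fun n => (hg n).integrable (by simpa using hs.le)
  have hp : ∀ n, Integrable (fun x => ‖g n x‖ ^ s) volume := fun n =>
    integrable_norm_rpow_of_memLp hs0 (hg n)
  have hR0 : 0 ≤ R := (integral_nonneg fun x => by positivity).trans (hR 0)
  obtain ⟨K, hK, hbound⟩ := exists_norm_sub_le_bracketGap (E := E) hs
    (show 0 < η / (2 * (1 + 2 * R)) by positivity)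
  have hlim : Tendsto (fun n => K * e n) atTop (𝓝 0) := by simpa using he.const_mul K
  obtain ⟨N, hN⟩ := eventually_atTop.1 (hlim.eventually (Iio_mem_nhds (half_pos hη)))
  refine ⟨N, fun n hn m hm => ?_⟩
  have i1 : Integrable (fun x => 1 + ‖g n x‖ ^ s) volume := (integrable_const 1).add (hp n)
  have i2 : Integrable (fun x => 1 + ‖g n x‖ ^ s + ‖g m x‖ ^ s) volume := i1.add (hp m)
  have i3 := integrable_bracketGap (hi n) (hi m)
  have h1 : ∫ x, ‖g n x - g m x‖ ≤ ∫ x, (η / (2 * (1 + 2 * R)) *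
      (1 + ‖g n x‖ ^ s + ‖g m x‖ ^ s) + K * bracketGap (g n x) (g m x)) :=
    integral_mono ((hi n).sub (hi m)).norm ((i2.const_mul _).add (i3.const_mul _))
      fun x => hbound _ _
  rw [integral_add (i2.const_mul _) (i3.const_mul _), integral_const_mul, integral_const_mul,
    integral_add i1 (hp m), integral_add (integrable_const _) (hp n)] at h1
  simp only [integral_const, probReal_univ, one_smul] at h1
  have h2 : η / (2 * (1 + 2 * R)) * (1 + (∫ x, ‖g n x‖ ^ s) + ∫ x, ‖g m x‖ ^ s) ≤ η / 2 := by
    calc _ ≤ η / (2 * (1 + 2 * R)) * (1 + 2 * R) :=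
          mul_le_mul_of_nonneg_left (by linarith [hR n, hR m]) (by positivity)
      _ = η / 2 := by field_simp
  have h3 := mul_le_mul_of_nonneg_left (hgap n m hm) hK
  have h4 : K * e n < η / 2 := hN n hn
  linarith

/-- Fatou's lemma. Only membership in L^s is inherited; convergence in L^s is neither claimed nor
needed. -/
theorem memLp_of_ae_tendsto {F : Type*} [NormedAddCommGroup F] {s : ℝ} (hs : 0 < s)
    {g : ℕ → Torus d → F} {g' : Torus d → F}
    (hg : ∀ n, MemLp (g n) (ENNReal.ofReal s) volume) (hg' : AEStronglyMeasurable g' volume) {R : ℝ}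
    (hR : ∀ n, ∫ x, ‖g n x‖ ^ s ≤ R)
    (h : ∀ᵐ x, Tendsto (fun n => g n x) atTop (𝓝 (g' x))) :
    MemLp g' (ENNReal.ofReal s) volume := by
  refine ⟨hg', ?_⟩
  have h1 := Lp.eLpNorm_lim_le_liminf_eLpNorm (p := ENNReal.ofReal s) (fun n => (hg n).1) g' h
  have h2 : ∀ n, eLpNorm (g n) (ENNReal.ofReal s) volume ≤ ENNReal.ofReal R ^ s⁻¹ := fun n => by
    rw [eLpNorm_ofReal_le_iff hs, ENNReal.rpow_inv_rpow hs.ne', lintegral_enorm_rpow_eq hs (hg n)]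
    exact ENNReal.ofReal_le_ofReal (hR n)
  have h3 : liminf (fun n => eLpNorm (g n) (ENNReal.ofReal s) volume) atTop
      ≤ ENNReal.ofReal R ^ s⁻¹ :=
    (liminf_le_liminf (Eventually.of_forall h2)).trans (liminf_const _).le
  exact (h1.trans h3).trans_lt (ENNReal.rpow_lt_top_of_nonneg (by positivity) ENNReal.ofReal_ne_top)

end Gap

variable {p r ε : ℝ} {f : Torus d → ℝ → ℝ} {M B : Torus d → ℝ → ℝ} {H : Torus d → Space d → ℝ}

/-- Lower semicontinuity of the energy. -/
theorem energy_le_of_tendsto (hp : 1 < p) (hr : 1 < r) (hε : 0 < ε) (hB : IsPotential f p M B)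
    (hH : IsHamiltonian H r) {u : ℕ → Torus d → ℝ} {G : ℕ → Torus d → Space d}
    {u' : Torus d → ℝ} {G' : Torus d → Space d} (h : ∀ n, IsSobolev (p * r) (u n) (G n))
    (h' : IsSobolev (p * r) u' G')
    (hu : ∀ᵐ x, Tendsto (fun n => u n x) atTop (𝓝 (u' x)))
    (hG : ∀ᵐ x, Tendsto (fun n => G n x) atTop (𝓝 (G' x)))
    (hm : Tendsto (fun n => ∫ x, u n x) atTop (𝓝 (∫ x, u' x))) {I : ℝ}
    (hI : Tendsto (fun n => energy ε H B (u n) (G n)) atTop (𝓝 I)) :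
    energy ε H B u' G' ≤ I := by
  have hcont := hH.continuous_comp_hjb ε hB.continuous
  have hint : ∀ n, Integrable (fun x => B x (ε * u n x + H x (G n x))) volume := fun n =>
    integrable_potential hp hr hε hB hH (h n).memLp (h n).memLp_grad
  have hint' := integrable_potential hp hr hε hB hH h'.memLp h'.memLp_grad
  have hlim : Tendsto (fun n => ∫ x, B x (ε * u n x + H x (G n x))) atTop
      (𝓝 (I + ε * ∫ x, u' x)) :=
    (hI.add (hm.const_mul ε)).congr fun n => by simp [energy]
  -- Fatou applies since B ≥ 0. The linear term, which has no sign, converges by the hypothesis on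
  -- the means.
  have hfatou : ∫⁻ x, ENNReal.ofReal (B x (ε * u' x + H x (G' x)))
      ≤ liminf (fun n => ∫⁻ x, ENNReal.ofReal (B x (ε * u n x + H x (G n x)))) atTop := by
    refine le_trans (lintegral_mono_ae ?_)
      (lintegral_liminf_le' fun n => (hint n).1.aemeasurable.ennreal_ofReal)
    filter_upwards [hu, hG] with x hx hx'
    have : Tendsto (fun n => B x (ε * u n x + H x (G n x))) atTop
        (𝓝 (B x (ε * u' x + H x (G' x)))) :=
      (hcont.tendsto (x, u' x, G' x)).comp (tendsto_const_nhds.prodMk_nhds (hx.prodMk_nhds hx'))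
    exact ((ENNReal.continuous_ofReal.tendsto _).comp this).liminf_eq.ge
  have hconv : ∀ {g : Torus d → ℝ}, Integrable g volume → (∀ x, 0 ≤ g x) →
      ∫⁻ x, ENNReal.ofReal (g x) = ENNReal.ofReal (∫ x, g x) := fun hg h0 =>
    (ofReal_integral_eq_lintegral_ofReal hg (ae_of_all _ h0)).symm
  rw [hconv hint' fun x => hB.nonneg _ _] at hfatou
  simp only [hconv (hint _) fun x => hB.nonneg _ _] at hfatou
  replace hfatou := hfatou.trans_eq ((ENNReal.continuous_ofReal.tendsto _).comp hlim).liminf_eq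
  have hnn : 0 ≤ I + ε * ∫ x, u' x :=
    ge_of_tendsto' hlim fun n => integral_nonneg fun x => hB.nonneg _ _
  have := (ENNReal.ofReal_le_ofReal_iff hnn).1 hfatou
  unfold energy
  linarith

theorem exists_minimizer (hp : 1 < p) (hr : 1 < r) (hε : 0 < ε) (hB : IsPotential f p M B)
    (hH : IsHamiltonian H r) : ∃ u G, IsSobolev (p * r) u G ∧
      ∀ v F, IsSobolev (p * r) v F → energy ε H B u G ≤ energy ε H B v F := by
  have hs : 1 < p * r := by nlinarith
  have hs0 : 0 < p * r := by linarith
  -- The competitors carry a chosen weak gradient as data; no quotient or topology on them is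
  -- needed.
  let X := {w : (Torus d → ℝ) × (Torus d → Space d) // IsSobolev (p * r) w.1 w.2}
  have : Nonempty X := ⟨⟨(fun _ => 0, torusGrad fun _ => 0), (isCn_const 0).isSobolev _⟩⟩
  let J : X → ℝ := fun w => energy ε H B w.1.1 w.1.2
  let Φ : X → ℝ := fun w => (∫ x, bracket (w.1.1 x)) + ∫ x, bracket (w.1.2 x)
  let mid : X → X → X := fun v w =>
    ⟨(fun x => 1 / 2 * (v.1.1 x + w.1.1 x), fun x => (1 / 2 : ℝ) • (v.1.2 x + w.1.2 x)),
      (v.2.add hs.le w.2).const_mul _⟩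
  have hint : ∀ w : X, Integrable w.1.1 volume := fun w => w.2.integrable hs.le
  have hintG : ∀ w : X, Integrable w.1.2 volume := fun w => w.2.integrable_grad hs.le
  obtain ⟨c, hc⟩ := energy_bddBelow hp hr hε hB hH
  obtain ⟨R, hR⟩ := energy_coercive hp hr hε hB hH (sInf (range J) + 1)
  obtain ⟨z, hzJ, e, he, hgap⟩ := exists_minimizing_seq J Φ mid
    (fun v w => energy_midpoint_le hp hr hε hB hH v.2 w.2 (mid v w).2)
    (fun w => add_nonneg (integral_nonneg fun x => zero_le_one.trans (one_le_bracket _))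
      (integral_nonneg fun x => zero_le_one.trans (one_le_bracket _)))
    (R := 4 + 2 * R) (fun w hw => by
      have h1 := integral_bracket_le hs w.2.memLp
      have h2 := integral_bracket_le hs w.2.memLp_grad
      have h3 := hR w.1.1 w.1.2 w.2 hw
      simp only [Real.norm_eq_abs] at h1
      show (∫ x, bracket (w.1.1 x)) + ∫ x, bracket (w.1.2 x) ≤ _
      linarith [h3.1, h3.2])
  have hbd : ∀ n, (∫ x, |(z n).1.1 x| ^ (p * r) ≤ R) ∧ ∫ x, ‖(z n).1.2 x‖ ^ (p * r) ≤ R :=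
    fun n => hR _ _ (z n).2 ((hzJ n).trans (by
      have : (1 : ℝ) / ((n : ℝ) + 1) ≤ 1 := by
        rw [div_le_one (by positivity)]; linarith [(Nat.cast_nonneg n : (0 : ℝ) ≤ n)]
      linarith))
  -- The gap of Φ is the sum of the gaps of u and of Du. Both are nonnegative, so each is small.
  have hsplit : ∀ n m, n ≤ m →
      (∫ x, bracketGap ((z n).1.1 x) ((z m).1.1 x)) +
        ∫ x, bracketGap ((z n).1.2 x) ((z m).1.2 x) ≤ e n := fun n m hnm => by
    refine le_trans (le_of_eq ?_) (hgap n m hnm)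
    rw [integral_bracketGap (hint _) (hint _), integral_bracketGap (hintG _) (hintG _)]
    simp only [Φ, mid, smul_eq_mul]
    ring
  have hnn1 : ∀ n m, 0 ≤ ∫ x, bracketGap ((z n).1.1 x) ((z m).1.1 x) := fun n m =>
    integral_nonneg fun x => bracketGap_nonneg _ _
  have hnn2 : ∀ n m, 0 ≤ ∫ x, bracketGap ((z n).1.2 x) ((z m).1.2 x) := fun n m =>
    integral_nonneg fun x => bracketGap_nonneg _ _
  obtain ⟨u, hui, hu⟩ := exists_limit_of_cauchy_integral (fun n => hint (z n))
    (cauchy_of_bracketGap hs (fun n => (z n).2.memLp) (fun n => (hbd n).1) he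
      fun n m hnm => by linarith [hsplit n m hnm, hnn2 n m])
  obtain ⟨G, hGi, hG⟩ := exists_limit_of_cauchy_integral (fun n => hintG (z n))
    (cauchy_of_bracketGap hs (fun n => (z n).2.memLp_grad) (fun n => (hbd n).2) he
      fun n m hnm => by linarith [hsplit n m hnm, hnn1 n m])
  obtain ⟨ns, hns, hae1⟩ := (tendstoInMeasure_of_tendsto_eLpNorm one_ne_zero
    (fun n => (hint (z n)).1) hui.1 hu).exists_seq_tendsto_ae
  obtain ⟨ms, hms, hae2⟩ := (tendstoInMeasure_of_tendsto_eLpNorm one_ne_zero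
    (fun n => (hintG (z (ns n))).1) hGi.1 (hG.comp hns.tendsto_atTop)).exists_seq_tendsto_ae
  have hk : Tendsto (fun n => ns (ms n)) atTop atTop := hns.tendsto_atTop.comp hms.tendsto_atTop
  have hae1' : ∀ᵐ x, Tendsto (fun n => (z (ns (ms n))).1.1 x) atTop (𝓝 (u x)) := by
    filter_upwards [hae1] with x hx
    exact hx.comp hms.tendsto_atTop
  have hS : IsSobolev (p * r) u G := by
    refine ⟨memLp_of_ae_tendsto hs0 (fun n => (z (ns (ms n))).2.memLp) hui.1
      (fun n => (hbd (ns (ms n))).1) hae1',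
      memLp_of_ae_tendsto hs0 (fun n => (z (ns (ms n))).2.memLp_grad) hGi.1
      (fun n => (hbd (ns (ms n))).2) hae2, ?_⟩
    exact hasWeakGrad_of_tendsto (fun n => hint (z n)) (fun n => hintG (z n)) hui hGi
      (fun n => (z n).2.hasWeakGrad) hu hG
  have hmean : Tendsto (fun n => ∫ x, (z n).1.1 x) atTop (𝓝 (∫ x, u x)) := by
    simpa using tendsto_integral_mul_of_tendsto_eLpNorm (fun n => hint (z n)) hui
      (continuous_const (y := (1 : ℝ))) hu
  have hJb : BddBelow (range J) := ⟨c, by rintro _ ⟨w, rfl⟩; exact hc _ _ w.2⟩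
  have hJlim : Tendsto (fun n => J (z n)) atTop (𝓝 (sInf (range J))) := by
    have h1 : Tendsto (fun n : ℕ => sInf (range J) + 1 / ((n : ℝ) + 1)) atTop
        (𝓝 (sInf (range J))) := by
      simpa using (tendsto_const_nhds (x := sInf (range J))).add
        (tendsto_one_div_add_atTop_nhds_zero_nat (𝕜 := ℝ))
    exact tendsto_of_tendsto_of_tendsto_of_le_of_le tendsto_const_nhds h1
      (fun n => csInf_le hJb ⟨z n, rfl⟩) hzJ
  refine ⟨u, G, hS, fun v F hv => ?_⟩
  refine (energy_le_of_tendsto hp hr hε hB hH (fun n => (z (ns (ms n))).2) hS hae1' hae2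
    (hmean.comp hk) (hJlim.comp hk)).trans ?_
  exact csInf_le hJb ⟨⟨(v, F), hv⟩, rfl⟩

end

section

variable {d : ℕ}

/-! ### The Euler-Lagrange equation and existence -/

theorem majorant_perturb {r L y y' : ℝ} {ξ ξ' : Space d} (hr : 0 ≤ r) (hL : 0 ≤ L)
    (hy : |y'| ≤ |y| + L) (hξ : ‖ξ'‖ ≤ ‖ξ‖ + L) :
    majorant r y' ξ' ≤ ((1 + L) + (1 + L) ^ r) * majorant r y ξ := by
  have h1 : (1 + ‖ξ'‖) ^ r ≤ (1 + L) ^ r * (1 + ‖ξ‖) ^ r := by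
    rw [← Real.mul_rpow (by positivity) (by positivity)]
    refine Real.rpow_le_rpow (by positivity) ?_ hr
    nlinarith [norm_nonneg ξ]
  have h2 : 1 + |y'| ≤ (1 + L) * (1 + |y|) := by nlinarith [abs_nonneg y]
  have h3 : 0 ≤ (1 + L) * (1 + ‖ξ‖) ^ r := by positivity
  have h4 : 0 ≤ (1 + L) ^ r * (1 + |y|) := by positivity
  unfold majorant
  nlinarith

variable {p q r ε : ℝ} {f : Torus d → ℝ → ℝ} {M B : Torus d → ℝ → ℝ} {H : Torus d → Space d → ℝ}

theorem hasDerivAt_potential (hB : IsPotential f p M B) (hH : IsHamiltonian H r) (ε : ℝ)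
    (x : Torus d) (y z : ℝ) (ξ ζ : Space d) (t : ℝ) :
    HasDerivAt (fun t : ℝ => B x (ε * (y + t * z) + H x (ξ + t • ζ)))
      (M x (ε * (y + t * z) + H x (ξ + t • ζ)) *
        (ε * z + inner ℝ (gradient (H x) (ξ + t • ζ)) ζ)) t := by
  have h1 : HasDerivAt (fun t : ℝ => ξ + t • ζ) ζ t := by
    simpa using ((hasDerivAt_id t).smul_const ζ).const_add ξ
  have h2 := ((hH.differentiable x) (ξ + t • ζ)).hasGradientAt.hasFDerivAt.comp_hasDerivAt t h1
  rw [InnerProductSpace.toDual_apply_apply] at h2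
  have h3 : HasDerivAt (fun t : ℝ => ε * (y + t * z)) (ε * z) t := by
    simpa using (((hasDerivAt_id t).mul_const z).const_add y).const_mul ε
  exact (hB.hasDerivAt x _).comp t (h3.add h2)

/-- For |t| < 1 a C^1 test function perturbs u and Du by bounded amounts, which by
`majorant_perturb` costs a constant factor in the majorant; its p-th power dominates the derivative
uniformly in t. -/
theorem hasDerivAt_integral_potential (hp : 1 < p) (hr : 1 < r) (hε : 0 < ε)
    (hB : IsPotential f p M B) (hH : IsHamiltonian H r) {u : Torus d → ℝ} {G : Torus d → Space d}
    (hu : MemLp u (ENNReal.ofReal (p * r)) volume) (hG : MemLp G (ENNReal.ofReal (p * r)) volume)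
    {ψ : Torus d → ℝ} (hψ : IsCn 1 ψ) :
    HasDerivAt (fun t : ℝ => ∫ x, B x (ε * (u x + t * ψ x) + H x (G x + t • torusGrad ψ x)))
      (∫ x, M x (ε * u x + H x (G x)) *
        (ε * ψ x + inner ℝ (gradient (H x) (G x)) (torusGrad ψ x))) 0 := by
  obtain ⟨K, hK, hbd⟩ := exists_majorant_bounds hp hr hε hB hH
  obtain ⟨L₁, hL₁, hψL⟩ := exists_bound_of_continuous hψ.continuous
  obtain ⟨L₂, hL₂, hDL⟩ := exists_bound_of_continuous hψ.continuous_torusGrad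
  set L := max L₁ L₂
  have hL : 0 ≤ L := hL₁.trans (le_max_left _ _)
  have hψL' : ∀ x, |ψ x| ≤ L := fun x => (hψL x).trans (le_max_left _ _)
  have hDL' : ∀ x, ‖torusGrad ψ x‖ ≤ L := fun x => (hDL x).trans (le_max_right _ _)
  set c := (1 + L) + (1 + L) ^ r
  have hc : 0 < c := by positivity
  have hA0 : ∀ y (ξ : Space d), 0 < majorant r y ξ := fun y ξ =>
    one_pos.trans_le (one_le_majorant r y ξ)
  have hmeasu : ∀ t : ℝ, AEStronglyMeasurable (fun x => u x + t * ψ x) volume := fun t =>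
    hu.1.add (hψ.continuous.const_mul t).aestronglyMeasurable
  have hmeasG : ∀ t : ℝ, AEStronglyMeasurable (fun x => G x + t • torusGrad ψ x) volume := fun t =>
    hG.1.add (hψ.continuous_torusGrad.const_smul t).aestronglyMeasurable
  have key := (hasDerivAt_integral_of_dominated_loc_of_deriv_le
    (μ := (volume : Measure (Torus d)))
    (F := fun (t : ℝ) x => B x (ε * (u x + t * ψ x) + H x (G x + t • torusGrad ψ x)))
    (F' := fun (t : ℝ) x => M x (ε * (u x + t * ψ x) + H x (G x + t • torusGrad ψ x)) *
        (ε * ψ x + inner ℝ (gradient (H x) (G x + t • torusGrad ψ x)) (torusGrad ψ x)))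
    (x₀ := 0) (s := Metric.ball 0 1)
    (bound := fun x => K * (ε + K) * L * c ^ p * majorant r (u x) (G x) ^ p)
    (Metric.ball_mem_nhds _ one_pos)
    (Eventually.of_forall fun t => aestronglyMeasurable_comp
      (hH.continuous_comp_hjb ε hB.continuous) (hmeasu t) (hmeasG t))
    (by simpa using integrable_potential hp hr hε hB hH hu hG)
    (by
      simp only [zero_mul, add_zero, zero_smul]
      refine (aestronglyMeasurable_comp (hH.continuous_comp_hjb ε hB.continuous_inv) hu.1 hG.1).mul
        ((hψ.continuous.const_mul ε).aestronglyMeasurable.add (AEStronglyMeasurable.inner ?_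
          hψ.continuous_torusGrad.aestronglyMeasurable))
      exact hH.continuous_grad.comp_aestronglyMeasurable
        (measurable_id.aestronglyMeasurable.prodMk hG.1))
    (ae_of_all _ fun x t ht => by
      have ht1 : |t| ≤ 1 := by
        rw [Metric.mem_ball, dist_zero_right, Real.norm_eq_abs] at ht
        exact ht.le
      set y := u x + t * ψ x
      set ξ := G x + t • torusGrad ψ x
      have hy : |y| ≤ |u x| + L := by
        refine (abs_add_le _ _).trans (add_le_add le_rfl ?_)
        rw [abs_mul]
        exact (mul_le_of_le_one_left (abs_nonneg _) ht1).trans (hψL' x)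
      have hξ : ‖ξ‖ ≤ ‖G x‖ + L := by
        refine (norm_add_le _ _).trans (add_le_add le_rfl ?_)
        rw [norm_smul, Real.norm_eq_abs]
        exact (mul_le_of_le_one_left (norm_nonneg _) ht1).trans (hDL' x)
      have hA := majorant_perturb (by linarith : 0 ≤ r) hL hy hξ
      have hA1 := one_le_majorant r y ξ
      obtain ⟨-, -, hM, hgr⟩ := hbd x y ξ
      have e1 : |ε * ψ x + inner ℝ (gradient (H x) ξ) (torusGrad ψ x)|
          ≤ (ε + K) * L * majorant r y ξ := by
        refine (abs_add_le _ _).trans ?_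
        have i1 : |ε * ψ x| ≤ ε * L * majorant r y ξ := by
          rw [abs_mul, abs_of_pos hε]
          have := mul_le_mul_of_nonneg_left (hψL' x) hε.le
          nlinarith [mul_nonneg hε.le hL]
        have i2 : |inner ℝ (gradient (H x) ξ) (torusGrad ψ x)| ≤ K * majorant r y ξ * L :=
          (abs_real_inner_le_norm _ _).trans
            (mul_le_mul hgr (hDL' x) (norm_nonneg _) (by positivity))
        linarith
      rw [norm_mul, Real.norm_of_nonneg (hB.inv_nonneg _ _), Real.norm_eq_abs]
      have e2 : majorant r y ξ ^ (p - 1) * majorant r y ξ = majorant r y ξ ^ p := by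
        rw [← Real.rpow_add_one (hA0 y ξ).ne']; ring_nf
      have e3 : majorant r y ξ ^ p ≤ c ^ p * majorant r (u x) (G x) ^ p := by
        rw [← Real.mul_rpow hc.le (hA0 _ _).le]
        exact Real.rpow_le_rpow (hA0 _ _).le hA (by linarith)
      calc _ ≤ (K * majorant r y ξ ^ (p - 1)) * ((ε + K) * L * majorant r y ξ) :=
            mul_le_mul hM e1 (abs_nonneg _) (by positivity [hA0 y ξ])
        _ = K * (ε + K) * L * (majorant r y ξ ^ (p - 1) * majorant r y ξ) := by ring
        _ ≤ K * (ε + K) * L * (c ^ p * majorant r (u x) (G x) ^ p) := by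
            rw [e2]
            exact mul_le_mul_of_nonneg_left e3 (by positivity)
        _ = _ := by ring)
    ((integrable_majorant_rpow hp hr hu hG).const_mul _)
    (ae_of_all _ fun x t _ => hasDerivAt_potential hB hH ε x _ _ _ _ t)).2
  simpa using key

/-- M is bounded by the power p - 1 of the majorant, and (p-1)q = p. -/
theorem memLp_inv (hpq : p.HolderConjugate q) (hr : 1 < r) (hε : 0 < ε)
    (hB : IsPotential f p M B) (hH : IsHamiltonian H r) {u : Torus d → ℝ} {G : Torus d → Space d}
    (hu : MemLp u (ENNReal.ofReal (p * r)) volume) (hG : MemLp G (ENNReal.ofReal (p * r)) volume) :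
    MemLp (fun x => M x (ε * u x + H x (G x))) (ENNReal.ofReal q) volume := by
  have hp := hpq.lt
  have hq0 : 0 < q := hpq.symm.pos
  obtain ⟨K, hK, hbd⟩ := exists_majorant_bounds hp hr hε hB hH
  have hmeas := aestronglyMeasurable_comp (hH.continuous_comp_hjb ε hB.continuous_inv) hu.1 hG.1
  rw [← integrable_norm_rpow_iff hmeas (by simpa using hq0) ENNReal.ofReal_ne_top,
    ENNReal.toReal_ofReal hq0.le]
  refine ((integrable_majorant_rpow hp hr hu hG).const_mul (K ^ q)).mono'
    ((hmeas.norm.aemeasurable.pow_const q).aestronglyMeasurable) (ae_of_all _ fun x => ?_)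
  have hA0 : 0 < majorant r (u x) (G x) := one_pos.trans_le (one_le_majorant _ _ _)
  have h0 := hB.inv_nonneg x (ε * u x + H x (G x))
  rw [Real.norm_of_nonneg (by positivity), Real.norm_of_nonneg h0]
  refine (Real.rpow_le_rpow h0 (hbd x (u x) (G x)).2.2.1 hq0.le).trans_eq ?_
  rw [Real.mul_rpow hK.le (by positivity), ← Real.rpow_mul hA0.le, hpq.sub_one_mul_conj]

theorem integrable_flux_inv (hp : 1 < p) (hr : 1 < r) (hε : 0 < ε)
    (hB : IsPotential f p M B) (hH : IsHamiltonian H r) {u : Torus d → ℝ} {G : Torus d → Space d}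
    (hu : MemLp u (ENNReal.ofReal (p * r)) volume) (hG : MemLp G (ENNReal.ofReal (p * r)) volume) :
    Integrable (fun x => M x (ε * u x + H x (G x)) • gradient (H x) (G x)) volume := by
  obtain ⟨K, hK, hbd⟩ := exists_majorant_bounds hp hr hε hB hH
  refine ((integrable_majorant_rpow hp hr hu hG).const_mul (K * K)).mono'
    ((aestronglyMeasurable_comp (hH.continuous_comp_hjb ε hB.continuous_inv) hu.1 hG.1).smul
      (hH.continuous_grad.comp_aestronglyMeasurable
        (measurable_id.aestronglyMeasurable.prodMk hG.1))) (ae_of_all _ fun x => ?_)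
  have hA0 : 0 < majorant r (u x) (G x) := one_pos.trans_le (one_le_majorant _ _ _)
  rw [norm_smul, Real.norm_of_nonneg (hB.inv_nonneg _ _)]
  calc _ ≤ (K * majorant r (u x) (G x) ^ (p - 1)) * (K * majorant r (u x) (G x)) :=
        mul_le_mul (hbd x (u x) (G x)).2.2.1 (hbd x (u x) (G x)).2.2.2 (norm_nonneg _)
          (by positivity)
    _ = K * K * (majorant r (u x) (G x) ^ (p - 1) * majorant r (u x) (G x)) := by ring
    _ = _ := by rw [← Real.rpow_add_one hA0.ne', sub_add_cancel]

theorem weakSystem_of_minimizer (hpq : p.HolderConjugate q) (hr : 1 < r) (hε : 0 < ε)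
    (hf : IsCoupling f q) (hB : IsPotential f p M B) (hH : IsHamiltonian H r) {u : Torus d → ℝ}
    {G : Torus d → Space d} (hu : IsSobolev (p * r) u G)
    (hmin : ∀ v F, IsSobolev (p * r) v F → energy ε H B u G ≤ energy ε H B v F) :
    WeakSystem ε H f u G (fun x => M x (ε * u x + H x (G x))) := by
  have hp := hpq.lt
  have hs : 1 ≤ p * r := by nlinarith
  have hui := hu.integrable hs
  have hmi : Integrable (fun x => M x (ε * u x + H x (G x))) volume :=
    (memLp_inv hpq hr hε hB hH hu.memLp hu.memLp_grad).integrable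
      (by simpa using hpq.symm.lt.le)
  have hflux := integrable_flux_inv hp hr hε hB hH hu.memLp hu.memLp_grad
  have htransport : ∀ ψ : Torus d → ℝ, IsCn 1 ψ →
      ε * (∫ x, M x (ε * u x + H x (G x)) * ψ x) +
        ∫ x, inner ℝ (M x (ε * u x + H x (G x)) • gradient (H x) (G x)) (torusGrad ψ x)
      = ε * ∫ x, ψ x := by
    intro ψ hψ
    have hψi := integrable_of_continuous hψ.continuous
    have hd1 := hasDerivAt_integral_potential hp hr hε hB hH hu.memLp hu.memLp_grad hψ
    have hd2 : HasDerivAt (fun t : ℝ => ε * ((∫ x, u x) + t * ∫ x, ψ x)) (ε * ∫ x, ψ x) 0 := by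
      simpa using (((hasDerivAt_id (0 : ℝ)).mul_const (∫ x, ψ x)).const_add (∫ x, u x)).const_mul ε
    have hd := hd1.sub hd2
    have henergy : ∀ t : ℝ, energy ε H B (fun x => u x + t * ψ x) (fun x => G x + t • torusGrad ψ x)
        = (∫ x, B x (ε * (u x + t * ψ x) + H x (G x + t • torusGrad ψ x)))
          - ε * ((∫ x, u x) + t * ∫ x, ψ x) := fun t => by
      unfold energy
      rw [integral_add hui (hψi.const_mul t), integral_const_mul]
    -- The curve u + tψ stays in the Sobolev class, so its energy is minimal at t = 0; the vanishing
    -- derivative is the transport equation tested with ψ.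
    have hloc : IsLocalMin (fun t : ℝ => (∫ x, B x (ε * (u x + t * ψ x)
        + H x (G x + t • torusGrad ψ x))) - ε * ((∫ x, u x) + t * ∫ x, ψ x)) 0 := by
      refine Eventually.of_forall fun t => ?_
      simp only [← henergy]
      simpa using hmin _ _ (hu.add hs ((hψ.isSobolev (p * r)).const_mul t))
    have h0 := hloc.hasDerivAt_eq_zero hd
    obtain ⟨L₁, -, hL₁⟩ := exists_bound_of_continuous hψ.continuous
    obtain ⟨L₂, -, hL₂⟩ := exists_bound_of_continuous hψ.continuous_torusGrad
    have i1 : Integrable (fun x => M x (ε * u x + H x (G x)) * ψ x) volume :=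
      hmi.mul_bdd hψ.continuous.aestronglyMeasurable (ae_of_all _ hL₁)
    have i2 : Integrable (fun x => inner ℝ (M x (ε * u x + H x (G x)) • gradient (H x) (G x))
        (torusGrad ψ x)) volume := by
      refine (hflux.norm.mul_const L₂).mono'
        (hflux.1.inner hψ.continuous_torusGrad.aestronglyMeasurable) (ae_of_all _ fun x => ?_)
      exact (norm_inner_le_norm _ _).trans (mul_le_mul_of_nonneg_left (hL₂ x) (norm_nonneg _))
    rw [← integral_const_mul, ← integral_add (i1.const_mul ε) i2, ← sub_eq_zero.1 h0]
    refine integral_congr_ae (ae_of_all _ fun x => ?_)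
    simp only [inner_smul_left, conj_trivial]
    ring
  refine ⟨ae_of_all _ fun x => hB.inv_nonneg _ _, ?_, hflux, ae_of_all _ fun x hx => ?_,
    ae_of_all _ fun x => hB.le_apply_inv _ _, htransport⟩
  -- The constant test function turns the transport equation into ε∫m = ε.
  · have h1 := htransport (fun _ => 1) (isCn_const 1)
    simp only [torusGrad_const, inner_zero_right, integral_zero, mul_one, add_zero,
      integral_const, probReal_univ, smul_eq_mul] at h1
    exact mul_left_cancel₀ hε.ne' (by simpa using h1)
  · exact (hB.apply_inv_of_pos hf hx).symm

theorem HasWeakGrad.congr {u v : Torus d → ℝ} {G : Torus d → Space d} (h : HasWeakGrad u G)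
    (huv : v =ᵐ[volume] u) : HasWeakGrad v G := fun φ hφ i => by
  rw [← h φ hφ i]
  exact integral_congr_ae (huv.mono fun x hx => by simp only [hx])

theorem WeakSystem.congr {u v : Torus d → ℝ} {G : Torus d → Space d} {m n : Torus d → ℝ}
    (h : WeakSystem ε H f u G m) (huv : v =ᵐ[volume] u) (hmn : n =ᵐ[volume] m) :
    WeakSystem ε H f v G n := by
  refine ⟨?_, ?_, ?_, ?_, ?_, fun ψ hψ => ?_⟩
  · filter_upwards [h.nonneg, hmn] with x hx hx'
    rwa [hx']
  · exact (integral_congr_ae hmn).trans h.mass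
  · exact h.integrable_flux.congr (hmn.mono fun x hx => by simp only [hx])
  · filter_upwards [h.eq_on_pos, hmn, huv] with x hx h1 h2
    rwa [h1, h2]
  · filter_upwards [h.le_ae, hmn, huv] with x hx h1 h2
    rwa [h1, h2]
  · rw [← h.transport ψ hψ]
    congr 1
    · congr 1
      exact integral_congr_ae (hmn.mono fun x hx => by simp only [hx])
    · exact integral_congr_ae (hmn.mono fun x hx => by simp only [hx])

theorem exists_isWeakSolution (hpq : p.HolderConjugate q) (hr : 1 < r) (hε : 0 < ε)
    (hf : IsCoupling f q) (hH : IsHamiltonian H r) :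
    ∃ (u : W1 d (p * r)) (m : Lp ℝ (ENNReal.ofReal q) (volume : Measure (Torus d))),
      IsWeakSolution ε H f u m := by
  obtain ⟨M, B, hB⟩ := hf.exists_potential hpq
  obtain ⟨u, G, hu, hmin⟩ := exists_minimizer hpq.lt hr hε hB hH
  have hsys := weakSystem_of_minimizer hpq hr hε hf hB hH hu hmin
  have hm := memLp_inv hpq hr hε hB hH hu.memLp hu.memLp_grad
  have hgrad : HasWeakGrad (hu.memLp.toLp u) G := hu.hasWeakGrad.congr hu.memLp.coeFn_toLp
  exact ⟨⟨hu.memLp.toLp u, G, hu.memLp_grad, hgrad⟩, hm.toLp _, G, hu.memLp_grad, hgrad,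
    hsys.congr hu.memLp.coeFn_toLp hm.coeFn_toLp⟩

end

section

variable {d : ℕ}

/-! ### Sobolev test functions -/

theorem holderTriple_ofReal {a b c : ℝ} (ha : 0 < a) (hb : 0 < b) (hc : 0 < c)
    (h : a⁻¹ + b⁻¹ = c⁻¹) :
    ENNReal.HolderTriple (ENNReal.ofReal a) (ENNReal.ofReal b) (ENNReal.ofReal c) :=
  ⟨by
    rw [← ENNReal.ofReal_inv_of_pos ha, ← ENNReal.ofReal_inv_of_pos hb,
      ← ENNReal.ofReal_inv_of_pos hc, ← ENNReal.ofReal_add (by positivity) (by positivity), h]⟩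

theorem lintegral_enorm_mul_le {a b : ℝ≥0∞} [a.HolderTriple b 1] {E F : Type*}
    [NormedAddCommGroup E] [NormedAddCommGroup F] {φ : Torus d → E} {g : Torus d → F}
    (hφ : AEStronglyMeasurable φ volume) (hg : AEStronglyMeasurable g volume) :
    ∫⁻ x, ‖φ x‖ₑ * ‖g x‖ₑ ≤ eLpNorm φ a volume * eLpNorm g b volume := by
  have h := eLpNorm_smul_le_mul_eLpNorm (p := a) (q := b) (r := 1) hg.norm hφ.norm
  rw [eLpNorm_norm, eLpNorm_norm, eLpNorm_one_eq_lintegral_enorm] at h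
  simpa using h

theorem integrable_of_le_mul {a b : ℝ≥0∞} [a.HolderTriple b 1] {E F : Type*}
    [NormedAddCommGroup E] [NormedAddCommGroup F] {φ : Torus d → E} {g : Torus d → F}
    (hφ : MemLp φ a volume) (hg : MemLp g b volume) {h : Torus d → ℝ}
    (hh : AEStronglyMeasurable h volume) (hle : ∀ x, |h x| ≤ ‖φ x‖ * ‖g x‖) :
    Integrable h volume := by
  refine ⟨hh, ?_⟩
  have h1 : ∫⁻ x, ‖h x‖ₑ ≤ ∫⁻ x, ‖φ x‖ₑ * ‖g x‖ₑ := lintegral_mono fun x => by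
    rw [← ofReal_norm, ← ofReal_norm, ← ofReal_norm, ← ENNReal.ofReal_mul (norm_nonneg _)]
    exact ENNReal.ofReal_le_ofReal (hle x)
  exact (h1.trans (lintegral_enorm_mul_le hφ.1 hg.1)).trans_lt (ENNReal.mul_lt_top hφ.2 hg.2)

theorem tendsto_integral_zero_of_holder {a b : ℝ≥0∞} [a.HolderTriple b 1] {E F : Type*}
    [NormedAddCommGroup E] [NormedAddCommGroup F] {φ : Torus d → E} {g : ℕ → Torus d → F}
    (hφ : MemLp φ a volume) (hg : ∀ n, AEStronglyMeasurable (g n) volume)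
    (h0 : Tendsto (fun n => eLpNorm (g n) b volume) atTop (𝓝 0)) {h : ℕ → Torus d → ℝ}
    (hle : ∀ n x, |h n x| ≤ ‖φ x‖ * ‖g n x‖) :
    Tendsto (fun n => ∫ x, h n x) atTop (𝓝 0) := by
  rw [tendsto_zero_iff_enorm_tendsto_zero]
  have h1 : Tendsto (fun n => eLpNorm φ a volume * eLpNorm (g n) b volume) atTop (𝓝 0) := by
    simpa using ENNReal.Tendsto.const_mul h0 (Or.inr hφ.2.ne)
  refine tendsto_of_tendsto_of_tendsto_of_le_of_le tendsto_const_nhds h1 (fun _ => zero_le)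
    fun n => (enorm_integral_le_lintegral_enorm _).trans
      (le_trans (lintegral_mono fun x => ?_) (lintegral_enorm_mul_le hφ.1 (hg n)))
  rw [← ofReal_norm, ← ofReal_norm, ← ofReal_norm, ← ENNReal.ofReal_mul (norm_nonneg _)]
  exact ENNReal.ofReal_le_ofReal (hle n x)

variable {p q r ε : ℝ} {f : Torus d → ℝ → ℝ} {H : Torus d → Space d → ℝ}

theorem aestronglyMeasurable_gradient (hH : IsHamiltonian H r) {G : Torus d → Space d}
    (hG : AEStronglyMeasurable G volume) :
    AEStronglyMeasurable (fun x => gradient (H x) (G x)) volume :=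
  hH.continuous_grad.comp_aestronglyMeasurable (measurable_id.aestronglyMeasurable.prodMk hG)

/-- The flux `m D_pH(x, Du)` belongs to the dual exponent of `pr`. -/
theorem memLp_flux (hpq : p.HolderConjugate q) (hr : 1 < r) (hH : IsHamiltonian H r)
    {m : Torus d → ℝ} {G : Torus d → Space d} (hm : MemLp m (ENNReal.ofReal q) volume)
    (hG : MemLp G (ENNReal.ofReal (p * r)) volume) :
    MemLp (fun x => m x • gradient (H x) (G x)) (ENNReal.ofReal (p * r / (p * r - 1))) volume := by
  have hp := hpq.lt
  have hp0 : 0 < p := hpq.pos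
  have hq0 : 0 < q := hpq.symm.pos
  have hr1 : 0 < r - 1 := by linarith
  have hs1 : 0 < p * r - 1 := by nlinarith
  obtain ⟨K, hK, hHb⟩ := hH.exists_bounds hr
  have h1 : MemLp (fun x => 1 + ‖G x‖) (ENNReal.ofReal (p * r / (r - 1) * (r - 1))) volume := by
    rw [div_mul_cancel₀ _ hr1.ne']
    exact (memLp_const (1 : ℝ)).add hG.norm
  have h2 := memLp_norm_rpow hr1 h1
  -- The exponents add up as (r-1)/(pr) + 1/q = 1 - 1/(pr), because 1/q = 1 - 1/p.
  have htriple : ENNReal.HolderTriple (ENNReal.ofReal (p * r / (r - 1))) (ENNReal.ofReal q)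
      (ENNReal.ofReal (p * r / (p * r - 1))) := by
    refine holderTriple_ofReal (by positivity) hq0 (by positivity) ?_
    have := hpq.inv_add_inv_eq_one
    have hq' : q⁻¹ = 1 - p⁻¹ := by linarith
    rw [hq']
    field_simp
    ring
  have h3 : MemLp ((fun x => ‖1 + ‖G x‖‖ ^ (r - 1)) * fun x => ‖m x‖)
      (ENNReal.ofReal (p * r / (p * r - 1))) volume := hm.norm.mul h2
  refine (h3.const_mul K).mono (hm.1.smul (aestronglyMeasurable_gradient hH hG.1))
    (ae_of_all _ fun x => ?_)
  have hb := (hHb x (G x)).2.1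
  rw [norm_smul]
  have e : ‖K * ((fun x => ‖1 + ‖G x‖‖ ^ (r - 1)) * fun x => ‖m x‖) x‖
      = ‖m x‖ * (K * (1 + ‖G x‖) ^ (r - 1)) := by
    have h5 : (0 : ℝ) ≤ 1 + ‖G x‖ := by positivity
    simp only [Pi.mul_apply, Real.norm_of_nonneg h5]
    rw [Real.norm_of_nonneg (by positivity)]
    ring
  rw [e]
  exact mul_le_mul_of_nonneg_left hb (norm_nonneg _)

theorem holderTriple_flux (hp : 1 < p) (hr : 1 < r) :
    ENNReal.HolderTriple (ENNReal.ofReal (p * r / (p * r - 1))) (ENNReal.ofReal (p * r)) 1 := by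
  have hs1 : 0 < p * r - 1 := by nlinarith
  have hs0 : 0 < p * r := by nlinarith
  rw [← ENNReal.ofReal_one]
  refine holderTriple_ofReal (by positivity) hs0 one_pos ?_
  field_simp
  ring

theorem integrable_mul_memLp (hpq : p.HolderConjugate q) (hr : 1 < r) {m v : Torus d → ℝ}
    (hm : MemLp m (ENNReal.ofReal q) volume) (hv : MemLp v (ENNReal.ofReal (p * r)) volume) :
    Integrable (fun x => m x * v x) volume := by
  have hp := hpq.lt
  have htriple : ENNReal.HolderTriple (ENNReal.ofReal q) (ENNReal.ofReal p) 1 := by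
    rw [← ENNReal.ofReal_one]
    exact holderTriple_ofReal hpq.symm.pos hpq.pos one_pos (by
      rw [inv_one]; exact hpq.symm.inv_add_inv_eq_one)
  have hv' : MemLp v (ENNReal.ofReal p) volume :=
    hv.mono_exponent (ENNReal.ofReal_le_ofReal (by nlinarith))
  exact integrable_of_le_mul hm hv' (hm.1.mul hv'.1) fun x => by simp

theorem integrable_inner_flux (hpq : p.HolderConjugate q) (hr : 1 < r) (hH : IsHamiltonian H r)
    {m : Torus d → ℝ} {G F : Torus d → Space d} (hm : MemLp m (ENNReal.ofReal q) volume)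
    (hG : MemLp G (ENNReal.ofReal (p * r)) volume) (hF : MemLp F (ENNReal.ofReal (p * r)) volume) :
    Integrable (fun x => inner ℝ (m x • gradient (H x) (G x)) (F x)) volume := by
  have := holderTriple_flux hpq.lt hr
  have hw := memLp_flux hpq hr hH hm hG
  exact integrable_of_le_mul hw hF (hw.1.inner hF.1) fun x => abs_real_inner_le_norm _ _

/-- The transport equation may be tested with `g (χ - v)`, for `v` in the Sobolev space. -/
theorem WeakSystem.transport_comp (hpq : p.HolderConjugate q) (hr : 1 < r) (hH : IsHamiltonian H r)
    {u m : Torus d → ℝ} {G : Torus d → Space d} (h : WeakSystem ε H f u G m)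
    (hm : MemLp m (ENNReal.ofReal q) volume) (hG : MemLp G (ENNReal.ofReal (p * r)) volume)
    {v : Torus d → ℝ} {F : Torus d → Space d} (hv : IsSobolev (p * r) v F)
    {χ : Torus d → ℝ} (hχ : IsCn 1 χ) {g g' : ℝ → ℝ} (hg : ∀ t, HasDerivAt g (g' t) t)
    (hg' : Continuous g') (hg1 : ∀ t, |g' t| ≤ 1) :
    ε * (∫ x, m x * g (χ x - v x)) +
      ∫ x, g' (χ x - v x) * inner ℝ (m x • gradient (H x) (G x)) (torusGrad χ x - F x)
      = ε * ∫ x, g (χ x - v x) := by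
  have hp := hpq.lt
  have hs : 1 ≤ p * r := by nlinarith
  have hgC : ContDiff ℝ 1 g := by
    rw [contDiff_one_iff_deriv]
    refine ⟨fun t => (hg t).differentiableAt, ?_⟩
    rwa [show deriv g = g' from funext fun t => (hg t).deriv]
  have hgLip : ∀ a b, |g a - g b| ≤ |a - b| := fun a b => by
    have := Convex.norm_image_sub_le_of_norm_hasDerivWithin_le (s := univ) (C := 1)
      (fun t _ => (hg t).hasDerivWithinAt) (fun t _ => hg1 t) convex_univ (mem_univ b) (mem_univ a)
    simpa using this
  obtain ⟨v', hv'C, hv'1, hv'2⟩ := hv.exists_smooth_approx hs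
  -- Almost everywhere convergence is needed besides norm convergence, since g' is merely continuous
  -- and g'(χ - w n) can only be handled by dominated convergence.
  obtain ⟨ns, hns, hae⟩ := (tendstoInMeasure_of_tendsto_eLpNorm
    (by simpa using one_pos.trans_le hs) (fun n => (hv'C n).continuous.aestronglyMeasurable)
    hv.memLp.1 hv'1).exists_seq_tendsto_ae
  set w : ℕ → Torus d → ℝ := fun n => v' (ns n) with hw
  have hwC : ∀ n, IsCn 1 (w n) := fun n => hv'C _
  have hw1 : Tendsto (fun n => eLpNorm (fun x => w n x - v x) (ENNReal.ofReal (p * r)) volume)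
      atTop (𝓝 0) := hv'1.comp hns.tendsto_atTop
  have hw2 : Tendsto (fun n => eLpNorm (fun x => torusGrad (w n) x - F x)
      (ENNReal.ofReal (p * r)) volume) atTop (𝓝 0) := hv'2.comp hns.tendsto_atTop
  have hwm : ∀ n, AEStronglyMeasurable (fun x => w n x - v x) volume := fun n =>
    (hwC n).continuous.aestronglyMeasurable.sub hv.memLp.1
  have hwGm : ∀ n, AEStronglyMeasurable (fun x => torusGrad (w n) x - F x) volume := fun n =>
    (hwC n).continuous_torusGrad.aestronglyMeasurable.sub hv.memLp_grad.1
  have hgc : Continuous g := hgC.continuous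
  have hgw : ∀ n, Continuous fun x => g (χ x - w n x) := fun n =>
    hgc.comp (hχ.continuous.sub (hwC n).continuous)
  have hvi := hv.integrable hs
  have hχvm : AEStronglyMeasurable (fun x => χ x - v x) volume :=
    hχ.continuous.aestronglyMeasurable.sub hv.memLp.1
  have hgmem : MemLp (fun x => g (χ x - v x)) (ENNReal.ofReal (p * r)) volume := by
    have h1 : MemLp (fun x => |χ x - v x| + |g 0|) (ENNReal.ofReal (p * r)) volume :=
      ((memLp_of_continuous hχ.continuous _).sub hv.memLp).norm.add (memLp_const _)
    refine h1.mono' (hgc.comp_aestronglyMeasurable hχvm) (ae_of_all _ fun x => ?_)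
    have h2 := hgLip (χ x - v x) 0
    rw [sub_zero] at h2
    have h3 := abs_add_le (g (χ x - v x) - g 0) (g 0)
    rw [sub_add_cancel] at h3
    rw [Real.norm_eq_abs]
    linarith
  have hmi : Integrable m volume := hm.integrable (by simpa using hpq.symm.lt.le)
  have hflux := memLp_flux hpq hr hH hm hG
  have ht1 : ENNReal.HolderTriple (ENNReal.ofReal q) (ENNReal.ofReal p) 1 := by
    rw [← ENNReal.ofReal_one]
    exact holderTriple_ofReal hpq.symm.pos hpq.pos one_pos (by
      rw [inv_one]; exact hpq.symm.inv_add_inv_eq_one)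
  have ht2 := holderTriple_flux hp hr
  have hwp : Tendsto (fun n => eLpNorm (fun x => w n x - v x) (ENNReal.ofReal p) volume)
      atTop (𝓝 0) :=
    tendsto_of_tendsto_of_tendsto_of_le_of_le tendsto_const_nhds hw1 (fun _ => zero_le) fun n =>
      eLpNorm_le_eLpNorm_of_exponent_le (ENNReal.ofReal_le_ofReal (by nlinarith)) (hwm n)
  have hdiff : ∀ n x, |g (χ x - w n x) - g (χ x - v x)| ≤ ‖w n x - v x‖ := fun n x => by
    refine (hgLip _ _).trans_eq ?_
    rw [Real.norm_eq_abs, abs_sub_comm]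
    congr 1
    ring
  have l1 : Tendsto (fun n => ∫ x, m x * g (χ x - w n x)) atTop
      (𝓝 (∫ x, m x * g (χ x - v x))) := by
    have h1 := tendsto_integral_zero_of_holder (h := fun n x =>
      m x * g (χ x - w n x) - m x * g (χ x - v x)) hm hwm hwp fun n x => by
        rw [← mul_sub, abs_mul]
        exact mul_le_mul_of_nonneg_left (hdiff n x) (abs_nonneg _)
    have h2 : ∀ n, Integrable (fun x => m x * g (χ x - w n x)) volume := fun n =>
      integrable_mul_memLp hpq hr hm (memLp_of_continuous (hgw n) _)
    simp only [integral_sub (h2 _) (integrable_mul_memLp hpq hr hm hgmem)] at h1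
    simpa using h1.add_const (∫ x, m x * g (χ x - v x))
  have l3 : Tendsto (fun n => ∫ x, g (χ x - w n x)) atTop (𝓝 (∫ x, g (χ x - v x))) := by
    have hone : MemLp (fun _ : Torus d => (1 : ℝ)) (ENNReal.ofReal q) volume := memLp_const _
    have h1 := tendsto_integral_zero_of_holder (h := fun n x =>
      g (χ x - w n x) - g (χ x - v x)) hone hwm hwp fun n x => by
        simpa using hdiff n x
    simp only [integral_sub (integrable_of_continuous (hgw _))
      (hgmem.integrable (by simpa using hs))] at h1
    simpa using h1.add_const (∫ x, g (χ x - v x))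
  have hDm : MemLp (fun x => torusGrad χ x - F x) (ENNReal.ofReal (p * r)) volume :=
    (memLp_of_continuous hχ.continuous_torusGrad _).sub hv.memLp_grad
  have iD := integrable_inner_flux hpq hr hH hm hG hDm
  -- The gradient of χ - w n is split into the limit gradient Dχ - F, treated here by dominated
  -- convergence, and the error F - Dw n, which Hölder sends to zero because |g'| ≤ 1 and the flux
  -- lies in the dual space.
  have l2a : Tendsto (fun n => ∫ x, g' (χ x - w n x) *
      inner ℝ (m x • gradient (H x) (G x)) (torusGrad χ x - F x)) atTop
      (𝓝 (∫ x, g' (χ x - v x) *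
        inner ℝ (m x • gradient (H x) (G x)) (torusGrad χ x - F x))) := by
    refine tendsto_integral_of_dominated_convergence _ (fun n => ?_) iD.norm (fun n => ?_) ?_
    · exact (hg'.comp (hχ.continuous.sub (hwC n).continuous)).aestronglyMeasurable.mul iD.1
    · refine ae_of_all _ fun x => ?_
      rw [norm_mul]
      exact mul_le_of_le_one_left (norm_nonneg _) (hg1 _)
    · filter_upwards [hae] with x hx
      exact ((hg'.tendsto _).comp (tendsto_const_nhds.sub hx)).mul_const _
  have l2b := tendsto_integral_zero_of_holder (h := fun n x => g' (χ x - w n x) *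
      inner ℝ (m x • gradient (H x) (G x)) (torusGrad (w n) x - F x)) hflux hwGm hw2 fun n x => by
    rw [abs_mul]
    exact (mul_le_of_le_one_left (abs_nonneg _) (hg1 _)).trans (abs_real_inner_le_norm _ _)
  have hi1 : ∀ n, Integrable (fun x => g' (χ x - w n x) *
      inner ℝ (m x • gradient (H x) (G x)) (torusGrad χ x - F x)) volume := fun n =>
    iD.bdd_mul (hg'.comp (hχ.continuous.sub (hwC n).continuous)).aestronglyMeasurable
      (ae_of_all _ fun x => hg1 _)
  have hi2 : ∀ n, Integrable (fun x => g' (χ x - w n x) *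
      inner ℝ (m x • gradient (H x) (G x)) (torusGrad (w n) x - F x)) volume := fun n =>
    (integrable_inner_flux hpq hr hH hm hG
      ((memLp_of_continuous (hwC n).continuous_torusGrad _).sub hv.memLp_grad)).bdd_mul
      (hg'.comp (hχ.continuous.sub (hwC n).continuous)).aestronglyMeasurable
      (ae_of_all _ fun x => hg1 _)
  have heq : ∀ n, ε * (∫ x, m x * g (χ x - w n x)) +
      ((∫ x, g' (χ x - w n x) *
        inner ℝ (m x • gradient (H x) (G x)) (torusGrad χ x - F x)) -
      ∫ x, g' (χ x - w n x) *
        inner ℝ (m x • gradient (H x) (G x)) (torusGrad (w n) x - F x))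
      = ε * ∫ x, g (χ x - w n x) := by
    intro n
    have hsub := hχ.sub (hwC n)
    rw [← h.transport _ (IsCn.comp (by exact_mod_cast hgC) hsub), ← integral_sub (hi1 n) (hi2 n)]
    congr 1
    refine integral_congr_ae (ae_of_all _ fun x => ?_)
    simp only [torusGrad_comp hsub x (hg _), torusGrad_sub hχ (hwC n), inner_smul_right,
      inner_sub_right]
    ring
  have hlim := (l1.const_mul ε).add (l2a.sub l2b)
  rw [sub_zero] at hlim
  simp only [heq] at hlim
  exact tendsto_nhds_unique hlim (l3.const_mul ε)

/-! ### A convex ramp -/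

/-- The derivative of `ramp`. -/
def clip (t : ℝ) : ℝ := max 0 (min t 1)

/-- A convex function of class `C^1` that vanishes exactly on the nonpositive numbers. -/
def ramp (t : ℝ) : ℝ := ∫ s in (0 : ℝ)..t, clip s

theorem continuous_clip : Continuous clip := by unfold clip; fun_prop

theorem clip_nonneg (t : ℝ) : 0 ≤ clip t := le_max_left _ _

theorem abs_clip_le (t : ℝ) : |clip t| ≤ 1 := by
  rw [abs_of_nonneg (clip_nonneg t)]
  exact max_le zero_le_one (min_le_right _ _)

theorem clip_of_nonpos {t : ℝ} (ht : t ≤ 0) : clip t = 0 :=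
  max_eq_left ((min_le_left _ _).trans ht)

theorem hasDerivAt_ramp (t : ℝ) : HasDerivAt ramp (clip t) t :=
  (continuous_clip.integral_hasStrictDerivAt 0 t).hasDerivAt

theorem monotone_clip : Monotone clip := fun _ _ h =>
  max_le_max_left _ (min_le_min_right _ h)

theorem ramp_zero : ramp 0 = 0 := intervalIntegral.integral_same

theorem ramp_of_nonpos {t : ℝ} (ht : t ≤ 0) : ramp t = 0 := by
  have : ramp t = ∫ _ in (0 : ℝ)..t, (0 : ℝ) :=
    intervalIntegral.integral_congr fun s hs => by
      rw [uIcc_of_ge ht] at hs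
      exact clip_of_nonpos hs.2
  rw [this]; simp

theorem ramp_pos {t : ℝ} (ht : 0 < t) : 0 < ramp t :=
  intervalIntegral.intervalIntegral_pos_of_pos_on (continuous_clip.intervalIntegrable _ _)
    (fun _ hs => lt_max_of_lt_right (lt_min hs.1 one_pos)) ht

theorem ramp_nonneg (t : ℝ) : 0 ≤ ramp t := by
  rcases le_or_gt t 0 with h | h
  · exact (ramp_of_nonpos h).ge
  · exact (ramp_pos h).le

/-- The tangent line of the convex function `ramp` at t, evaluated at 0. It compares the zero-order
and flux terms in the viscosity argument. -/
theorem ramp_le_mul_clip (t : ℝ) : ramp t ≤ t * clip t := by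
  have hconv : ConvexOn ℝ univ ramp :=
    Monotone.convexOn_univ_of_deriv (fun t => (hasDerivAt_ramp t).differentiableAt) (by
      rw [show deriv ramp = clip from funext fun t => (hasDerivAt_ramp t).deriv]
      exact monotone_clip)
  have := tangent_le hconv (hasDerivAt_ramp t) 0
  rw [ramp_zero] at this
  linarith

theorem continuous_ramp : Continuous ramp :=
  continuous_iff_continuousAt.2 fun t => (hasDerivAt_ramp t).continuousAt

theorem ramp_le_abs (t : ℝ) : ramp t ≤ |t| := by
  refine (ramp_le_mul_clip t).trans ((le_abs_self _).trans ?_)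
  rw [abs_mul]
  exact mul_le_of_le_one_right (abs_nonneg _) (abs_clip_le t)

/-! ### Uniqueness -/

/-- The pointwise form of the monotonicity argument. -/
theorem monotonicity_pointwise (hf : IsCoupling f q) (hH : IsHamiltonian H r) (hε : 0 < ε)
    {x : Torus d} {u₁ u₂ m₁ m₂ : ℝ} {ξ₁ ξ₂ : Space d} (hm₁ : 0 ≤ m₁) (hm₂ : 0 ≤ m₂)
    (he₁ : 0 < m₁ → ε * u₁ + H x ξ₁ = f x m₁) (he₂ : 0 < m₂ → ε * u₂ + H x ξ₂ = f x m₂)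
    (hl₁ : ε * u₁ + H x ξ₁ ≤ f x m₁) (hl₂ : ε * u₂ + H x ξ₂ ≤ f x m₂) :
    0 ≤ ε * (m₁ * (u₁ - u₂)) + inner ℝ (m₁ • gradient (H x) ξ₁) (ξ₁ - ξ₂)
      - (ε * (m₂ * (u₁ - u₂)) + inner ℝ (m₂ • gradient (H x) ξ₂) (ξ₁ - ξ₂)) ∧
    (ε * (m₁ * (u₁ - u₂)) + inner ℝ (m₁ • gradient (H x) ξ₁) (ξ₁ - ξ₂)
      - (ε * (m₂ * (u₁ - u₂)) + inner ℝ (m₂ • gradient (H x) ξ₂) (ξ₁ - ξ₂)) = 0 →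
      m₁ = m₂ ∧ (0 < m₁ → u₁ = u₂)) := by
  simp only [inner_smul_left, conj_trivial]
  set b₁ := inner ℝ (gradient (H x) ξ₁) (ξ₁ - ξ₂) with hb₁
  set b₂ := inner ℝ (gradient (H x) ξ₂) (ξ₁ - ξ₂)
  have hneg : inner ℝ (gradient (H x) ξ₁) (ξ₂ - ξ₁) = -b₁ := by
    rw [hb₁, ← inner_neg_right, neg_sub]
  have g₁ := hH.gradient_inner_le x ξ₁ ξ₂
  have g₂ := hH.gradient_inner_le x ξ₂ ξ₁
  rw [hneg] at g₁
  have p₁ : m₁ * (ε * u₁ + H x ξ₁) = m₁ * f x m₁ := by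
    rcases hm₁.eq_or_lt with h | h
    · rw [← h]; simp
    · rw [he₁ h]
  have p₂ : m₂ * (ε * u₂ + H x ξ₂) = m₂ * f x m₂ := by
    rcases hm₂.eq_or_lt with h | h
    · rw [← h]; simp
    · rw [he₂ h]
  -- Where one density vanishes and the other does not, only the inequality εu + H ≤ f is available;
  -- it is multiplied by the other density, which has the favourable sign.
  have p₃ := mul_le_mul_of_nonneg_left hl₂ hm₁
  have p₄ := mul_le_mul_of_nonneg_left hl₁ hm₂
  have c₁ : m₁ * (H x ξ₁ - H x ξ₂) ≤ m₁ * b₁ := mul_le_mul_of_nonneg_left (by linarith) hm₁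
  have c₂ : m₂ * b₂ ≤ m₂ * (H x ξ₁ - H x ξ₂) := mul_le_mul_of_nonneg_left (by linarith) hm₂
  have key : (m₁ - m₂) * (f x m₁ - f x m₂)
      ≤ ε * (m₁ * (u₁ - u₂)) + m₁ * (H x ξ₁ - H x ξ₂)
        - (ε * (m₂ * (u₁ - u₂)) + m₂ * (H x ξ₁ - H x ξ₂)) := by nlinarith
  have hmono : 0 ≤ (m₁ - m₂) * (f x m₁ - f x m₂) := by
    rcases le_total m₁ m₂ with h | h
    · have := (hf.strictMonoOn x).monotoneOn hm₁ hm₂ h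
      exact mul_nonneg_of_nonpos_of_nonpos (by linarith) (by linarith)
    · have := (hf.strictMonoOn x).monotoneOn hm₂ hm₁ h
      exact mul_nonneg (by linarith) (by linarith)
  refine ⟨by linarith, fun h0 => ?_⟩
  have hzero : (m₁ - m₂) * (f x m₁ - f x m₂) = 0 := le_antisymm (by linarith) hmono
  have heq : m₁ = m₂ := by
    rcases mul_eq_zero.1 hzero with h | h
    · linarith
    · exact (hf.strictMonoOn x).injOn hm₁ hm₂ (by linarith)
  refine ⟨heq, fun hpos => ?_⟩
  subst heq
  -- Equality with positive density contradicts the strict tangent inequality unless the gradients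
  -- agree; then the two Hamilton–Jacobi equations give equal values.
  have hξ : ξ₁ = ξ₂ := by
    by_contra hne
    have s₁ := hH.gradient_inner_lt x hne
    rw [hneg] at s₁
    have : m₁ * (H x ξ₁ - H x ξ₂) < m₁ * b₁ := mul_lt_mul_of_pos_left (by linarith) hpos
    linarith
  subst hξ
  have := (he₁ hpos).trans (he₂ hpos).symm
  exact mul_left_cancel₀ hε.ne' (by linarith)

end

/-! ### Uniqueness: integrated monotonicity and comparison where the density vanishes -/

section

variable {d : ℕ} {p q r ε : ℝ} {f : Torus d → ℝ → ℝ} {H : Torus d → Space d → ℝ}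

theorem IsSobolev.sub {s : ℝ} (hs : 1 ≤ s) {u v : Torus d → ℝ} {F G : Torus d → Space d}
    (hu : IsSobolev s u F) (hv : IsSobolev s v G) :
    IsSobolev s (fun x => u x - v x) (fun x => F x - G x) := by
  simpa [sub_eq_add_neg] using hu.add hs (hv.const_mul (-1))

/-- `transport_comp` with χ = 0, with g the identity, and with -v in place of v. -/
theorem WeakSystem.transport_sobolev (hpq : p.HolderConjugate q) (hr : 1 < r)
    (hH : IsHamiltonian H r) {u m : Torus d → ℝ} {G : Torus d → Space d}
    (h : WeakSystem ε H f u G m) (hm : MemLp m (ENNReal.ofReal q) volume)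
    (hG : MemLp G (ENNReal.ofReal (p * r)) volume) {v : Torus d → ℝ} {F : Torus d → Space d}
    (hv : IsSobolev (p * r) v F) :
    ε * (∫ x, m x * v x) + ∫ x, inner ℝ (m x • gradient (H x) (G x)) (F x) = ε * ∫ x, v x := by
  have := h.transport_comp hpq hr hH hm hG (hv.const_mul (-1)) (isCn_const 0)
    (g := fun t => t) (g' := fun _ => 1) (fun t => hasDerivAt_id t) continuous_const
    (fun _ => by simp)
  simpa [torusGrad_const] using this

/-- Both transport equations, tested with u₁ - u₂, have the same right-hand side. The difference of
the left sides is the integral of a nonnegative function, which therefore vanishes almost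
everywhere. -/
theorem ae_eq_of_weakSystem (hpq : p.HolderConjugate q) (hr : 1 < r) (hε : 0 < ε)
    (hf : IsCoupling f q) (hH : IsHamiltonian H r) {u₁ u₂ m₁ m₂ : Torus d → ℝ}
    {G₁ G₂ : Torus d → Space d} (h₁ : WeakSystem ε H f u₁ G₁ m₁) (h₂ : WeakSystem ε H f u₂ G₂ m₂)
    (hm₁ : MemLp m₁ (ENNReal.ofReal q) volume) (hm₂ : MemLp m₂ (ENNReal.ofReal q) volume)
    (hu₁ : IsSobolev (p * r) u₁ G₁) (hu₂ : IsSobolev (p * r) u₂ G₂) :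
    ∀ᵐ x, m₁ x = m₂ x ∧ (0 < m₁ x → u₁ x = u₂ x) := by
  have hs : 1 ≤ p * r := by have := hpq.lt; nlinarith
  have hv := hu₁.sub hs hu₂
  have t₁ := h₁.transport_sobolev hpq hr hH hm₁ hu₁.memLp_grad hv
  have t₂ := h₂.transport_sobolev hpq hr hH hm₂ hu₂.memLp_grad hv
  have i₁ := (integrable_mul_memLp hpq hr hm₁ hv.memLp).const_mul ε
  have i₂ := (integrable_mul_memLp hpq hr hm₂ hv.memLp).const_mul ε
  have j₁ := integrable_inner_flux hpq hr hH hm₁ hu₁.memLp_grad hv.memLp_grad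
  have j₂ := integrable_inner_flux hpq hr hH hm₂ hu₂.memLp_grad hv.memLp_grad
  rw [← integral_const_mul, ← integral_add i₁ j₁] at t₁
  rw [← integral_const_mul, ← integral_add i₂ j₂] at t₂
  have key := sub_eq_zero.2 (t₁.trans t₂.symm)
  have k₁ : Integrable (fun x => ε * (m₁ x * (u₁ x - u₂ x)) +
      inner ℝ (m₁ x • gradient (H x) (G₁ x)) (G₁ x - G₂ x)) volume := i₁.add j₁
  have k₂ : Integrable (fun x => ε * (m₂ x * (u₁ x - u₂ x)) +
      inner ℝ (m₂ x • gradient (H x) (G₂ x)) (G₁ x - G₂ x)) volume := i₂.add j₂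
  rw [← integral_sub k₁ k₂] at key
  set D : Torus d → ℝ := fun x => ε * (m₁ x * (u₁ x - u₂ x)) +
    inner ℝ (m₁ x • gradient (H x) (G₁ x)) (G₁ x - G₂ x) - (ε * (m₂ x * (u₁ x - u₂ x)) +
      inner ℝ (m₂ x • gradient (H x) (G₂ x)) (G₁ x - G₂ x))
  have hpt : ∀ᵐ x, 0 ≤ D x ∧ (D x = 0 → m₁ x = m₂ x ∧ (0 < m₁ x → u₁ x = u₂ x)) := by
    filter_upwards [h₁.nonneg, h₂.nonneg, h₁.eq_on_pos, h₂.eq_on_pos, h₁.le_ae, h₂.le_ae]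
      with x a b c e k l
    exact monotonicity_pointwise hf hH hε a b c e k l
  have hzero := (integral_eq_zero_iff_of_nonneg_ae (hpt.mono fun x hx => hx.1)
    (k₁.sub k₂)).1 key
  filter_upwards [hpt, hzero] with x hx h0
  exact hx.2 h0

/-- The test function `ramp (u - v)` and its derivative vanish wherever m > 0, so both terms on the
left of the transport equation are zero. There remains ε∫ ramp(u - v) = 0: the source term reaches
the set where m = 0. -/
theorem ae_le_of_ae_eq_on_pos (hpq : p.HolderConjugate q) (hr : 1 < r) (hε : 0 < ε)
    (hH : IsHamiltonian H r) {u v m : Torus d → ℝ} {G F : Torus d → Space d}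
    (h : WeakSystem ε H f u G m) (hm : MemLp m (ENNReal.ofReal q) volume)
    (hu : IsSobolev (p * r) u G) (hv : IsSobolev (p * r) v F)
    (heq : ∀ᵐ x, 0 < m x → u x = v x) : ∀ᵐ x, u x ≤ v x := by
  have hs : 1 ≤ p * r := by have := hpq.lt; nlinarith
  have hw := hv.sub hs hu
  have key := h.transport_comp hpq hr hH hm hu.memLp_grad hw (isCn_const 0) hasDerivAt_ramp
    continuous_clip abs_clip_le
  have hcase : ∀ᵐ x, m x = 0 ∨ 0 - (v x - u x) = 0 := by
    filter_upwards [heq, h.nonneg] with x hx h0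
    rcases h0.eq_or_lt with h1 | h1
    · exact Or.inl h1.symm
    · exact Or.inr (by rw [hx h1]; ring)
  have z₁ : ∫ x, m x * ramp (0 - (v x - u x)) = 0 := integral_eq_zero_of_ae <| by
    filter_upwards [hcase] with x hx
    rcases hx with hx | hx <;> simp [hx, ramp_zero]
  have z₂ : ∫ x, clip (0 - (v x - u x)) * inner ℝ (m x • gradient (H x) (G x))
      (torusGrad (fun _ => 0) x - (F x - G x)) = 0 := integral_eq_zero_of_ae <| by
    filter_upwards [hcase] with x hx
    rcases hx with hx | hx
    · simp [hx]
    · simp [hx, clip_of_nonpos le_rfl]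
  rw [z₁, z₂, mul_zero, zero_add] at key
  have hint : Integrable (fun x => ramp (0 - (v x - u x))) volume := by
    have hi := hw.integrable hs
    refine hi.norm.mono' (continuous_ramp.comp_aestronglyMeasurable
      (aestronglyMeasurable_const.sub hi.1)) (ae_of_all _ fun x => ?_)
    rw [Real.norm_of_nonneg (ramp_nonneg _)]
    refine (ramp_le_abs _).trans_eq ?_
    rw [zero_sub, abs_neg, Real.norm_eq_abs]
  have h0 : ∫ x, ramp (0 - (v x - u x)) = 0 := by
    rcases mul_eq_zero.1 key.symm with h | h
    · exact absurd h hε.ne'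
    · exact h
  filter_upwards [(integral_eq_zero_iff_of_nonneg (fun x => ramp_nonneg _) hint).1 h0] with x hx
  by_contra hlt
  have := ramp_pos (t := 0 - (v x - u x)) (by linarith)
  exact this.ne' hx

theorem IsWeakSolution.unique (hpq : p.HolderConjugate q) (hr : 1 < r) (hε : 0 < ε)
    (hf : IsCoupling f q) (hH : IsHamiltonian H r) {u₁ u₂ : W1 d (p * r)}
    {m₁ m₂ : Lp ℝ (ENNReal.ofReal q) (volume : Measure (Torus d))}
    (h₁ : IsWeakSolution ε H f u₁ m₁) (h₂ : IsWeakSolution ε H f u₂ m₂) : u₁ = u₂ ∧ m₁ = m₂ := by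
  obtain ⟨G₁, hG₁, hg₁, s₁⟩ := h₁
  obtain ⟨G₂, hG₂, hg₂, s₂⟩ := h₂
  have S₁ : IsSobolev (p * r) u₁.1 G₁ := ⟨Lp.memLp _, hG₁, hg₁⟩
  have S₂ : IsSobolev (p * r) u₂.1 G₂ := ⟨Lp.memLp _, hG₂, hg₂⟩
  have key := ae_eq_of_weakSystem hpq hr hε hf hH s₁ s₂ (Lp.memLp _) (Lp.memLp _) S₁ S₂
  have l₁ := ae_le_of_ae_eq_on_pos hpq hr hε hH s₁ (Lp.memLp _) S₁ S₂ (key.mono fun x hx => hx.2)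
  have l₂ := ae_le_of_ae_eq_on_pos hpq hr hε hH s₂ (Lp.memLp _) S₂ S₁
    (key.mono fun x hx h => (hx.2 (hx.1 ▸ h)).symm)
  refine ⟨Subtype.ext (Lp.ext ?_), Lp.ext (key.mono fun x hx => hx.1)⟩
  filter_upwards [l₁, l₂] with x a b
  exact le_antisymm a b

/-! ### The viscosity property -/

theorem gauge_sub_isCn (x₀ : Torus d) : IsCn 1 fun x : Torus d => gauge (x - x₀) := by
  simpa [sub_eq_add_neg] using (isCn_gauge.of_le le_top).comp_add_right (-x₀)

/-- The point x₀ is a minimum of the translated gauge, so adding a multiple of it leaves the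
gradient of a test function at x₀ unchanged. -/
theorem torusGrad_gauge_sub (x₀ : Torus d) : torusGrad (fun x : Torus d => gauge (x - x₀)) x₀ = 0 := by
  have h := ((gauge_sub_isCn x₀).hasGradientAt_zero x₀).hasFDerivAt
  have hmin : IsLocalMin (fun y : Space d => gauge (x₀ + toTorus y - x₀)) 0 :=
    Eventually.of_forall fun y => by
      simpa using gauge_nonneg _
  exact (InnerProductSpace.toDual ℝ (Space d)).map_eq_zero_iff.1 (hmin.hasFDerivAt_eq_zero h)

/-- At a local minimum of `w - ψ` one can replace `ψ` by a function with the same `1`-jet such that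
the minimum is global and strict. -/
theorem exists_global_test {w : C(Torus d, ℝ)} {ψ : Torus d → ℝ} (hψ : IsCn 1 ψ) {x₀ : Torus d}
    (hmin : IsLocalMin (fun x => w x - ψ x) x₀) :
    ∃ φ : Torus d → ℝ, IsCn 1 φ ∧ φ x₀ = w x₀ ∧ torusGrad φ x₀ = torusGrad ψ x₀ ∧
      ∀ x, gauge (x - x₀) ≤ w x - φ x := by
  have hN : {y : Torus d | w x₀ - ψ x₀ ≤ w (y + x₀) - ψ (y + x₀)} ∈ 𝓝 (0 : Torus d) := by
    have hc : Tendsto (fun y : Torus d => y + x₀) (𝓝 0) (𝓝 x₀) := by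
      simpa using (continuous_add_const x₀).tendsto (0 : Torus d)
    exact hc.eventually hmin
  obtain ⟨δ, hδ, hsub⟩ := exists_gauge_lt_subset hN
  obtain ⟨L, hL, hbd⟩ := exists_bound_of_continuous
    ((w.continuous.sub hψ.continuous).sub (continuous_const (y := w x₀ - ψ x₀)))
  have hθ := gauge_sub_isCn x₀
  -- The part L/δ makes the minimum global, by compensating for the possible deficit L where the
  -- gauge is at least δ; the extra 1 provides the strict margin.
  set K := L / δ + 1 with hK
  have hK0 : 0 ≤ L / δ := by positivity
  have hKθ : IsCn 1 fun x : Torus d => K * gauge (x - x₀) := (isCn_const K).mul hθ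
  have h1 : IsCn 1 fun x => ψ x - K * gauge (x - x₀) := hψ.sub hKθ
  refine ⟨fun x => ψ x - K * gauge (x - x₀) + (w x₀ - ψ x₀), h1.add (isCn_const _), by simp, ?_,
    fun x => ?_⟩
  · rw [torusGrad_add h1 (isCn_const _), torusGrad_sub hψ hKθ, torusGrad_const,
      torusGrad_mul (isCn_const K) hθ, torusGrad_gauge_sub, torusGrad_const]
    simp
  · have hg := gauge_nonneg (x - x₀)
    rcases lt_or_ge (gauge (x - x₀)) δ with h | h
    · have h2 := hsub _ h
      simp only [mem_ofPred_eq, sub_add_cancel] at h2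
      have h3 := mul_nonneg hK0 hg
      change gauge (x - x₀) ≤ w x - (ψ x - (L / δ + 1) * gauge (x - x₀) + (w x₀ - ψ x₀))
      linarith
    · have h2 : -L ≤ w x - ψ x - (w x₀ - ψ x₀) := (abs_le.1 (hbd x)).1
      have h3 : L ≤ L / δ * gauge (x - x₀) := by
        rw [div_mul_eq_mul_div, le_div_iff₀ hδ]
        exact mul_le_mul_of_nonneg_left h hL
      change gauge (x - x₀) ≤ w x - (ψ x - (L / δ + 1) * gauge (x - x₀) + (w x₀ - ψ x₀))
      linarith

/-- If the property failed, the raised test function φ + δ would be a strict subsolution with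
right-hand side f(x,0) on {φ + δ > w}. Testing the transport equation with `ramp (φ + δ - w)` makes
the left side nonpositive and the right side positive. -/
theorem WeakSystem.isViscositySupersolution (hpq : p.HolderConjugate q) (hr : 1 < r) (hε : 0 < ε)
    (hf : IsCoupling f q) (hH : IsHamiltonian H r) {w : C(Torus d, ℝ)} {m : Torus d → ℝ}
    {G : Torus d → Space d} (h : WeakSystem ε H f w G m)
    (hm : MemLp m (ENNReal.ofReal q) volume) (hw : IsSobolev (p * r) w G) :
    IsViscositySupersolution ε H (fun x => f x 0) w := by
  intro ψ hψ x₀ hmin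
  by_contra hlt
  push Not at hlt
  obtain ⟨φ, hφ, hφ0, hDφ, hφmin⟩ := exists_global_test hψ hmin
  set e : Torus d → ℝ := fun x => ε * φ x + H x (torusGrad φ x) - f x 0 with he
  have hec : Continuous e :=
    ((hφ.continuous.const_mul ε).add (hH.continuous.comp
      (continuous_id.prodMk hφ.continuous_torusGrad))).sub hf.continuous_zero
  have he0 : e x₀ < 0 := by
    simp only [he, hφ0, hDφ]
    linarith
  have hU : {y : Torus d | e (y + x₀) < e x₀ / 2} ∈ 𝓝 (0 : Torus d) := by
    have hc : ContinuousAt (fun y : Torus d => e (y + x₀)) 0 :=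
      (hec.comp (continuous_add_const x₀)).continuousAt
    refine hc.eventually (Iio_mem_nhds ?_)
    simp only [zero_add]
    linarith
  obtain ⟨δ₁, hδ₁, hsub⟩ := exists_gauge_lt_subset hU
  have hκ : 0 < -(e x₀ / 2) / ε := div_pos (by linarith) hε
  -- The bound δ₁ confines {φ + δ > w} to the neighbourhood where e < e x₀ / 2; the other bound
  -- keeps εδ from using up that margin.
  set δ := min δ₁ (-(e x₀ / 2) / ε) with hδ
  have hδ0 : 0 < δ := lt_min hδ₁ hκ
  have hδε : ε * δ ≤ -(e x₀ / 2) := by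
    have := mul_le_mul_of_nonneg_left (min_le_right δ₁ (-(e x₀ / 2) / ε)) hε.le
    rwa [mul_div_cancel₀ _ hε.ne'] at this
  have hχ : IsCn 1 fun x => φ x + δ := hφ.add (isCn_const δ)
  have hDχ : ∀ x, torusGrad (fun x => φ x + δ) x = torusGrad φ x := fun x => by
    rw [torusGrad_add hφ (isCn_const δ), torusGrad_const, add_zero]
  have hstrict : ∀ x, 0 < φ x + δ - w x → ε * (φ x + δ) + H x (torusGrad φ x) < f x 0 := by
    intro x hx
    have h1 : gauge (x - x₀) < δ₁ := by
      have := hφmin x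
      exact lt_of_lt_of_le (by linarith) (min_le_left δ₁ (-(e x₀ / 2) / ε))
    have h2 := hsub _ h1
    simp only [mem_ofPred_eq, sub_add_cancel, he] at h2
    simp only [he] at hδε
    linarith
  have key := h.transport_comp hpq hr hH hm hw.memLp_grad hw hχ hasDerivAt_ramp
    continuous_clip abs_clip_le
  simp only [hDχ] at key
  have hcont : Continuous fun x => ramp (φ x + δ - w x) :=
    continuous_ramp.comp (hχ.continuous.sub w.continuous)
  have hpos : 0 < ∫ x, ramp (φ x + δ - w x) := by
    refine hcont.integral_pos_of_hasCompactSupport_nonneg_nonzero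
      (HasCompactSupport.of_compactSpace _) (fun x => ramp_nonneg _) (x := x₀) ?_
    rw [hφ0, add_sub_cancel_left]
    exact (ramp_pos hδ0).ne'
  have i₁ : Integrable (fun x => ε * (m x * ramp (φ x + δ - w x))) volume :=
    (integrable_mul_memLp hpq hr hm (memLp_of_continuous hcont _)).const_mul ε
  have i₂ : Integrable (fun x => clip (φ x + δ - w x) *
      inner ℝ (m x • gradient (H x) (G x)) (torusGrad φ x - G x)) volume :=
    (integrable_inner_flux hpq hr hH hm hw.memLp_grad
      ((memLp_of_continuous hφ.continuous_torusGrad _).sub hw.memLp_grad)).bdd_mul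
      (continuous_clip.comp (hχ.continuous.sub w.continuous)).aestronglyMeasurable
      (ae_of_all _ fun x => abs_clip_le _)
  rw [← integral_const_mul, ← integral_add i₁ i₂] at key
  have hnonpos : ∫ x, (ε * (m x * ramp (φ x + δ - w x)) + clip (φ x + δ - w x) *
      inner ℝ (m x • gradient (H x) (G x)) (torusGrad φ x - G x)) ≤ 0 := by
    refine integral_nonpos_of_ae ?_
    filter_upwards [h.nonneg, h.eq_on_pos] with x h0 heq
    simp only [Pi.zero_apply, inner_smul_left, conj_trivial]
    rcases le_or_gt (φ x + δ - w x) 0 with ht | ht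
    · simp [ramp_of_nonpos ht, clip_of_nonpos ht]
    · rcases h0.eq_or_lt with hm0 | hm0
      · simp [← hm0]
      · have e1 := heq hm0
        have e2 := hstrict x ht
        have e3 := hf.strictMonoOn x self_mem_Ici hm0.le hm0
        have e4 := hH.gradient_inner_le x (G x) (torusGrad φ x)
        -- The tangent inequality bounds the left side by H(x,Dφ) - H(x,G). Strictness of φ + δ, the
        -- equation for w and f(x,m) > f(x,0) then leave only the zero-order difference.
        have e5 : inner ℝ (gradient (H x) (G x)) (torusGrad φ x - G x)
            ≤ -(ε * (φ x + δ - w x)) := by linarith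
        have e6 := mul_le_mul_of_nonneg_left e5 (mul_nonneg (clip_nonneg (φ x + δ - w x)) hm0.le)
        have e7 := mul_le_mul_of_nonneg_left (ramp_le_mul_clip (φ x + δ - w x))
          (mul_nonneg hε.le hm0.le)
        linarith
  have := mul_pos hε hpos
  linarith

theorem IsWeakSolution.exists_viscositySupersolution (hpq : p.HolderConjugate q) (hr : 1 < r)
    (hε : 0 < ε) (hf : IsCoupling f q) (hH : IsHamiltonian H r) (hd : (d : ℝ) < p * r)
    {u : W1 d (p * r)} {m : Lp ℝ (ENNReal.ofReal q) (volume : Measure (Torus d))}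
    (h : IsWeakSolution ε H f u m) :
    ∃ v : C(Torus d, ℝ), (∀ᵐ x, u.1 x = v x) ∧
      IsViscositySupersolution ε H (fun x => f x 0) v := by
  obtain ⟨G, hG, hg, hsys⟩ := h
  have S : IsSobolev (p * r) u.1 G := ⟨Lp.memLp _, hG, hg⟩
  obtain ⟨v, hv⟩ := S.exists_continuous (by have := hpq.lt; nlinarith) hd
  have hv' : v =ᵐ[volume] u.1 := hv.mono fun x hx => hx.symm
  exact ⟨v, hv, (hsys.congr hv' (ae_eq_refl _)).isViscositySupersolution hpq hr hε hf hH
    (Lp.memLp _) ⟨memLp_of_continuous v.continuous _, hG, hg.congr hv'⟩⟩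

end

end DiscountMFG

end

open DiscountMFG in
theorem theorem1 (d : ℕ) (hd : 0 < d) (p q r : ℝ) (hq : 1 < q) (hr : 1 < r)
    (hpq : 1 / p + 1 / q = 1)
    (f : Torus d → ℝ → ℝ) (hf : IsCoupling f q)
    (H : Torus d → Space d → ℝ) (hH : IsHamiltonian H r)
    (ε : ℝ) (hε : 0 < ε) :
    (∃! um : W1 d (p * r) × Lp ℝ (ENNReal.ofReal q) (volume : Measure (Torus d)),
      IsWeakSolution ε H f um.1 um.2) ∧
    ((d : ℝ) < p * r →
      ∀ (u : W1 d (p * r)) (m : Lp ℝ (ENNReal.ofReal q) (volume : Measure (Torus d))),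
        IsWeakSolution ε H f u m →
          ∃ v : C(Torus d, ℝ), (∀ᵐ x, u.1 x = v x) ∧
            IsViscositySupersolution ε H (fun x => f x 0) v) := by
  have hconj : p.HolderConjugate q := by
    rw [one_div, one_div, add_comm] at hpq
    exact (Real.holderConjugate_iff.2 ⟨hq, hpq⟩).symm
  refine ⟨?_, fun hds u m h => h.exists_viscositySupersolution hconj hr hε hf hH hds⟩
  obtain ⟨u, m, h⟩ := exists_isWeakSolution hconj hr hε hf hH
  refine ⟨(u, m), h, fun um h' => ?_⟩
  obtain ⟨e₁, e₂⟩ := IsWeakSolution.unique hconj hr hε hf hH h' h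
  exact Prod.ext e₁ e₂
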